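/- Conventions. All graphs are finite and simple. A circular-arc model $\mathcal{M}=(C,\mathcal{A})$ consists of a circle $C$ and a finite family $\mathcal{A}$ of open arcs $(s(A),t(A))$ of $C$ whose extremes (beginning points $s(A)$ and ending points $t(A)$) are pairwise different; in particular no single arc covers $C$. The intersection graph of $\mathcal{M}$ has the arcs as vertices, two different arcs being adjacent if and only if they have nonempty intersection; $\mathcal{M}$ is a model of every graph isomorphic to it. Two models are equivalent if their intersection graphs are isomorphic. A model is Helly (HCA) if every family of pairwise intersecting arcs has a common point, normal (NCA) if no two arcs together cover $C$, and normal Helly (NHCA) if it is both. A graph is an HCA (resp. NHCA) graph if it has an HCA (resp. NHCA) model. An induced submodel of $\mathcal{M}$ is the model formed by a subfamily of $\mathcal{A}$ on the same circle. Forbidden graphs. For $n\ge 4$, the $n$-wheel is the chordless cycle of length $n$ together with one further vertex adjacent to all vertices of the cycle. The $3$-sun is a triangle $x_0x_1x_2$ together with three further vertices $y_0,y_1,y_2$, where $y_k$ is adjacent exactly to $x_k$ and $x_{k+1}$ (indices modulo $3$). The umbrella is a path $p_1p_2p_3p_4p_5$ together with a vertex adjacent exactly to $p_1,\dots,p_5$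 and a vertex adjacent exactly to $p_3$. For $n\ge 4$, the $n$-rising sun is obtained from a path $v_2,\dots,v_{n-1}$ by first adding two vertices $v_1,v_n$ that are adjacent to each other and to all vertices of the path, and then adding three vertices $w_1,w_{n-1},w_n$, where $w_i$ is adjacent exactly to $v_i$ and $v_{i+1}$ (with $v_{n+1}=v_1$). Theorem. (a) Let $\mathcal{M}$ be an HCA model. Then $\mathcal{M}$ is equivalent to an NHCA model if and only if no induced submodel of $\mathcal{M}$ is a model of an $n$-wheel ($n\ge 4$), of the $3$-sun, of an $n$-rising sun ($n\ge 4$), or of the umbrella. (b) Let $G$ be an HCA graph. Then $G$ is an NHCA graph if and only if $G$ contains no $n$-wheel ($n\ge 4$), no $3$-sun, no $n$-rising sun ($n\ge 4$) and no umbrella as an induced subgraph. -/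

import Mathlib

/-- A circular-arc model whose arcs are indexed by the finite type `ι`: a finite family of open
arcs of a circle (the circle of circumference one).  The arc of index `i` is traversed from its
beginning point `s i` to its ending point `t i`; no two of the extremes coincide. -/
structure CircularArcModel (ι : Type*) [Finite ι] where
  /-- The beginning points of the arcs. -/
  s : ι → UnitAddCircle
  /-- The ending points of the arcs. -/
  t : ι → UnitAddCircle
  /-- All the extremes of the model are pairwise different. -/
  extremes_injective : Function.Injective (Sum.elim s t)

namespace CircularArcModel

/-- The open arc of index `i`: the points met strictly between `s i` and `t i` when the circle is
traversed from `s i` to `t i`. -/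
def arc {ι : Type*} [Finite ι] (M : CircularArcModel ι) (i : ι) : Set UnitAddCircle :=
  Set.cIoo (M.s i) (M.t i)

/-- The intersection graph of the arcs of a model. -/
def intersectionGraph {ι : Type*} [Finite ι] (M : CircularArcModel ι) : SimpleGraph ι where
  Adj i j := i ≠ j ∧ (M.arc i ∩ M.arc j).Nonempty
  symm := ⟨fun i j h => ⟨h.1.symm, by rw [Set.inter_comm]; exact h.2⟩⟩
  loopless := ⟨fun _ h => h.1 rfl⟩

/-- Two models are equivalent when their intersection graphs are isomorphic. -/
def Equivalent {ι κ : Type*} [Finite ι] [Finite κ]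
    (M : CircularArcModel ι) (N : CircularArcModel κ) : Prop :=
  Nonempty (M.intersectionGraph ≃g N.intersectionGraph)

/-- `M` is a model of the graph `G`. -/
def IsModelOf {ι V : Type*} [Finite ι] (M : CircularArcModel ι) (G : SimpleGraph V) : Prop :=
  Nonempty (M.intersectionGraph ≃g G)

/-- Helly circular-arc model: every family of pairwise intersecting arcs has a common point. -/
def IsHCA {ι : Type*} [Finite ι] (M : CircularArcModel ι) : Prop :=
  ∀ F : Set ι, (∀ i ∈ F, ∀ j ∈ F, (M.arc i ∩ M.arc j).Nonempty) →
    ∃ p : UnitAddCircle, ∀ i ∈ F, p ∈ M.arc i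

/-- Normal circular-arc model: no two arcs cover the circle. -/
def IsNCA {ι : Type*} [Finite ι] (M : CircularArcModel ι) : Prop :=
  ∀ i j : ι, i ≠ j → M.arc i ∪ M.arc j ≠ Set.univ

/-- Normal Helly circular-arc model. -/
def IsNHCA {ι : Type*} [Finite ι] (M : CircularArcModel ι) : Prop :=
  M.IsNCA ∧ M.IsHCA

/-- The submodel formed by the arcs whose index lies in `F`. -/
def submodel {ι : Type*} [Finite ι] (M : CircularArcModel ι) (F : Set ι) :
    CircularArcModel F where
  s i := M.s i
  t i := M.t i
  extremes_injective := by
    have h : Sum.elim (fun i : F => M.s i) (fun i : F => M.t i) =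
        Sum.elim M.s M.t ∘ Sum.map Subtype.val Subtype.val := by
      ext x
      cases x <;> rfl
    rw [h]
    exact M.extremes_injective.comp
      (Function.Injective.sumMap Subtype.val_injective Subtype.val_injective)

/-- Some subfamily of the arcs of `M` induces a submodel which is a model of `H`. -/
def HasInducedSubmodelOf {ι V : Type*} [Finite ι] (M : CircularArcModel ι)
    (H : SimpleGraph V) : Prop :=
  ∃ F : Set ι, (M.submodel F).IsModelOf H

end CircularArcModel

/-- Helly circular-arc graph: a graph that admits an HCA model. -/
def IsHCAGraph {V : Type*} (G : SimpleGraph V) : Prop :=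
  ∃ (ι : Type) (_ : Finite ι) (M : CircularArcModel ι), M.IsHCA ∧ M.IsModelOf G

/-- Normal Helly circular-arc graph: a graph that admits an NHCA model. -/
def IsNHCAGraph {V : Type*} (G : SimpleGraph V) : Prop :=
  ∃ (ι : Type) (_ : Finite ι) (M : CircularArcModel ι), M.IsNHCA ∧ M.IsModelOf G

/-- The `n`-wheel (used for `n ≥ 4`): a cycle on `n` vertices together with one universal vertex
`none`. -/
def wheelGraph (n : ℕ) : SimpleGraph (Option (Fin n)) :=
  SimpleGraph.fromRel fun x y => match x, y with
    | none, some _ => True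
    | some i, some j => (SimpleGraph.cycleGraph n).Adj i j
    | _, none => False

/-- The `3`-sun: a triangle `inl 0, inl 1, inl 2` and three further vertices `inr k`, where `inr k`
is adjacent exactly to `inl k` and `inl (k + 1)` (indices modulo `3`). -/
def threeSunGraph : SimpleGraph (Fin 3 ⊕ Fin 3) :=
  SimpleGraph.fromRel fun x y => match x, y with
    | Sum.inl _, Sum.inl _ => True
    | Sum.inl i, Sum.inr k => i = k ∨ i = k + 1
    | Sum.inr _, _ => False

/-- The umbrella: a path `0, 1, 2, 3, 4`, a vertex `5` adjacent to the five vertices of the path,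
and a vertex `6` adjacent only to the middle vertex `2` of the path. -/
def umbrellaGraph : SimpleGraph (Fin 7) :=
  SimpleGraph.fromEdgeSet
    {s(0, 1), s(1, 2), s(2, 3), s(3, 4),
     s(5, 0), s(5, 1), s(5, 2), s(5, 3), s(5, 4),
     s(6, 2)}

/-- The `n`-rising sun (used for `n ≥ 4`).  The vertex `inl i` stands for `v_{i+1}`, so that
`v_2, …, v_{n-1}` is a path to which the universal vertices `v_1` and `v_n` are added; the vertices
`inr 0`, `inr 1`, `inr 2` stand for `w_1`, `w_{n-1}`, `w_n`, where `w_i` is adjacent exactly to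
`v_i` and `v_{i+1}` (indices modulo `n`). -/
def risingSunGraph (n : ℕ) : SimpleGraph (Fin n ⊕ Fin 3) :=
  SimpleGraph.fromRel fun x y => match x, y with
    | Sum.inl i, Sum.inl j =>
        (i : ℕ) = 0 ∨ (i : ℕ) = n - 1 ∨ (j : ℕ) = (i : ℕ) + 1
    | Sum.inl i, Sum.inr 0 => (i : ℕ) = 0 ∨ (i : ℕ) = 1
    | Sum.inl i, Sum.inr 1 => (i : ℕ) = n - 2 ∨ (i : ℕ) = n - 1
    | Sum.inl i, Sum.inr 2 => (i : ℕ) = n - 1 ∨ (i : ℕ) = 0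
    | Sum.inr _, _ => False

/-! Necessity. Call adjacent vertices `A`, `B` a cover pair if, whenever `x` and `y` are equal or
adjacent, `x` lies in the closed neighbourhood of `A` or `y` in that of `B`. In a normal model the
arcs of a cover pair leave some point uncovered. Cut the circle there: the union of the two arcs
becomes an interval, and normality and the Helly property show that all arcs leave intervals on it
with the same intersections (`IsNHCA.exists_intervalOrder`). So an induced subgraph with a cover
pair is an interval graph. Each forbidden graph has a cover pair, yet is no interval graph: a wheel
contains a long chordless cycle, the others an asteroidal triple.

Sufficiency. If a Helly model is not normal, its graph is shown to be an interval graph, in the form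
of an interval order on the vertices; every interval graph has a normal Helly model
(`IntervalOrder.exists_isNHCA`). There are two cases.

If two non-universal arcs `A`, `B` cover the circle, they form a cover pair, and it is replaced by
one with closed neighbourhoods of largest total size. The vertices fall into five groups, from left
to right: those far from `B`; `A` and the common neighbours of `A` and `B` that see a vertex far
from `B`; the inner vertices, which are common neighbours seeing no far vertex; `B` and the
remaining common neighbours, which see a vertex far from `A`; those far from `A`. The second and
fourth groups are cliques. The outer groups are ordered by the model (`IsHCA.exists_sideOrder`), as
is each component of inner vertices (`IsHCA.exists_innerOrder`); the components are ordered among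
themselves by forbidden-subgraph arguments (`mayPrecede_total`). The resulting orientation of the
non-edges is transitive, and there is no induced four-cycle, so it is an interval order.

Otherwise every covering pair contains a universal arc. Then some point is missed by all
non-universal arcs, since a chain of such arcs around the circle would give a wheel with a universal
hub (`IsHCA.exists_notMem_of_universal`). Cutting there and replacing universal arcs by the whole
line gives intervals. -/

/-! ### Coordinates on the circle. -/

/-- The position in `[0, 1)` of a point of the circle, measured from the base point `q`. -/
noncomputable def circlePos (q x : UnitAddCircle) : ℝ := AddCircle.equivIco (1 : ℝ) 0 (x - q)

theorem circlePos_nonneg (q x : UnitAddCircle) : 0 ≤ circlePos q x :=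
  (AddCircle.equivIco (1 : ℝ) 0 (x - q)).2.1

theorem circlePos_lt_one (q x : UnitAddCircle) : circlePos q x < 1 := by
  have h := (AddCircle.equivIco (1 : ℝ) 0 (x - q)).2.2
  exact h.trans_eq (zero_add 1)

theorem coe_circlePos (q x : UnitAddCircle) : (circlePos q x : UnitAddCircle) = x - q :=
  AddCircle.coe_equivIco

theorem circlePos_injective (q : UnitAddCircle) : Function.Injective (circlePos q) := fun x y h =>
  sub_left_injective (by
    have := coe_circlePos q x
    rw [h, coe_circlePos q y] at this
    exact this.symm)

theorem circlePos_add_coe (q : UnitAddCircle) {r : ℝ} (h0 : 0 ≤ r) (h1 : r < 1) :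
    circlePos q (q + (r : UnitAddCircle)) = r := by
  rw [circlePos, add_sub_cancel_left]
  exact AddCircle.equivIco_coe_of_mem (p := (1 : ℝ)) (a := 0) ⟨h0, by simpa using h1⟩

theorem circlePos_self (q : UnitAddCircle) : circlePos q q = 0 := by
  simpa using circlePos_add_coe q le_rfl one_pos

theorem circlePos_pos {q x : UnitAddCircle} (h : x ≠ q) : 0 < circlePos q x :=
  lt_of_le_of_ne (circlePos_nonneg q x) fun h0 =>
    h (circlePos_injective q (h0.symm.trans (circlePos_self q).symm))

theorem add_coe_circlePos (q x : UnitAddCircle) : q + (circlePos q x : UnitAddCircle) = x := by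
  rw [coe_circlePos]; abel

/-- The circular order expressed through positions. -/
theorem sbtw_iff_circlePos (q a x b : UnitAddCircle) :
    sbtw a x b ↔ (circlePos q a < circlePos q x ∧ circlePos q x < circlePos q b) ∨
      (circlePos q x < circlePos q b ∧ circlePos q b < circlePos q a) ∨
      (circlePos q b < circlePos q a ∧ circlePos q a < circlePos q x) := by
  -- Differences of positions lie in `(-1, 1)`, so reducing them modulo the period adds at most one;
  -- this turns the circular order into comparisons of reals.
  have h1 : ∀ y : ℝ, -1 < y → y < 1 →
      toIcoMod one_pos 0 y = if 0 ≤ y then y else y + 1 := by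
    intro y hy hy'
    split_ifs with h
    · exact (toIcoMod_eq_self one_pos).2 ⟨h, by linarith⟩
    · rw [← toIcoMod_add_right]
      exact (toIcoMod_eq_self one_pos).2 ⟨by linarith, by linarith⟩
  have h2 : ∀ y : ℝ, -1 < y → y < 1 →
      toIocMod one_pos 0 y = if 0 < y then y else y + 1 := by
    intro y hy hy'
    split_ifs with h
    · exact (toIocMod_eq_self one_pos).2 ⟨h, by linarith⟩
    · rw [← toIocMod_add_right]
      exact (toIocMod_eq_self one_pos).2 ⟨by linarith, by linarith⟩
  have hsub : ∀ u v : UnitAddCircle,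
      v - u = ((circlePos q v - circlePos q u : ℝ) : UnitAddCircle) := by
    intro u v
    rw [AddCircle.coe_sub, coe_circlePos, coe_circlePos]; abel
  have key : ∀ u v w : UnitAddCircle, btw u v w ↔
      toIcoMod one_pos 0 (circlePos q v - circlePos q u) ≤
        toIocMod one_pos 0 (circlePos q w - circlePos q u) := by
    intro u v w
    change (QuotientAddGroup.equivIcoMod one_pos 0 (v - u) : ℝ) ≤
      QuotientAddGroup.equivIocMod one_pos 0 (w - u) ↔ _
    rw [hsub u v, hsub u w]
    rfl
  rw [sbtw_iff_not_btw, key]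
  have := circlePos_nonneg q a
  have := circlePos_nonneg q b
  have := circlePos_nonneg q x
  have := circlePos_lt_one q a
  have := circlePos_lt_one q b
  have := circlePos_lt_one q x
  rw [h1 _ (by linarith) (by linarith), h2 _ (by linarith) (by linarith)]
  grind

theorem mem_cIoo_iff (q a x b : UnitAddCircle) :
    x ∈ Set.cIoo a b ↔ (circlePos q a < circlePos q x ∧ circlePos q x < circlePos q b) ∨
      (circlePos q x < circlePos q b ∧ circlePos q b < circlePos q a) ∨
      (circlePos q b < circlePos q a ∧ circlePos q a < circlePos q x) :=
  sbtw_iff_circlePos q a x b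

/-- An arc missing the base point is convex in the position coordinate. -/
theorem mem_cIoo_of_between {q a b u v p : UnitAddCircle} (hq : q ∉ Set.cIoo a b)
    (hu : u ∈ Set.cIoo a b) (hv : v ∈ Set.cIoo a b) (h1 : circlePos q u < circlePos q p)
    (h2 : circlePos q p < circlePos q v) : p ∈ Set.cIoo a b := by
  rw [mem_cIoo_iff q] at *
  have := circlePos_self q
  have := circlePos_nonneg q a
  have := circlePos_nonneg q b
  have := circlePos_nonneg q u
  have := circlePos_nonneg q v
  grind

/-- The complement of an arc through the base point is convex in the position coordinate. -/
theorem notMem_cIoo_of_between {q a b u v p : UnitAddCircle} (hq : q ∈ Set.cIoo a b)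
    (hu : u ∉ Set.cIoo a b) (hv : v ∉ Set.cIoo a b) (h1 : circlePos q u < circlePos q p)
    (h2 : circlePos q p < circlePos q v) : p ∉ Set.cIoo a b := by
  rw [mem_cIoo_iff q] at *
  have := circlePos_self q
  have := circlePos_nonneg q a
  have := circlePos_nonneg q b
  have := circlePos_nonneg q u
  have := circlePos_nonneg q v
  grind

/-- An arc is the image of an open real interval of length less than one. -/
theorem exists_cIoo_eq_image {s t : UnitAddCircle} (h : s ≠ t) : ∃ a b : ℝ, a < b ∧ b < a + 1 ∧
    (a : UnitAddCircle) = s ∧ (b : UnitAddCircle) = t ∧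
    Set.cIoo s t = (fun x : ℝ => (x : UnitAddCircle)) '' Set.Ioo a b := by
  have ha : ((circlePos 0 s : ℝ) : UnitAddCircle) = s := by simpa using coe_circlePos 0 s
  -- The right end is the left end plus the length of the arc, not the position of `t`; it may
  -- exceed one when the arc passes through `0`.
  refine ⟨circlePos 0 s, circlePos 0 s + circlePos s t, ?_, ?_, ha, ?_, ?_⟩
  · linarith [circlePos_pos h.symm]
  · linarith [circlePos_lt_one s t]
  · rw [AddCircle.coe_add, ha, add_coe_circlePos]
  · ext x
    rw [mem_cIoo_iff s, circlePos_self]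
    constructor
    · intro hx
      refine ⟨circlePos 0 s + circlePos s x, ?_, ?_⟩
      · have := circlePos_nonneg s t
        constructor <;> grind
      · simp only [AddCircle.coe_add, ha, add_coe_circlePos]
    · rintro ⟨y, ⟨h1, h2⟩, rfl⟩
      have : circlePos s (y : UnitAddCircle) = y - circlePos 0 s := by
        rw [← circlePos_add_coe s (r := y - circlePos 0 s) (by linarith)
          (by linarith [circlePos_lt_one s t])]
        congr 1
        rw [AddCircle.coe_sub, ha]; abel
      left; rw [this]; constructor <;> linarith

/-! ### Induced paths. -/

/-- `f 0, …, f k` is an induced path of `G`. -/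
def IsInducedPath {V : Type*} (G : SimpleGraph V) (k : ℕ) (f : ℕ → V) : Prop :=
  ∀ i j, i < j → j ≤ k → f i ≠ f j ∧ (G.Adj (f i) (f j) ↔ j = i + 1)

/-- Two vertices joined by a walk whose vertices satisfy `D` are joined by an induced path, and if
the ends of the path are only required to lie in `S` and `T`, the path meets these sets only in its
ends. -/
theorem exists_isInducedPath {V : Type*} (G : SimpleGraph V) {D S T : V → Prop} {s t : V}
    (hs : S s) (ht : T t) (hD : D s)
    (h : Relation.ReflTransGen (fun u v => G.Adj u v ∧ D v) s t) :
    ∃ k f, IsInducedPath G k f ∧ S (f 0) ∧ T (f k) ∧ (∀ i ≤ k, D (f i)) ∧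
      (∀ i, 0 < i → i ≤ k → ¬ S (f i)) ∧ (∀ i < k, ¬ T (f i)) := by
  classical
  -- A shortest walk inside `D` from `S` to `T` works: a repetition, a chord, or a further vertex in
  -- `S` or an earlier one in `T` would allow a shorter one.
  let P : ℕ → Prop := fun k => ∃ f : ℕ → V, S (f 0) ∧ T (f k) ∧ (∀ i ≤ k, D (f i)) ∧
    ∀ i < k, G.Adj (f i) (f (i + 1))
  have hP : ∃ k, P k := by
    have aux : ∃ k, ∃ f : ℕ → V, S (f 0) ∧ f k = t ∧ (∀ i ≤ k, D (f i)) ∧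
        ∀ i < k, G.Adj (f i) (f (i + 1)) := by
      clear ht
      induction h with
      | refl => exact ⟨0, fun _ => s, hs, rfl, fun _ _ => hD, by simp⟩
      | @tail b c hb hbc ih =>
        obtain ⟨k, f, h0, hk, hf, ha⟩ := ih
        refine ⟨k + 1, fun i => if i ≤ k then f i else c, by simpa, by simp, ?_, ?_⟩
        · intro i hi
          by_cases hik : i ≤ k
          · simpa [hik] using hf i hik
          · simpa [hik] using hbc.2
        · intro i hi
          by_cases hik : i + 1 ≤ k
          · simpa [hik, show i ≤ k by omega] using ha i hik
          · have : i = k := by omega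
            subst this
            simpa [hk] using hbc.1
    obtain ⟨k, f, h0, hk, hf, ha⟩ := aux
    exact ⟨k, f, h0, hk ▸ ht, hf, ha⟩
  obtain ⟨f, h0, hk, hf, ha⟩ := Nat.find_spec hP
  set k := Nat.find hP with hkdef
  have hmin : ∀ m < k, ¬ P m := fun m hm => Nat.find_min hP hm
  refine ⟨k, f, ?_, h0, hk, hf, ?_, ?_⟩
  · intro i j hij hjk
    refine ⟨fun he => ?_, fun hadj => ?_, fun he => he ▸ ha i (by omega)⟩
    · refine hmin (k - (j - i)) (by omega) ⟨fun m => if m ≤ i then f m else f (m + (j - i)),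
        by simpa, ?_, ?_, ?_⟩
      · by_cases h1 : k - (j - i) ≤ i
        · have : j = k := by omega
          simp only [h1, if_true]
          rw [show k - (j - i) = i by omega, he, this]; exact hk
        · simp only [h1, if_false]
          rw [show k - (j - i) + (j - i) = k by omega]; exact hk
      · intro m hm
        dsimp only
        split_ifs
        · exact hf _ (by omega)
        · exact hf _ (by omega)
      · intro m hm
        dsimp only
        split_ifs with h1 h2
        · exact ha _ (by omega)
        · have : m = i := by omega
          subst this
          rw [he, show m + 1 + (j - m) = j + 1 by omega]
          exact ha _ (by omega)
        · omega
        · rw [show m + 1 + (j - i) = m + (j - i) + 1 by omega]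
          exact ha _ (by omega)
    · by_contra hne
      refine hmin (k - (j - i - 1)) (by omega)
        ⟨fun m => if m ≤ i then f m else f (m + (j - i - 1)), by simpa, ?_, ?_, ?_⟩
      · have h1 : ¬ k - (j - i - 1) ≤ i := by omega
        simp only [h1, if_false]
        rw [show k - (j - i - 1) + (j - i - 1) = k by omega]; exact hk
      · intro m hm
        dsimp only
        split_ifs
        · exact hf _ (by omega)
        · exact hf _ (by omega)
      · intro m hm
        dsimp only
        split_ifs with h1 h2
        · exact ha _ (by omega)
        · have : m = i := by omega
          subst this
          rw [show m + 1 + (j - m - 1) = j by omega]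
          exact hadj
        · omega
        · rw [show m + 1 + (j - i - 1) = m + (j - i - 1) + 1 by omega]
          exact ha _ (by omega)
  · intro i hi hik hS
    refine hmin (k - i) (by omega) ⟨fun m => f (m + i), by simpa using hS, ?_, ?_, ?_⟩
    · simpa [show k - i + i = k by omega] using hk
    · exact fun m hm => hf _ (by omega)
    · intro m hm
      have := ha (m + i) (by omega)
      rwa [show m + i + 1 = m + 1 + i by omega] at this
  · exact fun i hi hT => hmin i hi ⟨f, h0, hT, fun m hm => hf _ (by omega),
      fun m hm => ha _ (by omega)⟩

/-! ### Recognising the forbidden graphs. -/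

/-- A graph without the forbidden induced subgraphs. -/
structure ForbiddenFree {V : Type*} (G : SimpleGraph V) : Prop where
  wheel : ∀ n : ℕ, 4 ≤ n → ¬ (wheelGraph n).IsIndContained G
  sun : ¬ threeSunGraph.IsIndContained G
  risingSun : ∀ n : ℕ, 4 ≤ n → ¬ (risingSunGraph n).IsIndContained G
  umbrella : ¬ umbrellaGraph.IsIndContained G

section Forbidden

variable {V : Type*} {G : SimpleGraph V}

theorem IsInducedPath.adj_iff {k : ℕ} {f : ℕ → V} (h : IsInducedPath G k f) {i j : ℕ}
    (hi : i ≤ k) (hj : j ≤ k) : G.Adj (f i) (f j) ↔ j = i + 1 ∨ i = j + 1 := by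
  rcases lt_trichotomy i j with hij | rfl | hij
  · rw [(h i j hij hj).2]; omega
  · simp
  · rw [G.adj_comm, (h j i hij hi).2]; omega

theorem IsInducedPath.eq_of_eq {k : ℕ} {f : ℕ → V} (h : IsInducedPath G k f) {i j : ℕ}
    (hi : i ≤ k) (hj : j ≤ k) (he : f i = f j) : i = j := by
  rcases lt_trichotomy i j with hij | rfl | hij
  · exact absurd he (h i j hij hj).1
  · rfl
  · exact absurd he.symm (h j i hij hi).1

theorem isIndContained_of_adj_iff {W : Type*} {H : SimpleGraph W} (g : W → V)
    (hinj : Function.Injective g) (hadj : ∀ u v, G.Adj (g u) (g v) ↔ H.Adj u v) :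
    H.IsIndContained G :=
  ⟨⟨⟨g, hinj⟩, hadj _ _⟩⟩

theorem wheel_adj_none (n : ℕ) (i : Fin n) : (wheelGraph n).Adj none (some i) := by
  simp [wheelGraph]

theorem wheel_adj_some (n : ℕ) (i j : Fin n) :
    (wheelGraph n).Adj (some i) (some j) ↔ (SimpleGraph.cycleGraph n).Adj i j := by
  simp only [wheelGraph, SimpleGraph.fromRel_adj, ne_eq, Option.some.injEq]
  constructor
  · rintro ⟨-, h | h⟩
    · exact h
    · exact h.symm
  · exact fun h => ⟨h.ne, Or.inl h⟩

/-- An induced path with at least three vertices, an apex joined to its ends only, and a hub joined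
to all of these form a wheel. -/
theorem ForbiddenFree.no_wheel (hG : ForbiddenFree G) {k : ℕ} (hk : 2 ≤ k) {f : ℕ → V}
    (hf : IsInducedPath G k f) {z h : V} (hz0 : G.Adj z (f 0)) (hzk : G.Adj z (f k))
    (hz : ∀ i, 0 < i → i < k → z ≠ f i ∧ ¬ G.Adj z (f i)) (hhz : G.Adj h z)
    (hh : ∀ i ≤ k, G.Adj h (f i)) : False := by
  have hzne : ∀ i ≤ k, z ≠ f i := by
    intro i hi
    by_cases h0 : i = 0
    · subst h0; exact hz0.ne
    · by_cases h1 : i = k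
      · subst h1; exact hzk.ne
      · exact (hz i (by omega) (by omega)).1
  have hzadj : ∀ i ≤ k, (G.Adj z (f i) ↔ i = 0 ∨ i = k) := by
    intro i hi
    by_cases h0 : i = 0
    · subst h0; simp [hz0]
    · by_cases h1 : i = k
      · subst h1; simp [hzk]
      · simp [h0, h1, (hz i (by omega) (by omega)).2]
  let g : Option (Fin (k + 2)) → V
    | none => h
    | some i => if i.val ≤ k then f i.val else z
  have hcyc : ∀ i j : Fin (k + 2), (SimpleGraph.cycleGraph (k + 2)).Adj i j ↔
      (j.val = i.val + 1 ∨ i.val = j.val + 1 ∨ (i.val = 0 ∧ j.val = k + 1) ∨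
        (j.val = 0 ∧ i.val = k + 1)) := by
    intro i j
    rw [SimpleGraph.cycleGraph_adj']
    have := i.isLt
    have := j.isLt
    rcases lt_trichotomy i j with hij | rfl | hij
    · have h1 : (j - i).val = j.val - i.val := Fin.sub_val_of_le hij.le
      have h2 : (i - j).val = k + 2 - (j.val - i.val) := by
        rw [Fin.coe_sub_iff_lt.2 hij]
        have : i.val < j.val := hij
        omega
      have : i.val < j.val := hij
      omega
    · simp only [sub_self, Fin.val_zero]; omega
    · have h1 : (i - j).val = i.val - j.val := Fin.sub_val_of_le hij.le
      have h2 : (j - i).val = k + 2 - (i.val - j.val) := by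
        rw [Fin.coe_sub_iff_lt.2 hij]
        have : j.val < i.val := hij
        omega
      have : j.val < i.val := hij
      omega
  refine hG.wheel (k + 2) (by omega) (isIndContained_of_adj_iff g ?_ ?_)
  · rintro (_ | i) (_ | j) hij
    · rfl
    · exfalso
      simp only [g] at hij
      split_ifs at hij with h1
      · exact (hh _ h1).ne hij
      · exact hhz.ne hij
    · exfalso
      simp only [g] at hij
      split_ifs at hij with h1
      · exact (hh _ h1).ne hij.symm
      · exact hhz.ne hij.symm
    · simp only [g] at hij
      congr 1
      ext
      split_ifs at hij with h1 h2 h2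
      · exact hf.eq_of_eq h1 h2 hij
      · exact absurd hij.symm (hzne _ h1)
      · exact absurd hij (hzne _ h2)
      · omega
  · rintro (_ | i) (_ | j)
    · simp
    · simp only [wheel_adj_none, iff_true, g]
      split_ifs with h1
      · exact hh _ h1
      · exact hhz
    · rw [SimpleGraph.adj_comm, (wheelGraph _).adj_comm]
      simp only [wheel_adj_none, iff_true, g]
      split_ifs with h1
      · exact hh _ h1
      · exact hhz
    · rw [wheel_adj_some, hcyc]
      simp only [g]
      have := i.isLt
      have := j.isLt
      split_ifs with h1 h2 h2
      · rw [hf.adj_iff h1 h2]; omega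
      · rw [G.adj_comm, hzadj _ h1]; omega
      · rw [hzadj _ h2]; omega
      · simp only [G.irrefl, false_iff]; omega

theorem threeSun_adj_inl_inl (i j : Fin 3) :
    threeSunGraph.Adj (Sum.inl i) (Sum.inl j) ↔ i ≠ j := by
  simp [threeSunGraph]

theorem threeSun_adj_inl_inr (i k : Fin 3) :
    threeSunGraph.Adj (Sum.inl i) (Sum.inr k) ↔ i = k ∨ i = k + 1 := by
  simp [threeSunGraph]

theorem threeSun_not_adj_inr_inr (i k : Fin 3) :
    ¬ threeSunGraph.Adj (Sum.inr i) (Sum.inr k) := by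
  simp [threeSunGraph]

/-- A triangle `x₀x₁x₂` with three further vertices, each joined to exactly two of its vertices. -/
theorem ForbiddenFree.no_sun (hG : ForbiddenFree G) {x0 x1 x2 y0 y1 y2 : V}
    (h01 : G.Adj x0 x1) (h02 : G.Adj x0 x2) (h12 : G.Adj x1 x2)
    (a00 : G.Adj x0 y0) (a10 : G.Adj x1 y0) (a20 : ¬ G.Adj x2 y0)
    (a01 : ¬ G.Adj x0 y1) (a11 : G.Adj x1 y1) (a21 : G.Adj x2 y1)
    (a02 : G.Adj x0 y2) (a12 : ¬ G.Adj x1 y2) (a22 : G.Adj x2 y2)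
    (b01 : ¬ G.Adj y0 y1) (b02 : ¬ G.Adj y0 y2) (b12 : ¬ G.Adj y1 y2) : False := by
  let g : Fin 3 ⊕ Fin 3 → V
    | Sum.inl 0 => x0
    | Sum.inl 1 => x1
    | Sum.inl 2 => x2
    | Sum.inr 0 => y0
    | Sum.inr 1 => y1
    | Sum.inr 2 => y2
  refine hG.sun (isIndContained_of_adj_iff g ?_ ?_)
  · rintro (u | u) (v | v) huv <;> fin_cases u <;> fin_cases v <;> simp only [g] at huv <;>
      first
      | rfl
      | (exfalso; grind [G.adj_comm, G.irrefl])
  · rintro (u | u) (v | v)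
    · rw [threeSun_adj_inl_inl]
      fin_cases u <;> fin_cases v <;> simp [g, *, G.adj_comm]
    · rw [threeSun_adj_inl_inr]
      fin_cases u <;> fin_cases v <;> simp [g, *]
    · rw [G.adj_comm, threeSunGraph.adj_comm, threeSun_adj_inl_inr]
      fin_cases u <;> fin_cases v <;> simp [g, *]
    · simp only [threeSun_not_adj_inr_inr, iff_false]
      fin_cases u <;> fin_cases v <;> simp [g, *, G.adj_comm]

theorem risingSun_adj_inl_inl (n : ℕ) (i j : Fin n) :
    (risingSunGraph n).Adj (Sum.inl i) (Sum.inl j) ↔ i ≠ j ∧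
      (i.val = 0 ∨ j.val = 0 ∨ i.val = n - 1 ∨ j.val = n - 1 ∨ j.val = i.val + 1 ∨
        i.val = j.val + 1) := by
  simp only [risingSunGraph, SimpleGraph.fromRel_adj, ne_eq, Sum.inl.injEq]
  tauto

theorem risingSun_adj_inl_inr_zero (n : ℕ) (i : Fin n) :
    (risingSunGraph n).Adj (Sum.inl i) (Sum.inr 0) ↔ i.val = 0 ∨ i.val = 1 := by
  simp [risingSunGraph]

theorem risingSun_adj_inl_inr_one (n : ℕ) (i : Fin n) :
    (risingSunGraph n).Adj (Sum.inl i) (Sum.inr 1) ↔ i.val = n - 2 ∨ i.val = n - 1 := by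
  simp [risingSunGraph]

theorem risingSun_adj_inl_inr_two (n : ℕ) (i : Fin n) :
    (risingSunGraph n).Adj (Sum.inl i) (Sum.inr 2) ↔ i.val = n - 1 ∨ i.val = 0 := by
  simp [risingSunGraph]

theorem risingSun_not_adj_inr_inr (n : ℕ) (i k : Fin 3) :
    ¬ (risingSunGraph n).Adj (Sum.inr i) (Sum.inr k) := by
  simp [risingSunGraph]

/-- An induced path joined completely to two adjacent vertices `S`, `T`, with three further
vertices joined to `S` and the first vertex of the path, to `T` and the last vertex of the path,
and to `S` and `T`. -/
theorem ForbiddenFree.no_risingSun (hG : ForbiddenFree G) {k : ℕ} {f : ℕ → V}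
    (hf : IsInducedPath G k f) {S T e1 e2 e3 : V} (hST : G.Adj S T)
    (hS : ∀ i ≤ k, G.Adj S (f i)) (hT : ∀ i ≤ k, G.Adj T (f i))
    (h1S : G.Adj e1 S) (h1f : G.Adj e1 (f 0)) (h1T : ¬ G.Adj e1 T)
    (h1 : ∀ i, 0 < i → i ≤ k → ¬ G.Adj e1 (f i))
    (h2T : G.Adj e2 T) (h2f : G.Adj e2 (f k)) (h2S : ¬ G.Adj e2 S)
    (h2 : ∀ i < k, ¬ G.Adj e2 (f i))
    (h3S : G.Adj e3 S) (h3T : G.Adj e3 T) (h3 : ∀ i ≤ k, ¬ G.Adj e3 (f i))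
    (h12 : ¬ G.Adj e1 e2) (h13 : ¬ G.Adj e1 e3) (h23 : ¬ G.Adj e2 e3) : False := by
  -- A path with one vertex gives the 3-sun; otherwise the configuration is the `(k + 3)`-rising sun
  -- with `S`, `T` in the roles of `v₁`, `vₙ`.
  rcases Nat.eq_zero_or_pos k with rfl | hk
  · exact hG.no_sun (hS 0 le_rfl) hST (hT 0 le_rfl).symm h1S.symm h1f.symm
      (fun h => h1T h.symm) (fun h => h2S h.symm) h2f.symm h2T.symm h3S.symm
      (fun h => h3 0 le_rfl h.symm) h3T.symm h12 h13 h23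
  have n1T : e1 ≠ T := by rintro rfl; exact h13 h3T.symm
  have n2S : e2 ≠ S := by rintro rfl; exact h23 h3S.symm
  have n1f : ∀ i ≤ k, e1 ≠ f i := by rintro i hi rfl; exact h1T (hT i hi).symm
  have n2f : ∀ i ≤ k, e2 ≠ f i := by rintro i hi rfl; exact h2S (hS i hi).symm
  have n3f : ∀ i ≤ k, e3 ≠ f i := by
    rintro i hi rfl
    by_cases hik : i = k
    · subst hik; exact h23 h2f
    · exact h3 (i + 1) (by omega) ((hf.adj_iff hi (by omega)).2 (Or.inl rfl))
  have n12 : e1 ≠ e2 := by rintro rfl; exact h2S h1S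
  have n13 : e1 ≠ e3 := by rintro rfl; exact h1T h3T
  have n23 : e2 ≠ e3 := by rintro rfl; exact h2S h3S
  let w : Fin 3 → V
    | 0 => e1
    | 1 => e2
    | 2 => e3
  let v : ℕ → V := fun i => if i = 0 then S else if i ≤ k + 1 then f (i - 1) else T
  let g : Fin (k + 3) ⊕ Fin 3 → V
    | Sum.inl i => v i.val
    | Sum.inr j => w j
  have hv0 : v 0 = S := rfl
  have hvT : v (k + 2) = T := by simp [v]
  have hvf : ∀ i ≤ k, v (i + 1) = f i := by intro i hi; simp [v, hi]
  have hcase : ∀ i : Fin (k + 3), i.val = 0 ∨ i.val = k + 2 ∨ ∃ m ≤ k, i.val = m + 1 := by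
    intro i
    have := i.isLt
    by_cases hi0 : i.val = 0
    · exact Or.inl hi0
    · by_cases hik : i.val = k + 2
      · exact Or.inr (Or.inl hik)
      · exact Or.inr (Or.inr ⟨i.val - 1, by omega, by omega⟩)
  have hvw : ∀ (i : Fin (k + 3)) j, v i.val ≠ w j := by
    intro i j
    rcases hcase i with hi | hi | ⟨m, hm, hi⟩ <;> rw [hi]
    · rw [hv0]; fin_cases j
      exacts [h1S.ne', n2S.symm, h3S.ne']
    · rw [hvT]; fin_cases j
      exacts [n1T.symm, h2T.ne', h3T.ne']
    · rw [hvf m hm]; fin_cases j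
      exacts [(n1f m hm).symm, (n2f m hm).symm, (n3f m hm).symm]
  refine hG.risingSun (k + 3) (by omega) (isIndContained_of_adj_iff g ?_ ?_)
  · rintro (i | i) (j | j) huv
    · simp only [g] at huv
      congr 1
      ext
      rcases hcase i with hi | hi | ⟨m, hm, hi⟩ <;> rcases hcase j with hj | hj | ⟨m', hm', hj⟩ <;>
        rw [hi, hj] at huv ⊢
      · rw [hv0, hvT] at huv; exact absurd huv hST.ne
      · rw [hv0, hvf _ hm'] at huv; exact absurd huv (hS _ hm').ne
      · rw [hv0, hvT] at huv; exact absurd huv hST.ne'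
      · rw [hvT, hvf _ hm'] at huv; exact absurd huv (hT _ hm').ne
      · rw [hv0, hvf _ hm] at huv; exact absurd huv (hS _ hm).ne'
      · rw [hvT, hvf _ hm] at huv; exact absurd huv (hT _ hm).ne'
      · rw [hvf _ hm, hvf _ hm'] at huv
        rw [hf.eq_of_eq hm hm' huv]
    · exact absurd huv (hvw i j)
    · exact absurd huv.symm (hvw j i)
    · simp only [g] at huv
      fin_cases i <;> fin_cases j <;> simp only [w] at huv <;>
        first | rfl | exact absurd huv ‹_› | exact absurd huv.symm ‹_›
  · have hvw0 : ∀ i : Fin (k + 3), G.Adj (v i.val) e1 ↔ i.val = 0 ∨ i.val = 1 := by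
      intro i
      rcases hcase i with hi | hi | ⟨m, hm, hi⟩ <;> rw [hi]
      · simp [hv0, h1S.symm]
      · rw [hvT, G.adj_comm]; simp [h1T]
      · rw [hvf _ hm, G.adj_comm]
        rcases Nat.eq_zero_or_pos m with rfl | hm0
        · simp [h1f]
        · simp [h1 m hm0 hm]; omega
    have hvw1 : ∀ i : Fin (k + 3), G.Adj (v i.val) e2 ↔ i.val = k + 1 ∨ i.val = k + 2 := by
      intro i
      rcases hcase i with hi | hi | ⟨m, hm, hi⟩ <;> rw [hi]
      · rw [hv0, G.adj_comm]; simp [h2S]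
      · simp [hvT, h2T.symm]
      · rw [hvf _ hm, G.adj_comm]
        rcases hm.eq_or_lt with rfl | hm0
        · simp [h2f]
        · simp [h2 m hm0]; omega
    have hvw2 : ∀ i : Fin (k + 3), G.Adj (v i.val) e3 ↔ i.val = k + 2 ∨ i.val = 0 := by
      intro i
      rcases hcase i with hi | hi | ⟨m, hm, hi⟩ <;> rw [hi]
      · simp [hv0, h3S.symm]
      · simp [hvT, h3T.symm]
      · rw [hvf _ hm, G.adj_comm]; simp [h3 m hm]; omega
    have hvw : ∀ (i : Fin (k + 3)) (j : Fin 3),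
        G.Adj (v i.val) (w j) ↔ (risingSunGraph (k + 3)).Adj (Sum.inl i) (Sum.inr j) := by
      intro i j
      fin_cases j
      · exact (hvw0 i).trans (risingSun_adj_inl_inr_zero _ i).symm
      · exact (hvw1 i).trans (risingSun_adj_inl_inr_one _ i).symm
      · exact (hvw2 i).trans (risingSun_adj_inl_inr_two _ i).symm
    rintro (i | i) (j | j)
    · rw [risingSun_adj_inl_inl, ne_eq, Fin.ext_iff]
      simp only [g]
      rcases hcase i with hi | hi | ⟨m, hm, hi⟩ <;> rcases hcase j with hj | hj | ⟨m', hm', hj⟩ <;>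
        rw [hi, hj]
      · simp
      · rw [hv0, hvT]; simp [hST]
      · rw [hv0, hvf _ hm']; simp [hS _ hm']
      · rw [hv0, hvT]; simp [hST.symm]
      · simp
      · rw [hvT, hvf _ hm']; simp [hT _ hm']; omega
      · rw [hv0, hvf _ hm]; simp [(hS _ hm).symm]
      · rw [hvT, hvf _ hm]; simp [(hT _ hm).symm]; omega
      · rw [hvf _ hm, hvf _ hm', hf.adj_iff hm hm']; omega
    · exact hvw i j
    · rw [G.adj_comm, (risingSunGraph _).adj_comm]
      exact hvw j i
    · simp only [risingSun_not_adj_inr_inr, iff_false, g]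
      fin_cases i <;> fin_cases j <;> simp [w, *, G.adj_comm]

theorem umbrella_adj_iff (i j : Fin 7) : umbrellaGraph.Adj i j ↔
    s(i, j) ∈ ([s(0, 1), s(1, 2), s(2, 3), s(3, 4), s(5, 0), s(5, 1), s(5, 2), s(5, 3), s(5, 4),
      s(6, 2)] : List (Sym2 (Fin 7))) := by
  simp only [umbrellaGraph, SimpleGraph.fromEdgeSet_adj, List.mem_cons, List.not_mem_nil, or_false,
    Set.mem_insert_iff, Set.mem_singleton_iff, and_iff_left_iff_imp]
  rintro h rfl
  revert h
  revert i
  decide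

/-- A path `p₁p₂p₃p₄p₅`, a vertex joined to all of it and a vertex joined to `p₃` only. -/
theorem ForbiddenFree.no_umbrella (hG : ForbiddenFree G) {p1 p2 p3 p4 p5 h q : V}
    (a12 : G.Adj p1 p2) (a23 : G.Adj p2 p3) (a34 : G.Adj p3 p4) (a45 : G.Adj p4 p5)
    (n13 : ¬ G.Adj p1 p3) (n14 : ¬ G.Adj p1 p4) (n15 : ¬ G.Adj p1 p5) (n24 : ¬ G.Adj p2 p4)
    (n25 : ¬ G.Adj p2 p5) (n35 : ¬ G.Adj p3 p5)
    (h1 : G.Adj h p1) (h2 : G.Adj h p2) (h3 : G.Adj h p3) (h4 : G.Adj h p4) (h5 : G.Adj h p5)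
    (q1 : ¬ G.Adj q p1) (q2 : ¬ G.Adj q p2) (q3 : G.Adj q p3) (q4 : ¬ G.Adj q p4)
    (q5 : ¬ G.Adj q p5) (qh : ¬ G.Adj q h) : False := by
  let g : Fin 7 → V
    | 0 => p1
    | 1 => p2
    | 2 => p3
    | 3 => p4
    | 4 => p5
    | 5 => h
    | 6 => q
  refine hG.umbrella (isIndContained_of_adj_iff g ?_ ?_)
  · intro i j hij
    by_contra hne
    fin_cases i <;> fin_cases j <;> simp only [g] at hij <;>
      first
      | exact hne rfl
      | (grind [G.adj_comm, G.irrefl])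
  · intro i j
    rw [umbrella_adj_iff]
    fin_cases i <;> fin_cases j <;> simp [g, *] <;> rw [G.adj_comm] <;> assumption

end Forbidden

/-! ### Interval orders and cover pairs. -/

/-- A strict order in which the incomparable pairs are the adjacent ones and in which two
comparable pairs are never independent. -/
structure IntervalOrder {V : Type*} (G : SimpleGraph V) (lt : V → V → Prop) : Prop where
  irrefl : ∀ v, ¬ lt v v
  two_two : ∀ x y z w, lt x y → lt z w → lt x w ∨ lt z y
  adj_iff : ∀ v w, v ≠ w → (G.Adj v w ↔ ¬ lt v w ∧ ¬ lt w v)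

theorem IntervalOrder.trans {V : Type*} {G : SimpleGraph V} {lt : V → V → Prop}
    (h : IntervalOrder G lt) {x y z : V} (hxy : lt x y) (hyz : lt y z) : lt x z :=
  (h.two_two x y y z hxy hyz).resolve_right (h.irrefl y)

theorem IntervalOrder.lt_or_lt {V : Type*} {G : SimpleGraph V} {lt : V → V → Prop}
    (h : IntervalOrder G lt) {x y : V} (hne : x ≠ y) (hxy : ¬ G.Adj x y) : lt x y ∨ lt y x := by
  by_contra hc
  push Not at hc
  exact hxy ((h.adj_iff x y hne).2 hc)

theorem IntervalOrder.not_adj {V : Type*} {G : SimpleGraph V} {lt : V → V → Prop}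
    (h : IntervalOrder G lt) {x y : V} (hxy : lt x y) : ¬ G.Adj x y := fun ha =>
  ((h.adj_iff x y ha.ne).1 ha).1 hxy

/-- Intersecting convex sets of reals define an interval order. -/
theorem intervalOrder_of_ordConnected {V : Type*} {G : SimpleGraph V} (S : V → Set ℝ)
    (hne : ∀ v, (S v).Nonempty) (hoc : ∀ v, (S v).OrdConnected)
    (hadj : ∀ v w, v ≠ w → (G.Adj v w ↔ (S v ∩ S w).Nonempty)) :
    IntervalOrder G (fun v w => ∀ p ∈ S v, ∀ q ∈ S w, p < q) where
  irrefl v h := by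
    obtain ⟨p, hp⟩ := hne v
    exact lt_irrefl _ (h p hp p hp)
  two_two x y z w hxy hzw := by
    by_contra hc
    push Not at hc
    obtain ⟨⟨p, hp, q, hq, hqp⟩, ⟨p', hp', q', hq', hqp'⟩⟩ := hc
    linarith [hxy p hp q' hq', hzw p' hp' q hq]
  adj_iff v w hvw := by
    rw [hadj v w hvw]
    constructor
    · rintro ⟨p, hp, hp'⟩
      exact ⟨fun h => lt_irrefl _ (h p hp p hp'), fun h => lt_irrefl _ (h p hp' p hp)⟩
    · rintro ⟨h1, h2⟩
      push Not at h1 h2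
      obtain ⟨p, hp, q, hq, hqp⟩ := h1
      obtain ⟨q', hq', p', hp', hpq⟩ := h2
      by_cases h : p ≤ q'
      · exact ⟨p, hp, (hoc w).out hq hq' ⟨hqp, h⟩⟩
      · exact ⟨q', (hoc v).out hp' hp ⟨hpq, (not_le.1 h).le⟩, hq'⟩

/-- Two adjacent vertices such that no clique contains a vertex far from the first one and a vertex
far from the second one. -/
structure CoverPair {V : Type*} (G : SimpleGraph V) (A B : V) : Prop where
  adj : G.Adj A B
  cover : ∀ x y, x = y ∨ G.Adj x y → (x = A ∨ G.Adj x A) ∨ (y = B ∨ G.Adj y B)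

theorem CoverPair.symm {V : Type*} {G : SimpleGraph V} {A B : V} (h : CoverPair G A B) :
    CoverPair G B A where
  adj := h.adj.symm
  cover x y hxy := (h.cover y x (hxy.imp Eq.symm fun ha => ha.symm)).symm

theorem ordConnected_circlePos_image {q : UnitAddCircle} {S : Set UnitAddCircle}
    (h : ∀ u ∈ S, ∀ v ∈ S, ∀ p, circlePos q u < circlePos q p → circlePos q p < circlePos q v →
      p ∈ S) : (circlePos q '' S).OrdConnected := by
  refine ⟨?_⟩
  rintro _ ⟨u, hu, rfl⟩ _ ⟨v, hv, rfl⟩ r ⟨h1, h2⟩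
  have hr : circlePos q (q + (r : UnitAddCircle)) = r :=
    circlePos_add_coe q ((circlePos_nonneg q u).trans h1) (h2.trans_lt (circlePos_lt_one q v))
  rcases h1.eq_or_lt with rfl | h1
  · exact ⟨u, hu, rfl⟩
  rcases h2.eq_or_lt with rfl | h2
  · exact ⟨v, hv, rfl⟩
  exact ⟨_, h u hu v hv (q + (r : UnitAddCircle)) (by rwa [hr]) (by rwa [hr]), hr⟩

/-! ### A cover pair in a normal Helly model forces an interval graph. -/

namespace CircularArcModel

variable {ι : Type*} [Finite ι] {M : CircularArcModel ι}

theorem s_ne_t (M : CircularArcModel ι) (i j : ι) : M.s i ≠ M.t j := fun h =>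
  Sum.inl_ne_inr (M.extremes_injective (a₁ := Sum.inl i) (a₂ := Sum.inr j) h)

theorem arc_nonempty (M : CircularArcModel ι) (i : ι) : (M.arc i).Nonempty := by
  obtain ⟨a, b, hab, -, -, -, h⟩ := exists_cIoo_eq_image (M.s_ne_t i i)
  rw [arc, h]
  exact (Set.nonempty_Ioo.2 hab).image _

theorem mem_arc_of_between {q u v p : UnitAddCircle} {i : ι} (hq : q ∉ M.arc i)
    (hu : u ∈ M.arc i) (hv : v ∈ M.arc i) (h1 : circlePos q u < circlePos q p)
    (h2 : circlePos q p < circlePos q v) : p ∈ M.arc i :=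
  mem_cIoo_of_between hq hu hv h1 h2

theorem notMem_arc_of_between {q u v p : UnitAddCircle} {i : ι} (hq : q ∈ M.arc i)
    (hu : u ∉ M.arc i) (hv : v ∉ M.arc i) (h1 : circlePos q u < circlePos q p)
    (h2 : circlePos q p < circlePos q v) : p ∉ M.arc i :=
  notMem_cIoo_of_between hq hu hv h1 h2

theorem adj_iff {i j : ι} :
    M.intersectionGraph.Adj i j ↔ i ≠ j ∧ (M.arc i ∩ M.arc j).Nonempty := Iff.rfl

theorem adj_of_mem {i j : ι} (hne : i ≠ j) {p : UnitAddCircle} (hi : p ∈ M.arc i)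
    (hj : p ∈ M.arc j) : M.intersectionGraph.Adj i j := ⟨hne, p, hi, hj⟩

/-- In a Helly model, the members of a clique have a common point. -/
theorem IsHCA.exists_common (h : M.IsHCA) (F : Set ι)
    (hF : ∀ i ∈ F, ∀ j ∈ F, i ≠ j → M.intersectionGraph.Adj i j) : ∃ p, ∀ i ∈ F, p ∈ M.arc i := by
  refine h F fun i hi j hj => ?_
  by_cases hij : i = j
  · subst hij; simpa using M.arc_nonempty i
  · exact (hF i hi j hj hij).2

theorem IsHCA.exists_common_three (h : M.IsHCA) {i j k : ι}
    (hij : i = j ∨ M.intersectionGraph.Adj i j) (hik : i = k ∨ M.intersectionGraph.Adj i k)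
    (hjk : j = k ∨ M.intersectionGraph.Adj j k) :
    ∃ p, p ∈ M.arc i ∧ p ∈ M.arc j ∧ p ∈ M.arc k := by
  obtain ⟨p, hp⟩ := h.exists_common {i, j, k} (by
    rintro x (rfl | rfl | rfl) y (rfl | rfl | rfl) hxy <;>
    grind [SimpleGraph.adj_comm])
  exact ⟨p, hp i (by simp), hp j (by simp), hp k (by simp)⟩

/-- Three arcs with a common point cover the circle only if two of them do. -/
theorem exists_notMem_three {i j k : ι} {h p1 p2 p3 : UnitAddCircle} (hi : h ∈ M.arc i)
    (hj : h ∈ M.arc j) (hk : h ∈ M.arc k) (h1 : p1 ∉ M.arc i ∧ p1 ∉ M.arc j)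
    (h2 : p2 ∉ M.arc i ∧ p2 ∉ M.arc k) (h3 : p3 ∉ M.arc j ∧ p3 ∉ M.arc k) :
    ∃ p, p ∉ M.arc i ∧ p ∉ M.arc j ∧ p ∉ M.arc k := by
  have ki : ∀ u v p, u ∉ M.arc i → v ∉ M.arc i → circlePos h u < circlePos h p →
      circlePos h p < circlePos h v → p ∉ M.arc i := fun _ _ _ => notMem_arc_of_between hi
  have kj : ∀ u v p, u ∉ M.arc j → v ∉ M.arc j → circlePos h u < circlePos h p →
      circlePos h p < circlePos h v → p ∉ M.arc j := fun _ _ _ => notMem_arc_of_between hj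
  have kk : ∀ u v p, u ∉ M.arc k → v ∉ M.arc k → circlePos h u < circlePos h p →
      circlePos h p < circlePos h v → p ∉ M.arc k := fun _ _ _ => notMem_arc_of_between hk
  by_contra hc
  push Not at hc
  -- If the three arcs cover, each of `p1`, `p2`, `p3` lies in exactly one of them. Seen from `h`,
  -- the middle one lies between two points missed by its own arc, whose complement is convex.
  have d1 := hc p1 h1.1 h1.2
  have d2 : p2 ∈ M.arc j := by by_contra h'; exact h2.2 (hc p2 h2.1 h')
  have d3 : p3 ∈ M.arc i := by by_contra h'; exact h3.2 (hc p3 h' h3.1)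
  have n12 : circlePos h p1 ≠ circlePos h p2 := fun e =>
    h1.2 (circlePos_injective h e ▸ d2)
  have n13 : circlePos h p1 ≠ circlePos h p3 := fun e =>
    h1.1 (circlePos_injective h e ▸ d3)
  have n23 : circlePos h p2 ≠ circlePos h p3 := fun e =>
    h2.1 (circlePos_injective h e ▸ d3)
  rcases lt_or_gt_of_ne n12 with a | a <;> rcases lt_or_gt_of_ne n13 with b | b <;>
    rcases lt_or_gt_of_ne n23 with c | c
  · exact kj _ _ _ h1.2 h3.1 a c d2
  · exact ki _ _ _ h1.1 h2.1 b c d3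
  · linarith
  · exact kk _ _ _ h3.2 h2.2 b a d1
  · exact kk _ _ _ h2.2 h3.2 a b d1
  · linarith
  · exact ki _ _ _ h2.1 h1.1 c b d3
  · exact kj _ _ _ h3.1 h1.2 c a d2

/-- A graph with a normal Helly model and a cover pair has an interval order. -/
theorem IsNHCA.exists_intervalOrder (hM : M.IsNHCA) {V : Type*} {G : SimpleGraph V}
    (φ : G ↪g M.intersectionGraph) {A B : V} (hAB : CoverPair G A B) :
    ∃ lt, IntervalOrder G lt := by
  have hadj : ∀ v w, v ≠ w → (G.Adj v w ↔ (M.arc (φ v) ∩ M.arc (φ w)).Nonempty) := by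
    intro v w hvw
    rw [← φ.map_adj_iff, adj_iff]
    exact ⟨fun h => h.2, fun h => ⟨φ.injective.ne hvw, h⟩⟩
  have hout : ∀ v w, v ≠ w → ∃ p, p ∉ M.arc (φ v) ∧ p ∉ M.arc (φ w) := by
    intro v w hvw
    obtain ⟨p, hp⟩ := (Set.ne_univ_iff_exists_notMem _).1 (hM.1 _ _ (φ.injective.ne hvw))
    exact ⟨p, fun h => hp (Or.inl h), fun h => hp (Or.inr h)⟩
  have hhelly : ∀ u v w, (u = v ∨ G.Adj u v) → (u = w ∨ G.Adj u w) → (v = w ∨ G.Adj v w) →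
      ∃ p, p ∈ M.arc (φ u) ∧ p ∈ M.arc (φ v) ∧ p ∈ M.arc (φ w) := by
    intro u v w h1 h2 h3
    exact hM.2.exists_common_three (h1.imp (congrArg φ) φ.map_adj_iff.2)
      (h2.imp (congrArg φ) φ.map_adj_iff.2) (h3.imp (congrArg φ) φ.map_adj_iff.2)
  -- Normality provides the cut point `q`. The union `J` of the two arcs is convex in positions from
  -- `q` because they share `m`.
  obtain ⟨q, hqA, hqB⟩ := hout A B hAB.adj.ne
  obtain ⟨m, hmA, hmB⟩ := (hadj A B hAB.adj.ne).1 hAB.adj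
  let J := M.arc (φ A) ∪ M.arc (φ B)
  have hA : ∀ {u v p}, u ∈ M.arc (φ A) → v ∈ M.arc (φ A) → circlePos q u < circlePos q p →
      circlePos q p < circlePos q v → p ∈ M.arc (φ A) := mem_arc_of_between hqA
  have hB : ∀ {u v p}, u ∈ M.arc (φ B) → v ∈ M.arc (φ B) → circlePos q u < circlePos q p →
      circlePos q p < circlePos q v → p ∈ M.arc (φ B) := mem_arc_of_between hqB
  have hJ : ∀ u ∈ J, ∀ v ∈ J, ∀ p, circlePos q u < circlePos q p →
      circlePos q p < circlePos q v → p ∈ J := by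
    intro u hu v hv p h1 h2
    rcases lt_trichotomy (circlePos q p) (circlePos q m) with h | h | h
    · rcases hu with hu | hu
      · exact Or.inl (hA hu hmA h1 h)
      · exact Or.inr (hB hu hmB h1 h)
    · exact Or.inl (circlePos_injective q h ▸ hmA)
    · rcases hv with hv | hv
      · exact Or.inl (hA hmA hv h h2)
      · exact Or.inr (hB hmB hv h h2)
  have f1 : ∀ x, (x = A ∨ G.Adj x A) ∨ (x = B ∨ G.Adj x B) := fun x => hAB.cover x x (Or.inl rfl)
  refine ⟨_, intervalOrder_of_ordConnected (fun v => circlePos q '' (M.arc (φ v) ∩ J)) ?_ ?_ ?_⟩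
  · intro v
    refine Set.Nonempty.image _ ?_
    rcases f1 v with h | h
    · obtain ⟨p, h1, h2, -⟩ := hhelly v A A h h (Or.inl rfl)
      exact ⟨p, h1, Or.inl h2⟩
    · obtain ⟨p, h1, h2, -⟩ := hhelly v B B h h (Or.inl rfl)
      exact ⟨p, h1, Or.inr h2⟩
  · intro v
    refine ordConnected_circlePos_image ?_
    rintro u ⟨hu, huJ⟩ w ⟨hw, hwJ⟩ p h1 h2
    refine ⟨?_, hJ u huJ w hwJ p h1 h2⟩
    by_cases hq : q ∈ M.arc (φ v)
    swap
    · exact mem_arc_of_between hq hu hw h1 h2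
    -- An arc through `q` with a gap between `u` and `w` has its whole complement there. If it meets
    -- only one of `A`, `B`, that arc contains the gap and the two cover the circle. If it meets
    -- both, `J` contains the gap, and the three arcs, which share a point, cover the circle; by
    -- `exists_notMem_three` two of them would do so.
    by_contra hp
    have hvA : v ≠ A := by rintro rfl; exact hqA hq
    have hvB : v ≠ B := by rintro rfl; exact hqB hq
    have key : ∀ r, r ∉ M.arc (φ v) → circlePos q u < circlePos q r ∧
        circlePos q r < circlePos q w := by
      intro r hr
      constructor
      · by_contra h
        rcases (not_lt.1 h).eq_or_lt with e | e
        · exact hr (circlePos_injective q e ▸ hu)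
        · exact notMem_arc_of_between hq hr hp e h1 hu
      · by_contra h
        rcases (not_lt.1 h).eq_or_lt with e | e
        · exact hr (circlePos_injective q e ▸ hw)
        · exact notMem_arc_of_between hq hp hr h2 e hw
    have hside : ∀ C, (∀ {u v p}, u ∈ M.arc (φ C) → v ∈ M.arc (φ C) →
        circlePos q u < circlePos q p → circlePos q p < circlePos q v → p ∈ M.arc (φ C)) →
        v ≠ C → u ∈ M.arc (φ C) → w ∈ M.arc (φ C) → False := by
      intro C hC hvC huC hwC
      obtain ⟨r, hr, hrC⟩ := hout v C hvC
      exact hrC (hC huC hwC (key r hr).1 (key r hr).2)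
    by_cases hA' : G.Adj v A
    · by_cases hB' : G.Adj v B
      · obtain ⟨h, hh1, hh2, hh3⟩ := hhelly v A B (Or.inr hA') (Or.inr hB') (Or.inr hAB.adj)
        obtain ⟨r1, hr1⟩ := hout v A hvA
        obtain ⟨r2, hr2⟩ := hout v B hvB
        obtain ⟨r, hr, hr', hr''⟩ := exists_notMem_three hh1 hh2 hh3 hr1 hr2 ⟨hqA, hqB⟩
        have := hJ u huJ w hwJ r (key r hr).1 (key r hr).2
        exact this.elim hr' hr''
      · have hn : ∀ x, x ∈ M.arc (φ v) → x ∈ J → x ∈ M.arc (φ A) := fun x hx hxJ =>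
          hxJ.resolve_right fun h => hB' ((hadj v B hvB).2 ⟨x, hx, h⟩)
        exact hside A hA hvA (hn u hu huJ) (hn w hw hwJ)
    · have hn : ∀ x, x ∈ M.arc (φ v) → x ∈ J → x ∈ M.arc (φ B) := fun x hx hxJ =>
        hxJ.resolve_left fun h => hA' ((hadj v A hvA).2 ⟨x, hx, h⟩)
      exact hside B hB hvB (hn u hu huJ) (hn w hw hwJ)
  · intro v w hvw
    rw [← Set.image_inter (circlePos_injective q)]
    simp only [Set.image_nonempty]
    constructor
    · intro h
      have h' : G.Adj v w := h
      -- The cover condition, used for `(v, w)`, `(w, v)`, `(v, v)` and `(w, w)`, puts both vertices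
      -- in the closed neighbourhood of one `C`; the Helly point of the three arcs then lies in `J`.
      have : (∃ C, (C = A ∨ C = B) ∧ (v = C ∨ G.Adj v C) ∧ (w = C ∨ G.Adj w C)) := by
        have c1 := hAB.cover v w (Or.inr h')
        have c2 := hAB.cover w v (Or.inr h'.symm)
        have c3 := f1 v
        have c4 := f1 w
        by_cases hvA : v = A ∨ G.Adj v A
        · by_cases hwA : w = A ∨ G.Adj w A
          · exact ⟨A, Or.inl rfl, hvA, hwA⟩
          · exact ⟨B, Or.inr rfl, c2.resolve_left hwA, c4.resolve_left hwA⟩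
        · exact ⟨B, Or.inr rfl, c3.resolve_left hvA, c1.resolve_left hvA⟩
      obtain ⟨C, hC, hvC, hwC⟩ := this
      obtain ⟨p, p1, p2, p3⟩ := hhelly v w C (Or.inr h') hvC hwC
      have : p ∈ J := by
        rcases hC with rfl | rfl
        · exact Or.inl p3
        · exact Or.inr p3
      exact ⟨p, ⟨p1, this⟩, ⟨p2, this⟩⟩
    · rintro ⟨p, ⟨p1, -⟩, ⟨p2, -⟩⟩
      exact (hadj v w hvw).2 ⟨p, p1, p2⟩

end CircularArcModel

/-! ### The forbidden graphs have cover pairs but no interval order. -/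

section NotInterval

variable {V : Type*} {G : SimpleGraph V} {lt : V → V → Prop}

/-- Adjacency preserves the side on which a vertex lies with respect to a vertex far from both. -/
theorem IntervalOrder.lt_of_adj (h : IntervalOrder G lt) {u v y : V} (huy : lt u y)
    (huv : G.Adj u v) (hne : v ≠ y) (hvy : ¬ G.Adj v y) : lt v y :=
  (h.lt_or_lt hne hvy).resolve_right fun hyv => h.not_adj (h.trans huy hyv) huv

theorem IntervalOrder.gt_of_adj (h : IntervalOrder G lt) {u v y : V} (huy : lt y u)
    (huv : G.Adj u v) (hne : v ≠ y) (hvy : ¬ G.Adj v y) : lt y v :=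
  (h.lt_or_lt hne hvy).resolve_left fun hyv => h.not_adj (h.trans hyv huy) huv.symm

/-- An interval order has no asteroidal triple. -/
theorem IntervalOrder.not_asteroidal (h : IntervalOrder G lt) {x y z : V} (hxy : x ≠ y)
    (nxy : ¬ G.Adj x y)
    (pxy : Relation.ReflTransGen (fun u v => G.Adj u v ∧ v ≠ z ∧ ¬ G.Adj v z) x y)
    (pxz : Relation.ReflTransGen (fun u v => G.Adj u v ∧ v ≠ y ∧ ¬ G.Adj v y) x z)
    (pyz : Relation.ReflTransGen (fun u v => G.Adj u v ∧ v ≠ x ∧ ¬ G.Adj v x) y z) : False := by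
  -- A path avoiding the closed neighbourhood of `c` stays on one side of `c`; hence none of the
  -- three vertices can be the middle one.
  have key : ∀ a b c, Relation.ReflTransGen (fun u v => G.Adj u v ∧ v ≠ c ∧ ¬ G.Adj v c) a b →
      (lt a c → lt b c) ∧ (lt c a → lt c b) := by
    intro a b c hp
    induction hp with
    | refl => exact ⟨id, id⟩
    | tail _ hst ih =>
      exact ⟨fun ha => h.lt_of_adj (ih.1 ha) hst.1 hst.2.1 hst.2.2,
        fun ha => h.gt_of_adj (ih.2 ha) hst.1 hst.2.1 hst.2.2⟩
  have k1 := key _ _ _ pxy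
  have k2 := key _ _ _ pxz
  have k3 := key _ _ _ pyz
  rcases h.lt_or_lt hxy nxy with a | a
  · exact h.irrefl _ (h.trans (k1.1 (k3.2 a)) (k2.1 a))
  · exact h.irrefl _ (h.trans (k1.2 (k3.1 a)) (k2.2 a))

/-- In an interval order on a nonempty finite graph some vertex has a clique of neighbours. -/
theorem IntervalOrder.exists_simplicial [Finite V] [Nonempty V] (h : IntervalOrder G lt) :
    ∃ v, ∀ x y, G.Adj v x → G.Adj v y → x ≠ y → G.Adj x y := by
  -- Having the most successors means that the right end of the interval is leftmost, so that all
  -- intervals meeting it share that end.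
  obtain ⟨v, hv⟩ := Finite.exists_max (fun v => {w | lt v w}.ncard)
  have key : ∀ x y, G.Adj v x → G.Adj v y → ¬ lt x y := by
    intro x y hx hy hxy
    refine absurd (hv x) (not_le.2 (Set.ncard_lt_ncard ⟨?_, fun hsub => ?_⟩ (Set.toFinite _)))
    · intro w hw
      exact (h.two_two x y v w hxy hw).resolve_right fun hvy => h.not_adj hvy hy
    · exact h.not_adj (hsub hxy : lt v y) hy
  exact ⟨v, fun x y hx hy hne => (h.adj_iff x y hne).2 ⟨key x y hx hy, key y x hy hx⟩⟩

/-- Interval orders restrict to induced subgraphs. -/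
theorem IntervalOrder.comap {W : Type*} {H : SimpleGraph W} (h : IntervalOrder G lt)
    (φ : H ↪g G) : IntervalOrder H (fun v w => lt (φ v) (φ w)) where
  irrefl v := h.irrefl _
  two_two x y z w := h.two_two _ _ _ _
  adj_iff v w hvw := by rw [← φ.map_adj_iff, h.adj_iff _ _ (φ.injective.ne hvw)]

end NotInterval

/-- On the rim the neighbours `v + 1` and `v - 1` differ by two and are not adjacent because `n ≥
4`, so no rim vertex is simplicial in the cycle. -/
theorem not_intervalOrder_wheel {n : ℕ} (hn : 4 ≤ n) {lt : Option (Fin n) → Option (Fin n) → Prop}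
    (h : IntervalOrder (wheelGraph n) lt) : False := by
  have : NeZero n := ⟨by omega⟩
  have hc : IntervalOrder (SimpleGraph.cycleGraph n) (fun v w => lt (some v) (some w)) :=
    h.comap ⟨⟨some, Option.some_injective _⟩, wheel_adj_some n _ _⟩
  obtain ⟨v, hv⟩ := hc.exists_simplicial
  have hval1 : (1 : Fin n).val = 1 := by
    rw [Fin.val_one', Nat.mod_eq_of_lt (by omega)]
  have hval2 : ((1 : Fin n) + 1).val = 2 := by
    rw [Fin.val_add, hval1, Nat.mod_eq_of_lt (by omega)]
  have hval3 : (-((1 : Fin n) + 1)).val = n - 2 := by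
    rw [Fin.val_neg', hval2, Nat.mod_eq_of_lt (by omega)]
  have h1 : (SimpleGraph.cycleGraph n).Adj v (v + 1) := by
    rw [SimpleGraph.cycleGraph_adj', add_sub_cancel_left]
    exact Or.inr hval1
  have h2 : (SimpleGraph.cycleGraph n).Adj v (v - 1) := by
    rw [SimpleGraph.cycleGraph_adj', sub_sub_cancel]
    exact Or.inl hval1
  have hd : v + 1 - (v - 1) = 1 + 1 := by abel
  have hd' : v - 1 - (v + 1) = -(1 + 1) := by abel
  have h3 := hv _ _ h1 h2 (by
    intro he
    rw [← sub_eq_zero, hd] at he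
    rw [he] at hval2
    simp at hval2)
  rw [SimpleGraph.cycleGraph_adj', hd, hd', hval2, hval3] at h3
  omega

theorem coverPair_wheel {n : ℕ} (i : Fin n) : CoverPair (wheelGraph n) none (some i) where
  adj := wheel_adj_none n i
  cover x y _ := by
    left
    cases x with
    | none => exact Or.inl rfl
    | some j => exact Or.inr (wheel_adj_none n j).symm

theorem coverPair_sun : CoverPair threeSunGraph (Sum.inl 0) (Sum.inl 1) where
  adj := by simp [threeSun_adj_inl_inl]
  cover := by
    rintro (x | x) (y | y) hxy <;> fin_cases x <;> fin_cases y <;>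
      simp_all [threeSun_adj_inl_inl, threeSun_adj_inl_inr, threeSun_not_adj_inr_inr,
        threeSunGraph.adj_comm (Sum.inr _) (Sum.inl _)]

/-- The three vertices of degree two form an asteroidal triple: any two have a common neighbour in
the triangle that misses the third. -/
theorem not_intervalOrder_sun {lt : Fin 3 ⊕ Fin 3 → Fin 3 ⊕ Fin 3 → Prop}
    (h : IntervalOrder threeSunGraph lt) : False := by
  have key : ∀ i j k : Fin 3, ∀ m, (m = i ∨ m = i + 1) → (m = j ∨ m = j + 1) →
      ¬ (m = k ∨ m = k + 1) →
      Relation.ReflTransGen (fun u v => threeSunGraph.Adj u v ∧ v ≠ Sum.inr k ∧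
        ¬ threeSunGraph.Adj v (Sum.inr k)) (Sum.inr i) (Sum.inr j) := by
    intro i j k m h1 h2 h3
    refine .tail (.single (b := Sum.inl m) ⟨?_, by simp, ?_⟩) ⟨?_, ?_, ?_⟩
    · rwa [threeSunGraph.adj_comm, threeSun_adj_inl_inr]
    · rwa [threeSun_adj_inl_inr]
    · rwa [threeSun_adj_inl_inr]
    · rintro he
      rw [Sum.inr.inj he] at h2
      exact h3 h2
    · exact threeSun_not_adj_inr_inr _ _
  exact h.not_asteroidal (x := Sum.inr 0) (y := Sum.inr 1) (z := Sum.inr 2) (by decide)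
    (threeSun_not_adj_inr_inr _ _) (key _ _ _ 1 (by decide) (by decide) (by decide))
    (key _ _ _ 0 (by decide) (by decide) (by decide))
    (key _ _ _ 2 (by decide) (by decide) (by decide))

instance : DecidableRel umbrellaGraph.Adj := fun i j => decidable_of_iff _ (umbrella_adj_iff i j).symm

theorem coverPair_umbrella : CoverPair umbrellaGraph 5 2 where
  adj := by decide
  cover := by decide

/-- The asteroidal triple consists of the ends of the path and the pendant vertex, with paths `0 5
4`, `0 1 2 6` and `4 3 2 6`. -/
theorem not_intervalOrder_umbrella {lt : Fin 7 → Fin 7 → Prop}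
    (h : IntervalOrder umbrellaGraph lt) : False := by
  refine h.not_asteroidal (x := 0) (y := 4) (z := 6) (by decide) (by decide) ?_ ?_ ?_
  · exact .tail (.single (b := 5) (by decide)) (by decide)
  · exact .tail (.tail (.single (b := 1) (by decide)) (by decide : umbrellaGraph.Adj 1 2 ∧ _))
      (by decide)
  · exact .tail (.tail (.single (b := 3) (by decide)) (by decide : umbrellaGraph.Adj 3 2 ∧ _))
      (by decide)

/-- Only `wₙ₋₁` is far from `v₁` and only `w₁` is far from `vₙ`, and these two are distinct and not
adjacent. -/
theorem coverPair_risingSun {n : ℕ} (hn : 4 ≤ n) :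
    CoverPair (risingSunGraph n) (Sum.inl ⟨0, by omega⟩) (Sum.inl ⟨n - 1, by omega⟩) where
  adj := by
    rw [risingSun_adj_inl_inl]
    simp [Fin.ext_iff]; omega
  cover := by
    have hl : ∀ x : Fin n, x.val = 0 ∨ (risingSunGraph n).Adj (Sum.inl x) (Sum.inl ⟨0, by omega⟩) := by
      intro x
      rw [risingSun_adj_inl_inl, ne_eq, Fin.ext_iff]
      by_cases hx : x.val = 0 <;> simp [hx]
    have hr : ∀ x : Fin n, x.val = n - 1 ∨
        (risingSunGraph n).Adj (Sum.inl x) (Sum.inl ⟨n - 1, by omega⟩) := by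
      intro x
      rw [risingSun_adj_inl_inl, ne_eq, Fin.ext_iff]
      by_cases hx : x.val = n - 1 <;> simp [hx]
    rintro (x | x) (y | y) hxy
    · left
      simpa [Fin.ext_iff] using hl x
    · left
      simpa [Fin.ext_iff] using hl x
    · right
      simpa [Fin.ext_iff] using hr y
    · have hxy : x = y := by
        rcases hxy with h | h
        · exact Sum.inr.inj h
        · exact absurd h (risingSun_not_adj_inr_inr _ _ _)
      subst hxy
      fin_cases x
      · left; right
        exact ((risingSun_adj_inl_inr_zero n _).2 (Or.inl rfl)).symm
      · right; right
        exact ((risingSun_adj_inl_inr_one n _).2 (Or.inr rfl)).symm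
      · right; right
        exact ((risingSun_adj_inl_inr_two n _).2 (Or.inl rfl)).symm

/-- The asteroidal triple is `w₁`, `wₙ₋₁`, `wₙ`: the first two are joined along `v₂, …, vₙ₋₁`, the
other pairs through `v₁` and through `vₙ`. -/
theorem not_intervalOrder_risingSun {n : ℕ} (hn : 4 ≤ n) {lt : Fin n ⊕ Fin 3 → Fin n ⊕ Fin 3 → Prop}
    (h : IntervalOrder (risingSunGraph n) lt) : False := by
  have e0 := risingSun_adj_inl_inr_zero n
  have e1 := risingSun_adj_inl_inr_one n
  have e2 := risingSun_adj_inl_inr_two n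
  refine h.not_asteroidal (x := Sum.inr 0) (y := Sum.inr 1) (z := Sum.inr 2) (by simp)
    (risingSun_not_adj_inr_inr _ _ _) ?_ ?_ ?_
  · have key : ∀ m (hm : m + 2 < n), Relation.ReflTransGen (fun u v => (risingSunGraph n).Adj u v ∧
        v ≠ Sum.inr 2 ∧ ¬ (risingSunGraph n).Adj v (Sum.inr 2)) (Sum.inr 0)
        (Sum.inl ⟨m + 1, by omega⟩) := by
      intro m hm
      induction m with
      | zero =>
        refine .single ⟨((e0 _).2 (Or.inr rfl)).symm, by simp, ?_⟩
        rw [e2]; simp; omega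
      | succ m ih =>
        refine .tail (ih (by omega)) ⟨?_, by simp, ?_⟩
        · rw [risingSun_adj_inl_inl]; simp
        · rw [e2]; simp; omega
    have := key (n - 3) (by omega)
    refine .tail this ⟨?_, by simp, risingSun_not_adj_inr_inr _ _ _⟩
    rw [e1]; left; simp; omega
  · refine .tail (.single (b := Sum.inl ⟨0, by omega⟩) ⟨((e0 _).2 (Or.inl rfl)).symm, by simp, ?_⟩)
      ⟨(e2 _).2 (Or.inr rfl), by simp, risingSun_not_adj_inr_inr _ _ _⟩
    rw [e1]; simp; omega
  · refine .tail (.single (b := Sum.inl ⟨n - 1, by omega⟩)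
      ⟨((e1 _).2 (Or.inr rfl)).symm, by simp, ?_⟩)
      ⟨(e2 _).2 (Or.inl rfl), by simp, risingSun_not_adj_inr_inr _ _ _⟩
    rw [e0]; simp; omega

/-- The intersection graph of a normal Helly model has no forbidden induced subgraph. -/
theorem CircularArcModel.IsNHCA.forbiddenFree {ι : Type*} [Finite ι] {M : CircularArcModel ι}
    (hM : M.IsNHCA) : ForbiddenFree M.intersectionGraph where
  wheel n hn := fun ⟨φ⟩ => by
    obtain ⟨lt, h⟩ := hM.exists_intervalOrder φ (coverPair_wheel ⟨0, by omega⟩)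
    exact not_intervalOrder_wheel hn h
  sun := fun ⟨φ⟩ => by
    obtain ⟨lt, h⟩ := hM.exists_intervalOrder φ coverPair_sun
    exact not_intervalOrder_sun h
  risingSun n hn := fun ⟨φ⟩ => by
    obtain ⟨lt, h⟩ := hM.exists_intervalOrder φ (coverPair_risingSun hn)
    exact not_intervalOrder_risingSun hn h
  umbrella := fun ⟨φ⟩ => by
    obtain ⟨lt, h⟩ := hM.exists_intervalOrder φ coverPair_umbrella
    exact not_intervalOrder_umbrella h

/-! ### Interval graphs have normal Helly models. -/

/-- The model formed by arcs that come from real intervals contained in `(0, 1)`. -/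
noncomputable def intervalModel {κ : Type*} [Finite κ] (a b : κ → ℝ)
    (ha : ∀ i, 0 < a i) (hab : ∀ i, a i < b i) (hb : ∀ i, b i < 1)
    (hinj : Function.Injective (Sum.elim a b)) : CircularArcModel κ where
  s i := (a i : UnitAddCircle)
  t i := (b i : UnitAddCircle)
  extremes_injective := by
    have h : Sum.elim (fun i => (a i : UnitAddCircle)) (fun i => (b i : UnitAddCircle)) =
        (fun x : ℝ => (x : UnitAddCircle)) ∘ Sum.elim a b := by
      ext x; cases x <;> rfl
    rw [h]
    intro x y hxy
    have hpos : ∀ z, circlePos 0 (Sum.elim a b z : ℝ) = Sum.elim a b z := by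
      intro z
      have h0 : 0 ≤ Sum.elim a b z := by
        cases z with
        | inl i => exact (ha i).le
        | inr i => exact ((ha i).trans (hab i)).le
      have h1 : Sum.elim a b z < 1 := by
        cases z with
        | inl i => exact (hab i).trans (hb i)
        | inr i => exact hb i
      simpa using circlePos_add_coe 0 h0 h1
    refine hinj ?_
    rw [← hpos x, ← hpos y]
    exact congrArg _ hxy

section IntervalModel

variable {κ : Type*} [Finite κ] {a b : κ → ℝ} {ha : ∀ i, 0 < a i} {hab : ∀ i, a i < b i}
  {hb : ∀ i, b i < 1} {hinj : Function.Injective (Sum.elim a b)}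

theorem mem_arc_intervalModel {i : κ} {x : UnitAddCircle} :
    x ∈ (intervalModel a b ha hab hb hinj).arc i ↔ a i < circlePos 0 x ∧ circlePos 0 x < b i := by
  have h1 : circlePos 0 (a i : UnitAddCircle) = a i := by
    simpa using circlePos_add_coe 0 (ha i).le ((hab i).trans (hb i))
  have h2 : circlePos 0 (b i : UnitAddCircle) = b i := by
    simpa using circlePos_add_coe 0 ((ha i).trans (hab i)).le (hb i)
  refine (mem_cIoo_iff 0 _ _ _).trans ?_
  have := hab i
  simp only [intervalModel, h1, h2]
  grind

theorem coe_mem_arc_intervalModel {i : κ} {x : ℝ} (h0 : a i < x) (h1 : x < b i) :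
    (x : UnitAddCircle) ∈ (intervalModel a b ha hab hb hinj).arc i := by
  have : circlePos 0 (x : UnitAddCircle) = x := by
    simpa using circlePos_add_coe 0 ((ha i).trans h0).le (h1.trans (hb i))
  rw [mem_arc_intervalModel, this]
  exact ⟨h0, h1⟩

theorem inter_nonempty_intervalModel {i j : κ} :
    ((intervalModel a b ha hab hb hinj).arc i ∩
      (intervalModel a b ha hab hb hinj).arc j).Nonempty ↔ a i < b j ∧ a j < b i := by
  constructor
  · rintro ⟨x, h1, h2⟩
    rw [mem_arc_intervalModel] at h1 h2
    exact ⟨h1.1.trans h2.2, h2.1.trans h1.2⟩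
  · rintro ⟨h1, h2⟩
    obtain ⟨x, hx1, hx2⟩ := exists_between
      (max_lt (lt_min (hab i) h1) (lt_min h2 (hab j)) : max (a i) (a j) < min (b i) (b j))
    rw [max_lt_iff] at hx1
    rw [lt_min_iff] at hx2
    exact ⟨x, coe_mem_arc_intervalModel hx1.1 hx2.1, coe_mem_arc_intervalModel hx1.2 hx2.2⟩

/-- No arc contains `0`, whence normality. A common point of a pairwise intersecting family lies
between its largest left end and its smallest right end. -/
theorem isNHCA_intervalModel : (intervalModel a b ha hab hb hinj).IsNHCA := by
  constructor
  · intro i j _ h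
    have h0 : (0 : UnitAddCircle) ∈ (Set.univ : Set UnitAddCircle) := Set.mem_univ _
    rw [← h] at h0
    rcases h0 with h0 | h0 <;> rw [mem_arc_intervalModel, circlePos_self] at h0
    · exact lt_asymm h0.1 (ha i)
    · exact lt_asymm h0.1 (ha j)
  · intro F hF
    rcases F.eq_empty_or_nonempty with rfl | hne
    · exact ⟨0, by simp⟩
    obtain ⟨i, hi, hmax⟩ := Set.exists_max_image F a F.toFinite hne
    obtain ⟨j, hj, hmin⟩ := Set.exists_min_image F b F.toFinite hne
    obtain ⟨x, hx1, hx2⟩ := exists_between (inter_nonempty_intervalModel.1 (hF i hi j hj)).1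
    exact ⟨x, fun k hk => coe_mem_arc_intervalModel ((hmax k hk).trans_lt hx1)
      (hx2.trans_le (hmin k hk))⟩

end IntervalModel

/-- A finite graph with an interval order has a normal Helly model. -/
theorem IntervalOrder.exists_isNHCA {V : Type*} [Finite V] {G : SimpleGraph V}
    {lt : V → V → Prop} (h : IntervalOrder G lt) :
    ∃ (κ : Type) (_ : Finite κ) (N : CircularArcModel κ), N.IsNHCA ∧
      Nonempty (G ≃g N.intersectionGraph) := by
  classical
  have := Fintype.ofFinite V
  let n := Fintype.card V
  let e : V ≃ Fin n := Fintype.equivFin V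
  -- The canonical integer representation by intervals `[l v, r v]`: predecessor sets form a chain,
  -- so counting predecessors loses nothing.
  let l : V → ℕ := fun v => {u | lt u v}.ncard
  let r : V → ℕ := fun v => (Finset.univ.filter (fun w => ¬ lt v w)).sup l
  have hl : ∀ v, l v ≤ n := fun v => by
    refine (Set.ncard_le_card _).trans ?_
    simp [n]
  have hr : ∀ v, r v ≤ n := fun v => Finset.sup_le fun w _ => hl w
  have hlr : ∀ v w, l w ≤ r v ↔ ¬ lt v w := by
    intro v w
    constructor
    · intro hle hlt
      have : ∀ u, ¬ lt v u → l u < l w := by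
        intro u hu
        refine Set.ncard_lt_ncard ⟨fun x hx => ?_, fun hsub => hu (hsub hlt)⟩ (Set.toFinite _)
        exact (h.two_two x u v w hx hlt).resolve_right hu
      have h2 : r v < l w := by
        refine (Finset.sup_lt_iff ?_).2 fun u hu => this u (Finset.mem_filter.1 hu).2
        exact (Nat.zero_le _).trans_lt (this v (h.irrefl v))
      omega
    · intro hn
      exact Finset.le_sup (Finset.mem_filter.2 ⟨Finset.mem_univ _, hn⟩)
  -- Distinct perturbations below `1/2` make all endpoints different without changing which integer
  -- intervals meet; division by `n + 3` brings them into `(0, 1)`.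
  let ε : Fin n → ℝ := fun i => (i.val + 1) / (2 * (n + 2))
  have hn2 : (0 : ℝ) < 2 * (n + 2) := by positivity
  have hε0 : ∀ i, 0 < ε i := fun i => by positivity
  have hε1 : ∀ i, ε i < 1 / 2 := by
    intro i
    have : ((i.val : ℕ) : ℝ) + 1 ≤ n := by exact_mod_cast i.isLt
    rw [div_lt_div_iff₀ hn2 two_pos]
    linarith
  have hεinj : ∀ i j, ε i = ε j → i = j := by
    intro i j hij
    have : ((i.val : ℝ) + 1) = j.val + 1 := by
      simpa [ε, div_left_inj' hn2.ne'] using hij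
    exact Fin.ext (by exact_mod_cast add_right_cancel this)
  have hn3 : (0 : ℝ) < n + 3 := by positivity
  let a : Fin n → ℝ := fun i => (1 + l (e.symm i) - ε i) / (n + 3)
  let b : Fin n → ℝ := fun i => (1 + r (e.symm i) + ε i) / (n + 3)
  have hlt_iff : ∀ i j, a i < b j ↔ l (e.symm i) ≤ r (e.symm j) := by
    intro i j
    rw [div_lt_div_iff_of_pos_right hn3]
    constructor
    · intro hlt
      have : ((l (e.symm i) : ℕ) : ℝ) < (r (e.symm j) + 1 : ℕ) := by
        push_cast; linarith [hε1 i, hε1 j]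
      have := Nat.cast_lt.1 this
      omega
    · intro hle
      have : ((l (e.symm i) : ℕ) : ℝ) ≤ r (e.symm j) := Nat.cast_le.2 hle
      linarith [hε0 i, hε0 j]
  have hab : ∀ i, a i < b i := fun i => (hlt_iff i i).2 ((hlr _ _).2 (h.irrefl _))
  have ha : ∀ i, 0 < a i := fun i => by
    have : (0 : ℝ) ≤ l (e.symm i) := Nat.cast_nonneg _
    exact div_pos (by linarith [hε1 i]) hn3
  have hb : ∀ i, b i < 1 := fun i => by
    have : (r (e.symm i) : ℝ) ≤ n := Nat.cast_le.2 (hr _)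
    rw [div_lt_one hn3]
    linarith [hε1 i]
  have hint : ∀ (x y : ℕ) (z : ℝ), (x : ℝ) - y = z → -1 < z → z < 1 → z = 0 := by
    intro x y z hz h1 h2
    have h1' : ((-1 : ℤ) : ℝ) < ((x - y : ℤ) : ℝ) := by push_cast; linarith
    have h2' : ((x - y : ℤ) : ℝ) < ((1 : ℤ) : ℝ) := by push_cast; linarith
    have h3 := Int.cast_lt.1 h1'
    have h4 := Int.cast_lt.1 h2'
    have : x = y := by omega
    rw [← hz, this, sub_self]
  have hinj : Function.Injective (Sum.elim a b) := by
    rintro (i | i) (j | j) hij <;> simp only [Sum.elim_inl, Sum.elim_inr, a, b] at hij <;>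
      rw [div_left_inj' hn3.ne'] at hij
    · have := hint (l (e.symm i)) (l (e.symm j)) (ε i - ε j) (by linarith)
        (by linarith [hε0 i, hε1 j]) (by linarith [hε1 i, hε0 j])
      rw [hεinj i j (by linarith)]
    · have := hint (l (e.symm i)) (r (e.symm j)) (ε i + ε j) (by linarith)
        (by linarith [hε0 i, hε0 j]) (by linarith [hε1 i, hε1 j])
      linarith [hε0 i, hε0 j]
    · have := hint (l (e.symm j)) (r (e.symm i)) (ε j + ε i) (by linarith)
        (by linarith [hε0 i, hε0 j]) (by linarith [hε1 i, hε1 j])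
      linarith [hε0 i, hε0 j]
    · have := hint (r (e.symm i)) (r (e.symm j)) (ε j - ε i) (by linarith)
        (by linarith [hε0 j, hε1 i]) (by linarith [hε1 j, hε0 i])
      rw [hεinj i j (by linarith)]
  refine ⟨Fin n, inferInstance, intervalModel a b ha hab hb hinj, isNHCA_intervalModel, ⟨e, ?_⟩⟩
  intro v w
  rw [CircularArcModel.adj_iff, inter_nonempty_intervalModel, hlt_iff, hlt_iff, hlr, hlr,
    e.symm_apply_apply, e.symm_apply_apply, e.injective.ne_iff]
  constructor
  · rintro ⟨hne, h1, h2⟩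
    exact (h.adj_iff v w hne).2 ⟨h2, h1⟩
  · intro hadj
    have := (h.adj_iff v w hadj.ne).1 hadj
    exact ⟨hadj.ne, this.2, this.1⟩

/-- A model can be indexed by a type in the lowest universe. -/
theorem CircularArcModel.IsNHCA.exists_type {ι : Type*} [Finite ι] {M : CircularArcModel ι}
    (hM : M.IsNHCA) : ∃ (κ : Type) (_ : Finite κ) (N : CircularArcModel κ), N.IsNHCA ∧
      Nonempty (M.intersectionGraph ≃g N.intersectionGraph) := by
  let e := (Finite.equivFin ι)
  let N : CircularArcModel (Fin (Nat.card ι)) :=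
    { s := M.s ∘ e.symm
      t := M.t ∘ e.symm
      extremes_injective := by
        rw [← Sum.elim_comp_map]
        exact M.extremes_injective.comp (e.symm.injective.sumMap e.symm.injective) }
  have harc : ∀ i, N.arc i = M.arc (e.symm i) := fun _ => rfl
  refine ⟨_, inferInstance, N, ⟨?_, ?_⟩, ⟨e, ?_⟩⟩
  · intro i j hij
    exact hM.1 _ _ (e.symm.injective.ne hij)
  · intro F hF
    obtain ⟨p, hp⟩ := hM.2 (e ⁻¹' F) (by
      intro i hi j hj
      have := hF _ hi _ hj
      rwa [harc, harc, e.symm_apply_apply, e.symm_apply_apply] at this)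
    refine ⟨p, fun i hi => hp (e.symm i) ?_⟩
    simpa using hi
  · intro v w
    rw [adj_iff, adj_iff, harc, harc, e.symm_apply_apply, e.symm_apply_apply, e.injective.ne_iff]

/-! ### Local structure around a cover pair. -/

section CoverSetting

variable {V : Type*} {G : SimpleGraph V} {A B : V}

/-- `x` is different from `B` and not adjacent to it. -/
def FarFrom (G : SimpleGraph V) (B x : V) : Prop := x ≠ B ∧ ¬ G.Adj x B

/-- `x` is adjacent to `A` and to `B`. -/
def IsMid (G : SimpleGraph V) (A B x : V) : Prop := G.Adj x A ∧ G.Adj x B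

/-- `x` is adjacent to `A`, to `B` and to some vertex far from `B`. -/
def Reaches (G : SimpleGraph V) (A B x : V) : Prop :=
  IsMid G A B x ∧ ∃ a, FarFrom G B a ∧ G.Adj x a

/-- `x` is adjacent to `A` and `B`, but to no vertex that is far from `A` or `B`. -/
def IsInner (G : SimpleGraph V) (A B x : V) : Prop :=
  IsMid G A B x ∧ ¬ Reaches G A B x ∧ ¬ Reaches G B A x

/-- `x` and `y` are joined by a walk of inner vertices. -/
def InnerConn (G : SimpleGraph V) (A B : V) : V → V → Prop :=
  Relation.ReflTransGen fun u v => G.Adj u v ∧ IsInner G A B u ∧ IsInner G A B v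

theorem isMid_swap : IsMid G B A = IsMid G A B := by
  ext x; exact and_comm

theorem isInner_swap : IsInner G B A = IsInner G A B := by
  ext x; simp only [IsInner, isMid_swap (A := A) (B := B)]; tauto

theorem innerConn_swap : InnerConn G B A = InnerConn G A B := by
  simp only [InnerConn, isInner_swap (A := A) (B := B)]

/-- The graph has no induced net. -/
def NetFree (G : SimpleGraph V) : Prop :=
  ∀ x0 x1 x2 y0 y1 y2, G.Adj x0 x1 → G.Adj x0 x2 → G.Adj x1 x2 → G.Adj x0 y0 → G.Adj x1 y1 →
    G.Adj x2 y2 → ¬ G.Adj x0 y1 → ¬ G.Adj x0 y2 → ¬ G.Adj x1 y0 → ¬ G.Adj x1 y2 → ¬ G.Adj x2 y0 →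
    ¬ G.Adj x2 y1 → ¬ G.Adj y0 y1 → ¬ G.Adj y0 y2 → ¬ G.Adj y1 y2 → False

/-- A graph without forbidden induced subgraphs and without nets, together with a cover pair of
vertices none of which is universal. -/
structure CoverSetting (G : SimpleGraph V) (A B : V) : Prop where
  free : ForbiddenFree G
  net : NetFree G
  pair : CoverPair G A B
  farA : ∃ b, FarFrom G A b
  farB : ∃ a, FarFrom G B a

namespace CoverSetting

theorem symm (h : CoverSetting G A B) : CoverSetting G B A :=
  ⟨h.free, h.net, h.pair.symm, h.farB, h.farA⟩

theorem adj_of_far (h : CoverSetting G A B) {a : V} (ha : FarFrom G B a) : G.Adj a A := by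
  rcases h.pair.cover a a (Or.inl rfl) with (rfl | h') | (rfl | h')
  · exact absurd h.pair.adj ha.2
  · exact h'
  · exact absurd rfl ha.1
  · exact absurd h' ha.2

theorem not_adj_far (h : CoverSetting G A B) {a b : V} (ha : FarFrom G B a) (hb : FarFrom G A b) :
    ¬ G.Adj a b := by
  intro hab
  rcases h.pair.cover b a (Or.inr hab.symm) with (h' | h') | (h' | h')
  exacts [hb.1 h', hb.2 h', ha.1 h', ha.2 h']

theorem inner_not_adj_far {z a : V} (hz : IsInner G A B z) (ha : FarFrom G B a) : ¬ G.Adj z a :=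
  fun h => hz.2.1 ⟨hz.1, a, ha, h⟩

theorem inner_not_adj_far' {z b : V} (hz : IsInner G A B z) (hb : FarFrom G A b) : ¬ G.Adj z b :=
  inner_not_adj_far (isInner_swap (A := A) (B := B) ▸ hz) hb

end CoverSetting

/-- The path on four given vertices, as a sequence. -/
def fourPath (a b c d : V) : ℕ → V
  | 0 => a
  | 1 => b
  | 2 => c
  | _ => d

theorem isInducedPath_two {a b c : V} (hab : G.Adj a b) (hbc : G.Adj b c) (hac : a ≠ c)
    (nac : ¬ G.Adj a c) : IsInducedPath G 2 (fourPath a b c c) := by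
  intro i j hij hj
  have : (i = 0 ∧ j = 1) ∨ (i = 0 ∧ j = 2) ∨ (i = 1 ∧ j = 2) := by omega
  rcases this with ⟨rfl, rfl⟩ | ⟨rfl, rfl⟩ | ⟨rfl, rfl⟩ <;> simp [fourPath, *, hab.ne, hbc.ne]

theorem isInducedPath_one {a b : V} (hab : G.Adj a b) : IsInducedPath G 1 (fourPath a b b b) := by
  intro i j hij hj
  obtain ⟨rfl, rfl⟩ : i = 0 ∧ j = 1 := by omega
  simp [fourPath, hab, hab.ne]

theorem isInducedPath_three {a b c d : V} (hab : G.Adj a b) (hbc : G.Adj b c) (hcd : G.Adj c d)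
    (hac : a ≠ c) (had : a ≠ d) (hbd : b ≠ d) (nac : ¬ G.Adj a c) (nad : ¬ G.Adj a d)
    (nbd : ¬ G.Adj b d) : IsInducedPath G 3 (fourPath a b c d) := by
  intro i j hij hj
  have : (i = 0 ∧ j = 1) ∨ (i = 0 ∧ j = 2) ∨ (i = 0 ∧ j = 3) ∨ (i = 1 ∧ j = 2) ∨ (i = 1 ∧ j = 3) ∨
    (i = 2 ∧ j = 3) := by omega
  rcases this with ⟨rfl, rfl⟩ | ⟨rfl, rfl⟩ | ⟨rfl, rfl⟩ | ⟨rfl, rfl⟩ | ⟨rfl, rfl⟩ | ⟨rfl, rfl⟩ <;>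
    simp [fourPath, *, hab.ne, hbc.ne, hcd.ne]

theorem IsInducedPath.shift {k : ℕ} {f : ℕ → V} (h : IsInducedPath G k f) {k' c : ℕ}
    (hc : k' + c ≤ k) : IsInducedPath G k' (fun i => f (i + c)) := by
  intro i j hij hj
  have := h (i + c) (j + c) (by omega) (by omega)
  refine ⟨this.1, this.2.trans ?_⟩
  omega

theorem ForbiddenFree.no_four_wheel (hG : ForbiddenFree G) {w x y z h : V} (a1 : G.Adj w x)
    (a2 : G.Adj x y) (a3 : G.Adj y z) (a4 : G.Adj z w) (n1 : w ≠ y) (n2 : ¬ G.Adj w y) (n3 : x ≠ z)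
    (n4 : ¬ G.Adj x z) (hw : G.Adj h w) (hx : G.Adj h x) (hy : G.Adj h y) (hz : G.Adj h z) :
    False := by
  refine hG.no_wheel le_rfl (isInducedPath_two a1 a2 n1 n2) (z := z) (h := h) a4 a3.symm ?_ hz ?_
  · intro i h1 h2
    obtain rfl : i = 1 := by omega
    exact ⟨n3.symm, fun h => n4 h.symm⟩
  · intro i hi
    obtain rfl | rfl | rfl : i = 0 ∨ i = 1 ∨ i = 2 := by omega
    exacts [hw, hx, hy]

theorem ForbiddenFree.no_five_wheel (hG : ForbiddenFree G) {v w x y z h : V} (a0 : G.Adj v w)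
    (a1 : G.Adj w x) (a2 : G.Adj x y) (a3 : G.Adj y z) (a4 : G.Adj z v)
    (m1 : v ≠ x) (m2 : v ≠ y) (m3 : w ≠ y) (m4 : w ≠ z) (m5 : x ≠ z)
    (n1 : ¬ G.Adj v x) (n2 : ¬ G.Adj v y) (n3 : ¬ G.Adj w y) (n4 : ¬ G.Adj w z) (n5 : ¬ G.Adj x z)
    (hv : G.Adj h v) (hw : G.Adj h w) (hx : G.Adj h x) (hy : G.Adj h y) (hz : G.Adj h z) :
    False := by
  refine hG.no_wheel (by omega) (isInducedPath_three a0 a1 a2 m1 m2 m3 n1 n2 n3) (z := z) (h := h)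
    a4 a3.symm ?_ hz ?_
  · intro i h1 h2
    obtain rfl | rfl : i = 1 ∨ i = 2 := by omega
    exacts [⟨m4.symm, fun h => n4 h.symm⟩, ⟨m5.symm, fun h => n5 h.symm⟩]
  · intro i hi
    obtain rfl | rfl | rfl | rfl : i = 0 ∨ i = 1 ∨ i = 2 ∨ i = 3 := by omega
    exacts [hv, hw, hx, hy]

namespace CoverSetting

/-- The vertex opposite to `A` is far from `A`, so its closed neighbourhood lies in that of `B`;
thus `B` is the hub of a 4-wheel on the cycle. -/
theorem no_four_cycle_at (h : CoverSetting G A B) {x y z : V} (a1 : G.Adj A x)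
    (a2 : G.Adj x y) (a3 : G.Adj y z) (a4 : G.Adj z A) (n1 : A ≠ y) (n2 : ¬ G.Adj A y) (n3 : x ≠ z)
    (n4 : ¬ G.Adj x z) : False := by
  have hy : FarFrom G A y := ⟨n1.symm, fun h => n2 h.symm⟩
  have c1 : ∀ u, y = u ∨ G.Adj y u → u = B ∨ G.Adj u B := fun u hu =>
    (h.pair.cover y u hu).resolve_left fun h' => h'.elim hy.1 hy.2
  have hyB := h.symm.adj_of_far hy
  have hx := c1 x (Or.inr a2.symm)
  have hz := c1 z (Or.inr a3)
  have hxB : G.Adj x B := hx.resolve_left (by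
    rintro rfl
    rcases hz with hz | hz
    · exact n3 hz.symm
    · exact n4 hz.symm)
  have hzB : G.Adj z B := hz.resolve_left (by
    rintro rfl
    exact n4 hxB)
  exact h.free.no_four_wheel a1 a2 a3 a4 n1 n2 n3 n4 h.pair.adj.symm hxB.symm hyB.symm hzB.symm

/-- If `B` is off the cycle, it sees `w` and both cycle neighbours of `w`. Either it sees `y` too
and is a hub, or `y` is far from `B`; then `A` sees `x` and `z` and can replace `y`, giving a
four-cycle through `A`. -/
theorem no_four_cycle_far (h : CoverSetting G A B) {w x y z : V} (a1 : G.Adj w x)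
    (a2 : G.Adj x y) (a3 : G.Adj y z) (a4 : G.Adj z w) (n1 : w ≠ y) (n2 : ¬ G.Adj w y) (n3 : x ≠ z)
    (n4 : ¬ G.Adj x z) (hw : FarFrom G A w) : False := by
  by_cases hxB : x = B
  · subst hxB
    exact h.symm.no_four_cycle_at a2 a3 a4 a1 n3 n4 n1.symm fun h => n2 h.symm
  by_cases hyB : y = B
  · subst hyB
    exact n2 (h.symm.adj_of_far hw)
  by_cases hzB : z = B
  · subst hzB
    exact h.symm.no_four_cycle_at a4 a1 a2 a3 n3.symm (fun h => n4 h.symm) n1 n2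
  have c1 : ∀ u, G.Adj w u → u = B ∨ G.Adj u B := fun u hu =>
    (h.pair.cover w u (Or.inr hu)).resolve_left fun h' => h'.elim hw.1 hw.2
  have hx := (c1 x a1).resolve_left hxB
  have hz := (c1 z a4.symm).resolve_left hzB
  by_cases hy : G.Adj y B
  · exact h.free.no_four_wheel a1 a2 a3 a4 n1 n2 n3 n4 (h.symm.adj_of_far hw).symm hx.symm hy.symm
      hz.symm
  · have hy' : FarFrom G B y := ⟨hyB, hy⟩
    have c2 : ∀ u, G.Adj y u → u = A ∨ G.Adj u A := fun u hu =>
      (h.pair.cover u y (Or.inr hu.symm)).resolve_right fun h' => h'.elim hy'.1 hy'.2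
    have hxA : G.Adj x A := (c2 x a2.symm).resolve_left fun e => hw.2 (e ▸ a1)
    have hzA : G.Adj z A := (c2 z a3).resolve_left fun e => hw.2 (e ▸ a4.symm)
    exact h.no_four_cycle_at hxA.symm a1.symm a4.symm hzA hw.1.symm (fun h => hw.2 h.symm) n3 n4

/-- There is no induced cycle of length four. -/
theorem no_four_cycle (h : CoverSetting G A B) {w x y z : V} (a1 : G.Adj w x)
    (a2 : G.Adj x y) (a3 : G.Adj y z) (a4 : G.Adj z w) (n1 : w ≠ y) (n2 : ¬ G.Adj w y) (n3 : x ≠ z)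
    (n4 : ¬ G.Adj x z) : False := by
  have key : ∀ u, u = A ∨ G.Adj A u ∨ FarFrom G A u := by
    intro u
    by_cases hu : u = A
    · exact Or.inl hu
    · by_cases hu' : G.Adj A u
      · exact Or.inr (Or.inl hu')
      · exact Or.inr (Or.inr ⟨hu, fun h => hu' h.symm⟩)
  have n2' : ¬ G.Adj y w := fun h => n2 h.symm
  have n4' : ¬ G.Adj z x := fun h => n4 h.symm
  rcases key w with rfl | hw | hw
  · exact h.no_four_cycle_at a1 a2 a3 a4 n1 n2 n3 n4
  · rcases key x with rfl | hx | hx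
    · exact h.no_four_cycle_at a2 a3 a4 a1 n3 n4 n1.symm n2'
    · rcases key y with rfl | hy | hy
      · exact h.no_four_cycle_at a3 a4 a1 a2 n1.symm n2' n3.symm n4'
      · rcases key z with rfl | hz | hz
        · exact h.no_four_cycle_at a4 a1 a2 a3 n3.symm n4' n1 n2
        · exact h.free.no_four_wheel a1 a2 a3 a4 n1 n2 n3 n4 hw hx hy hz
        · exact h.no_four_cycle_far a4 a1 a2 a3 n3.symm n4' n1 n2 hz
      · exact h.no_four_cycle_far a3 a4 a1 a2 n1.symm n2' n3.symm n4' hy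
    · exact h.no_four_cycle_far a2 a3 a4 a1 n3 n4 n1.symm n2' hx
  · exact h.no_four_cycle_far a1 a2 a3 a4 n1 n2 n3 n4 hw

/-- A vertex reaching both sides is adjacent to every middle vertex. -/
theorem adj_mid (h : CoverSetting G A B) {X v : V} (hX : Reaches G A B X) (hX' : Reaches G B A X)
    (hv : IsMid G A B v) (hne : X ≠ v) : G.Adj X v := by
  by_contra hXv
  obtain ⟨hm, a, ha, hXa⟩ := hX
  obtain ⟨-, b, hb, hXb⟩ := hX'
  have hab := h.not_adj_far ha hb
  -- If `v` saw `a`, then `a v B X` would be an induced four-cycle; likewise for `b` with `A`. What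
  -- remains is a 3-sun on the triangle `A B X` with `a`, `b`, `v`.
  have hva : ¬ G.Adj v a := fun hva =>
    h.no_four_cycle hva.symm hv.2 hm.2.symm hXa ha.1 ha.2 hne.symm fun h => hXv h.symm
  have hvb : ¬ G.Adj v b := fun hvb =>
    h.no_four_cycle hvb.symm hv.1 hm.1.symm hXb hb.1 hb.2 hne.symm fun h => hXv h.symm
  exact h.free.no_sun h.pair.adj hm.1.symm hm.2.symm hv.1.symm hv.2.symm hXv
    (fun h => hb.2 h.symm) (h.symm.adj_of_far hb).symm hXb (h.adj_of_far ha).symm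
    (fun h => ha.2 h.symm) hXa hvb hva fun h => hab h.symm

/-- The neighbourhoods, among the vertices far from `B`, of vertices reaching them form a chain. -/
theorem far_chain (h : CoverSetting G A B) {X X' a a' : V} (hX : Reaches G A B X)
    (hX' : Reaches G A B X') (ha : FarFrom G B a) (ha' : FarFrom G B a') (h1 : G.Adj X a)
    (h2 : ¬ G.Adj X' a) (h3 : G.Adj X' a') (h4 : ¬ G.Adj X a') : False := by
  have hne : X ≠ X' := by rintro rfl; exact h2 h1
  have naa : a ≠ a' := by rintro rfl; exact h2 h3
  have hA := h.adj_of_far ha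
  have hA' := h.adj_of_far ha'
  by_cases hXX : G.Adj X X'
  · have haa : ¬ G.Adj a a' := fun haa =>
      h.no_four_cycle h1.symm hXX h3 haa.symm (by rintro rfl; exact ha.2 hX'.1.2)
        (fun h => h2 h.symm) (by rintro rfl; exact ha'.2 hX.1.2) h4
    have rs : ∀ {X X' a a' b}, Reaches G A B X → Reaches G A B X' → FarFrom G B a →
        FarFrom G B a' → G.Adj X a → ¬ G.Adj X' a → G.Adj X' a' → ¬ G.Adj X a' → G.Adj X X' →
        ¬ G.Adj a a' → FarFrom G A b → G.Adj X b → ¬ G.Adj X' b → False := by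
      intro X X' a a' b hX hX' ha ha' h1 h2 h3 h4 hXX haa hb hXb hXb'
      refine h.free.no_risingSun (isInducedPath_one hX'.1.2) (S := A) (T := X) (e1 := a')
        (e2 := b) (e3 := a) hX.1.1.symm ?_ ?_ (h.adj_of_far ha') h3.symm (fun h => h4 h.symm) ?_
        hXb.symm (h.symm.adj_of_far hb) hb.2 ?_ (h.adj_of_far ha) h1.symm ?_
        (h.not_adj_far ha' hb) (fun h => haa h.symm) fun h' => h.not_adj_far ha hb h'.symm
      · intro i hi
        obtain rfl | rfl : i = 0 ∨ i = 1 := by omega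
        exacts [hX'.1.1.symm, h.pair.adj]
      · intro i hi
        obtain rfl | rfl : i = 0 ∨ i = 1 := by omega
        exacts [hXX, hX.1.2]
      · intro i hi hi'
        obtain rfl : i = 1 := by omega
        exact ha'.2
      · intro i hi
        obtain rfl : i = 0 := by omega
        exact fun h => hXb' h.symm
      · intro i hi
        obtain rfl | rfl : i = 0 ∨ i = 1 := by omega
        exacts [fun h => h2 h.symm, ha.2]
    have c : ∀ b, FarFrom G A b → (G.Adj X b ↔ G.Adj X' b) := fun b hb =>
      ⟨fun hb1 => by_contra fun hb2 => rs hX hX' ha ha' h1 h2 h3 h4 hXX haa hb hb1 hb2,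
        fun hb1 => by_contra fun hb2 => rs hX' hX ha' ha h3 h4 h1 h2 hXX.symm
          (fun h => haa h.symm) hb hb1 hb2⟩
    obtain ⟨b, hb⟩ := h.farA
    by_cases hXb : G.Adj X b
    · exact h.free.no_sun hXX hX.1.1 hX'.1.1 hXb ((c b hb).1 hXb) (fun h => hb.2 h.symm) h4 h3
        hA'.symm h1 h2 hA.symm (fun h' => h.not_adj_far ha' hb h'.symm)
        (fun h' => h.not_adj_far ha hb h'.symm) fun h => haa h.symm
    · exact h.net X X' B a a' b hXX hX.1.2 hX'.1.2 h1 h3 (h.symm.adj_of_far hb).symm h4 hXb h2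
        (fun h' => hXb ((c b hb).2 h')) (fun h => ha.2 h.symm) (fun h => ha'.2 h.symm) haa
        (h.not_adj_far ha hb) (h.not_adj_far ha' hb)
  · have nb : ∀ b, FarFrom G A b → ¬ G.Adj X b ∧ ¬ G.Adj X' b := by
      intro b hb
      refine ⟨fun hXb => hXX (h.adj_mid hX ⟨hX.1.symm, b, hb, hXb⟩ hX'.1 hne), fun hXb => ?_⟩
      exact hXX (h.adj_mid hX' ⟨hX'.1.symm, b, hb, hXb⟩ hX.1 hne.symm).symm
    by_cases haa : G.Adj a a'
    · exact h.free.no_five_wheel h1.symm hX.1.2 hX'.1.2.symm h3 haa.symm ha.1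
        (by rintro rfl; exact ha.2 hX'.1.2) hne (by rintro rfl; exact ha'.2 hX.1.2) ha'.1.symm ha.2
        (fun h => h2 h.symm) hXX h4 (fun h => ha'.2 h.symm) hA.symm hX.1.1.symm h.pair.adj
        hX'.1.1.symm hA'.symm
    · obtain ⟨b, hb⟩ := h.farA
      exact h.free.no_umbrella h1.symm hX.1.2 hX'.1.2.symm h3 ha.2 (fun h => h2 h.symm) haa hXX h4
        (fun h => ha'.2 h.symm) hA.symm hX.1.1.symm h.pair.adj hX'.1.1.symm hA'.symm
        (fun h' => h.not_adj_far ha hb h'.symm) (fun h => (nb b hb).1 h.symm)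
        (h.symm.adj_of_far hb) (fun h => (nb b hb).2 h.symm)
        (fun h' => h.not_adj_far ha' hb h'.symm) hb.2

/-- Some vertex far from `B` is adjacent to all the vertices that reach this side. -/
theorem exists_far_common [Finite V] (h : CoverSetting G A B) :
    ∃ a, FarFrom G B a ∧ ∀ X, Reaches G A B X → G.Adj X a := by
  obtain ⟨a, ha, hmax⟩ := Set.exists_max_image {a | FarFrom G B a}
    (fun a => {X | Reaches G A B X ∧ G.Adj X a}.ncard) (Set.toFinite _) h.farB
  refine ⟨a, ha, fun X hX => by_contra fun hXa => ?_⟩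
  obtain ⟨-, a', ha', hXa'⟩ := id hX
  refine absurd (hmax a' ha') (not_le.2 (Set.ncard_lt_ncard ⟨?_, fun hsub => ?_⟩ (Set.toFinite _)))
  · rintro X' ⟨hX', h'⟩
    exact ⟨hX', by_contra fun hc => h.far_chain hX hX' ha' ha hXa' hc h' hXa⟩
  · exact hXa (hsub ⟨hX, hXa'⟩).2

/-- A common far neighbour `a` exists, and non-adjacent `X`, `X'` would form the induced four-cycle
`a X B X'`. -/
theorem reaches_clique [Finite V] (h : CoverSetting G A B) {X X' : V} (hX : Reaches G A B X)
    (hX' : Reaches G A B X') (hne : X ≠ X') : G.Adj X X' := by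
  obtain ⟨a, ha, hall⟩ := h.exists_far_common
  by_contra hXX
  exact h.no_four_cycle (hall X hX).symm hX.1.2 hX'.1.2.symm (hall X' hX') ha.1 ha.2 hne hXX

/-- The neighbourhoods among the inner vertices of the vertices reaching one side form a chain. -/
theorem inner_chain [Finite V] (h : CoverSetting G A B) {X X' z z' : V} (hX : Reaches G A B X)
    (hX' : Reaches G A B X') (hz : IsInner G A B z) (hz' : IsInner G A B z') (h1 : G.Adj X z)
    (h2 : ¬ G.Adj X' z) (h3 : G.Adj X' z') (h4 : ¬ G.Adj X z') : False := by
  have hne : X ≠ X' := by rintro rfl; exact h2 h1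
  have hXX := h.reaches_clique hX hX' hne
  obtain ⟨a, ha, hall⟩ := h.exists_far_common
  have hzz : ¬ G.Adj z z' := fun hzz =>
    h.no_four_cycle h1.symm hXX h3 hzz.symm (by rintro rfl; exact hz.2.1 hX')
      (fun h => h2 h.symm) (by rintro rfl; exact hz'.2.1 hX) h4
  -- The triangle is `X X' B`; `a` sees `X` and `X'`, while `z'` and `z` each see `B` and one of
  -- them.
  exact h.free.no_sun hXX hX.1.2 hX'.1.2 (hall X hX) (hall X' hX') (fun h => ha.2 h.symm)
    h4 h3 hz'.1.2.symm h1 h2 hz.1.2.symm (fun h => inner_not_adj_far hz' ha h.symm)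
    (fun h => inner_not_adj_far hz ha h.symm) fun h => hzz h.symm

/-- A vertex that reaches one side is adjacent, or its neighbour reaching the other side is
adjacent, to any given inner vertex. -/
theorem adj_or_adj_inner (h : CoverSetting G A B) {X Y z : V} (hX : Reaches G A B X)
    (hY : Reaches G B A Y) (hXY : G.Adj X Y) (hz : IsInner G A B z) : G.Adj X z ∨ G.Adj Y z := by
  by_contra hc
  push Not at hc
  have hXz : X ≠ z := by rintro rfl; exact hz.2.1 hX
  have hYz : Y ≠ z := by rintro rfl; exact hz.2.2 hY
  have hX' : ¬ Reaches G B A X := fun hX' => hc.1 (h.adj_mid hX hX' hz.1 hXz)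
  have hY' : ¬ Reaches G A B Y := fun hY' => hc.2 (h.adj_mid hY' hY hz.1 hYz)
  obtain ⟨hXm, a, ha, hXa⟩ := hX
  obtain ⟨hYm, b, hb, hYb⟩ := hY
  -- The path is `X Y`, dominated by `A` and `B`; neither of `X`, `Y` reaches the opposite side, so
  -- `a` and `b` attach to the correct ends only.
  refine h.free.no_risingSun (isInducedPath_one hXY) (S := A) (T := B) (e1 := a) (e2 := b)
    (e3 := z) h.pair.adj ?_ ?_ (h.adj_of_far ha) hXa.symm ha.2 ?_ (h.symm.adj_of_far hb) hYb.symm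
    hb.2 ?_ hz.1.1 hz.1.2 ?_ (h.not_adj_far ha hb) (fun h' => inner_not_adj_far hz ha h'.symm)
    fun h' => inner_not_adj_far' hz hb h'.symm
  · intro i hi
    obtain rfl | rfl : i = 0 ∨ i = 1 := by omega
    exacts [hXm.1.symm, hYm.2.symm]
  · intro i hi
    obtain rfl | rfl : i = 0 ∨ i = 1 := by omega
    exacts [hXm.2.symm, hYm.1.symm]
  · intro i hi hi'
    obtain rfl : i = 1 := by omega
    exact fun h' => hY' ⟨hYm.symm, a, ha, h'.symm⟩
  · intro i hi
    obtain rfl : i = 0 := by omega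
    exact fun h' => hX' ⟨hXm.symm, b, hb, h'.symm⟩
  · intro i hi
    obtain rfl | rfl : i = 0 ∨ i = 1 := by omega
    exacts [fun h => hc.1 h.symm, fun h => hc.2 h.symm]

end CoverSetting

end CoverSetting

/-! ### Comparing the components of inner vertices. -/

section InnerComponents

variable {V : Type*} {G : SimpleGraph V} {A B : V}

theorem InnerConn.symm {x y : V} (h : InnerConn G A B x y) : InnerConn G A B y x := by
  induction h with
  | refl => exact .refl
  | tail _ h ih => exact .head ⟨h.1.symm, h.2.2, h.2.1⟩ ih

theorem InnerConn.trans {x y z : V} (h : InnerConn G A B x y) (h' : InnerConn G A B y z) :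
    InnerConn G A B x z :=
  Relation.ReflTransGen.trans h h'

theorem InnerConn.inner {x y : V} (h : InnerConn G A B x y) (hx : IsInner G A B x) :
    IsInner G A B y := by
  rcases Relation.ReflTransGen.cases_tail h with h | ⟨_, _, h⟩
  · exact h ▸ hx
  · exact h.2.2

/-- A component that meets a set and its complement has an edge leaving the set. -/
theorem InnerConn.exists_boundary {x y z : V} {P : V → Prop} (hy : InnerConn G A B x y)
    (hz : InnerConn G A B x z) (hPy : P y) (hPz : ¬ P z) :
    ∃ u v, InnerConn G A B x u ∧ InnerConn G A B x v ∧ G.Adj u v ∧ P u ∧ ¬ P v := by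
  have h := hy.symm.trans hz
  clear hz
  induction h with
  | refl => exact absurd hPy hPz
  | @tail b c hb hbc ih =>
    by_cases hPb : P b
    · exact ⟨b, c, hy.trans hb, hy.trans (hb.tail hbc), hbc.1, hPb, hPz⟩
    · exact ih hPb

theorem InnerConn.not_adj {x y u w : V} (hx : IsInner G A B x) (hy : IsInner G A B y)
    (hxy : ¬ InnerConn G A B x y) (hu : InnerConn G A B x u) (hw : InnerConn G A B y w) :
    ¬ G.Adj u w := fun h =>
  hxy ((hu.tail ⟨h, hu.inner hx, hw.inner hy⟩).trans hw.symm)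

namespace CoverSetting

/-- A vertex reaching one side cannot split two components of inner vertices. -/
theorem no_double_split (h : CoverSetting G A B) {X x y u u' w w' : V} (hX : Reaches G A B X)
    (hx : IsInner G A B x) (hy : IsInner G A B y) (hxy : ¬ InnerConn G A B x y)
    (hu : InnerConn G A B x u) (hu' : InnerConn G A B x u') (hw : InnerConn G A B y w)
    (hw' : InnerConn G A B y w') (h1 : G.Adj X u) (h2 : ¬ G.Adj X u') (h3 : G.Adj X w)
    (h4 : ¬ G.Adj X w') : False := by
  obtain ⟨u, u', hu, hu', huu, h1, h2⟩ := hu.exists_boundary hu' (P := fun v => G.Adj X v) h1 h2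
  obtain ⟨w, w', hw, hw', hww, h3, h4⟩ := hw.exists_boundary hw' (P := fun v => G.Adj X v) h3 h4
  have hn : ∀ {p q}, InnerConn G A B x p → InnerConn G A B y q → ¬ G.Adj p q :=
    fun hp hq => InnerConn.not_adj hx hy hxy hp hq
  obtain ⟨hm, a, ha, hXa⟩ := hX
  have hf : ∀ {z}, IsInner G A B z → ¬ G.Adj a z := fun hz h' => inner_not_adj_far hz ha h'.symm
  have iu := hu.inner hx
  have iu' := hu'.inner hx
  have iw := hw.inner hy
  have iw' := hw'.inner hy
  -- The umbrella has path `u' u X w w'`, hub `B`, and `a` hanging from `X`.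
  exact h.free.no_umbrella huu.symm h1.symm h3 hww (fun h => h2 h.symm) (hn hu' hw) (hn hu' hw')
    (hn hu hw) (hn hu hw') h4 iu'.1.2.symm iu.1.2.symm hm.2.symm iw.1.2.symm iw'.1.2.symm
    (hf iu') (hf iu) hXa.symm (hf iw) (hf iw') ha.2

/-- Both `X` and `X'` split the component of `y0`, so neither splits that of `x0`: `X'` is complete
to it and `X` misses it. A shortest path from `X` through the component of `y0` to a vertex missed
by `X'` gives, without its last vertex, the path of a rising sun dominated by `X'` and `B`; the last
vertex, `a` and `x` are the three outer vertices. -/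
theorem not_opposite_same_side_aux [Finite V] (h : CoverSetting G A B) {X X' x0 y0 x y y' : V}
    (hX : Reaches G A B X) (hX' : Reaches G A B X') (hx0 : IsInner G A B x0)
    (hy0 : IsInner G A B y0) (hxy : ¬ InnerConn G A B x0 y0) (hx : InnerConn G A B x0 x)
    (hy : InnerConn G A B y0 y) (hy' : InnerConn G A B y0 y')
    (hsub : ∀ z, IsInner G A B z → G.Adj X z → G.Adj X' z) (h1 : G.Adj X y) (h2 : ¬ G.Adj X x)
    (h3 : ∃ x', InnerConn G A B x0 x' ∧ G.Adj X' x') (h4 : ¬ G.Adj X' y') : False := by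
  obtain ⟨x', hx', h3⟩ := h3
  have ix := hx.inner hx0
  have hX'y := hsub y (hy.inner hy0) h1
  have hXy' : ¬ G.Adj X y' := fun hc => h4 (hsub y' (hy'.inner hy0) hc)
  have hX'D : ∀ u, InnerConn G A B x0 u → G.Adj X' u := fun u hu => by_contra fun hc =>
    h.no_double_split hX' hx0 hy0 hxy hx' hu hy hy' h3 hc hX'y h4
  have hXD : ∀ u, InnerConn G A B x0 u → ¬ G.Adj X u := fun u hu hc =>
    h.no_double_split hX hx0 hy0 hxy hu hx hy hy' hc h2 h1 hXy'
  have hne : X ≠ X' := by rintro rfl; exact h2 (hX'D x hx)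
  have hXX := h.reaches_clique hX hX' hne
  obtain ⟨a, ha, hall⟩ := h.exists_far_common
  have hchain : Relation.ReflTransGen (fun u v => G.Adj u v ∧ (v = X ∨ InnerConn G A B y0 v))
      X y' := by
    have : ∀ v, InnerConn G A B y v → Relation.ReflTransGen
        (fun u v => G.Adj u v ∧ (v = X ∨ InnerConn G A B y0 v)) X v := by
      intro v hv
      induction hv with
      | refl => exact .single ⟨h1, Or.inr hy⟩
      | @tail b c hb hbc ih => exact ih.tail ⟨hbc.1, Or.inr (hy.trans (hb.tail hbc))⟩
    exact this y' (hy.symm.trans hy')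
  obtain ⟨k, f, hf, f0, fk, fD, fS, fT⟩ := exists_isInducedPath G (S := fun v => v = X)
    (T := fun v => InnerConn G A B y0 v ∧ ¬ G.Adj X' v) rfl ⟨hy', h4⟩ (Or.inl rfl) hchain
  have hin : ∀ i, 0 < i → i ≤ k → InnerConn G A B y0 (f i) := fun i h0 hi =>
    (fD i hi).resolve_left (fS i h0 hi)
  have hk0 : k ≠ 0 := by
    rintro rfl
    exact (f0 ▸ fk.1.inner hy0).2.1 hX
  have hk1 : k ≠ 1 := by
    rintro rfl
    have : G.Adj (f 0) (f 1) := (hf.adj_iff (by omega) (by omega)).2 (Or.inl rfl)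
    exact fk.2 (hsub _ (fk.1.inner hy0) (f0 ▸ this))
  have hX'f : ∀ i, 0 < i → i < k → G.Adj X' (f i) := fun i h0 hi => by_contra fun hc =>
    fT i hi ⟨hin i h0 hi.le, hc⟩
  have hnf : ∀ i, 0 < i → i ≤ k → ∀ c, FarFrom G B c → ¬ G.Adj c (f i) := fun i h0 hi c hc h' =>
    inner_not_adj_far ((hin i h0 hi).inner hy0) hc h'.symm
  refine h.free.no_risingSun (hf.shift (k' := k - 1) (c := 0) (by omega)) (S := X') (T := B)
    (e1 := a) (e2 := f k) (e3 := x) hX'.1.2 ?_ ?_ (hall X' hX').symm ?_ ha.2 ?_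
    (fk.1.inner hy0).1.2 ?_ (fun h => fk.2 h.symm) ?_ (hX'D x hx).symm ix.1.2 ?_
    (hnf k (by omega) le_rfl a ha) (fun h' => inner_not_adj_far ix ha h'.symm)
    (fun h' => InnerConn.not_adj hx0 hy0 hxy hx fk.1 h'.symm)
  · intro i hi
    rcases Nat.eq_zero_or_pos i with rfl | h0
    · simpa [f0] using hXX.symm
    · exact hX'f i h0 (by omega)
  · intro i hi
    rcases Nat.eq_zero_or_pos i with rfl | h0
    · simpa [f0] using hX.1.2.symm
    · exact ((hin i h0 (by omega)).inner hy0).1.2.symm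
  · simpa [f0] using (hall X hX).symm
  · intro i h0 hi
    exact hnf i h0 (by omega) a ha
  · exact (hf.adj_iff le_rfl (by omega)).2 (Or.inr (by omega))
  · intro i hi hc
    have := (hf.adj_iff le_rfl (by omega)).1 hc
    omega
  · intro i hi
    rcases Nat.eq_zero_or_pos i with rfl | h0
    · simpa [f0] using fun h' => hXD x hx (G.adj_symm h')
    · exact InnerConn.not_adj hx0 hy0 hxy hx (hin i h0 (by omega))

/-- Two vertices reaching the same side do not order two components in opposite ways. -/
theorem not_opposite_same_side [Finite V] (h : CoverSetting G A B) {X X' x0 y0 x x' y y' : V}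
    (hX : Reaches G A B X) (hX' : Reaches G A B X') (hx0 : IsInner G A B x0)
    (hy0 : IsInner G A B y0) (hxy : ¬ InnerConn G A B x0 y0) (hx : InnerConn G A B x0 x)
    (hx' : InnerConn G A B x0 x') (hy : InnerConn G A B y0 y) (hy' : InnerConn G A B y0 y')
    (h1 : G.Adj X y) (h2 : ¬ G.Adj X x) (h3 : G.Adj X' x') (h4 : ¬ G.Adj X' y') : False := by
  -- By `inner_chain` the inner neighbourhoods of `X` and `X'` are nested; the two cases differ by
  -- exchanging the roles of the vertices and of the components.
  by_cases hsub : ∀ z, IsInner G A B z → G.Adj X z → G.Adj X' z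
  · exact h.not_opposite_same_side_aux hX hX' hx0 hy0 hxy hx hy hy' hsub h1 h2 ⟨x', hx', h3⟩ h4
  · push Not at hsub
    obtain ⟨z, hz, hz1, hz2⟩ := hsub
    refine h.not_opposite_same_side_aux hX' hX hy0 hx0 (fun hc => hxy hc.symm) hy' hx' hx ?_ h3 h4
      ⟨y, hy, h1⟩ h2
    intro z' hz' hz1'
    by_contra hz2'
    exact h.inner_chain hX hX' hz hz' hz1 hz2 hz1' hz2'

/-- Vertices reaching different sides do not order two components in opposite ways. -/
theorem not_opposite_other_side (h : CoverSetting G A B) {X Y x0 y0 x x' y y' : V}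
    (hX : Reaches G A B X) (hY : Reaches G B A Y) (hx0 : IsInner G A B x0)
    (hy0 : IsInner G A B y0) (hxy : ¬ InnerConn G A B x0 y0) (hx : InnerConn G A B x0 x)
    (hx' : InnerConn G A B x0 x') (hy : InnerConn G A B y0 y) (hy' : InnerConn G A B y0 y')
    (h1 : G.Adj X y) (h2 : ¬ G.Adj X x) (h3 : G.Adj Y y') (h4 : ¬ G.Adj Y x') : False := by
  have ix := hx.inner hx0
  have ix' := hx'.inner hx0
  have hXn : ∀ {z}, IsInner G A B z → X ≠ z := by rintro z hz rfl; exact hz.2.1 hX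
  have hYn : ∀ {z}, IsInner G A B z → Y ≠ z := by rintro z hz rfl; exact hz.2.2 hY
  have hX' : ¬ Reaches G B A X := fun hX' => h2 (h.adj_mid hX hX' ix.1 (hXn ix))
  have hY' : ¬ Reaches G A B Y := fun hY' => h4 (h.adj_mid hY' hY ix'.1 (hYn ix'))
  have hne : X ≠ Y := by rintro rfl; exact hX' hY
  obtain ⟨hXm, a, ha, hXa⟩ := id hX
  obtain ⟨hYm, b, hb, hYb⟩ := id hY
  have hnD : ∀ {p q}, InnerConn G A B x0 p → InnerConn G A B y0 q → ¬ G.Adj p q :=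
    fun hp hq => InnerConn.not_adj hx0 hy0 hxy hp hq
  -- If some `z` of the first component is missed by both, an induced path from `X` to `Y` through
  -- the second component forms a rising sun dominated by `A` and `B`, with `a`, `b`, `z`.
  by_cases hz : ∃ z, InnerConn G A B x0 z ∧ ¬ G.Adj X z ∧ ¬ G.Adj Y z
  · obtain ⟨z, hzD, hXz, hYz⟩ := hz
    have iz := hzD.inner hx0
    have hchain : Relation.ReflTransGen
        (fun u v => G.Adj u v ∧ (v = X ∨ v = Y ∨ InnerConn G A B y0 v)) X Y := by
      have : ∀ v, InnerConn G A B y v → Relation.ReflTransGen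
          (fun u v => G.Adj u v ∧ (v = X ∨ v = Y ∨ InnerConn G A B y0 v)) X v := by
        intro v hv
        induction hv with
        | refl => exact .single ⟨h1, Or.inr (Or.inr hy)⟩
        | @tail b c hb hbc ih => exact ih.tail ⟨hbc.1, Or.inr (Or.inr (hy.trans (hb.tail hbc)))⟩
      exact (this y' (hy.symm.trans hy')).tail ⟨h3.symm, Or.inr (Or.inl rfl)⟩
    obtain ⟨k, f, hf, f0, fk, fD, fS, fT⟩ := exists_isInducedPath G (S := fun v => v = X)
      (T := fun v => v = Y) rfl rfl (Or.inl rfl) hchain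
    have hcase : ∀ i ≤ k, f i = X ∨ f i = Y ∨ InnerConn G A B y0 (f i) := fD
    have hX1 : ∀ i, 0 < i → i ≤ k → f i = Y ∨ InnerConn G A B y0 (f i) := fun i h0 hi =>
      (fD i hi).resolve_left (fS i h0 hi)
    have hY1 : ∀ i, i < k → f i = X ∨ InnerConn G A B y0 (f i) := fun i hi =>
      (fD i hi.le).imp_right fun h' => h'.resolve_left (fT i hi)
    refine h.free.no_risingSun hf (S := A) (T := B) (e1 := a) (e2 := b) (e3 := z) h.pair.adj ?_ ?_
      (h.adj_of_far ha) (f0 ▸ hXa.symm) ha.2 ?_ (h.symm.adj_of_far hb) (fk ▸ hYb.symm) hb.2 ?_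
      iz.1.1 iz.1.2 ?_ (h.not_adj_far ha hb) (fun h' => inner_not_adj_far iz ha h'.symm)
      fun h' => inner_not_adj_far' iz hb h'.symm
    · intro i hi
      rcases fD i hi with e | e | e
      · exact e ▸ hXm.1.symm
      · exact e ▸ hYm.2.symm
      · exact (e.inner hy0).1.1.symm
    · intro i hi
      rcases fD i hi with e | e | e
      · exact e ▸ hXm.2.symm
      · exact e ▸ hYm.1.symm
      · exact (e.inner hy0).1.2.symm
    · intro i h0 hi hc
      rcases hX1 i h0 hi with e | e
      · exact hY' ⟨hYm.symm, a, ha, (e ▸ hc).symm⟩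
      · exact inner_not_adj_far (e.inner hy0) ha hc.symm
    · intro i hi hc
      rcases hY1 i hi with e | e
      · exact hX' ⟨hXm.symm, b, hb, (e ▸ hc).symm⟩
      · exact inner_not_adj_far' (e.inner hy0) hb hc.symm
    · intro i hi hc
      rcases fD i hi with e | e | e
      · exact hXz (e ▸ hc).symm
      · exact hYz (e ▸ hc).symm
      · exact hnD hzD e hc
  · push Not at hz
    have hor : ∀ z, InnerConn G A B x0 z → G.Adj X z ∨ G.Adj Y z := fun z hzD =>
      or_iff_not_imp_left.2 fun hc => hz z hzD hc
    have hYx := hz x hx h2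
    have hXx' := (hor x' hx').resolve_right h4
    -- Now both `X` and `Y` split the first component, so by `no_double_split` both are complete to
    -- the second one.
    have hXD' : ∀ w, InnerConn G A B y0 w → G.Adj X w := fun w hw => by_contra fun hc =>
      h.no_double_split hX hx0 hy0 hxy hx' hx hy hw hXx' h2 h1 hc
    have hYD' : ∀ w, InnerConn G A B y0 w → G.Adj Y w := fun w hw => by_contra fun hc => by
      have hxy' : ¬ InnerConn G B A x0 y0 := by rwa [innerConn_swap]
      rw [← innerConn_swap] at hx hx' hy' hw
      rw [← isInner_swap] at hx0 hy0
      exact h.symm.no_double_split hY hx0 hy0 hxy' hx hx' hy' hw hYx h4 h3 hc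
    have hXy := h1
    have hYy := hYD' y hy
    have iy := hy.inner hy0
    have hchain : Relation.ReflTransGen (fun u v => G.Adj u v ∧ InnerConn G A B x0 v) x' x := by
      have : ∀ v, InnerConn G A B x' v → Relation.ReflTransGen
          (fun u v => G.Adj u v ∧ InnerConn G A B x0 v) x' v := by
        intro v hv
        induction hv with
        | refl => exact .refl
        | @tail b c hb hbc ih => exact ih.tail ⟨hbc.1, hx'.trans (hb.tail hbc)⟩
      exact this x (hx'.symm.trans hx)
    -- On this path `Y` misses only the first vertex and `X` only the last. Depending on its length
    -- and on whether `X` and `Y` are adjacent, it gives a four-cycle, a 5-wheel with hub `A`, or a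
    -- (rising) sun dominated by `X` and `Y`.
    obtain ⟨k, f, hf, f0, fk, fD, fS, fT⟩ := exists_isInducedPath G
      (S := fun v => InnerConn G A B x0 v ∧ ¬ G.Adj Y v)
      (T := fun v => InnerConn G A B x0 v ∧ ¬ G.Adj X v) ⟨hx', h4⟩ ⟨hx, h2⟩ hx' hchain
    have hXf : ∀ i < k, G.Adj X (f i) := fun i hi => by_contra fun hc => fT i hi ⟨fD i hi.le, hc⟩
    have hYf : ∀ i, 0 < i → i ≤ k → G.Adj Y (f i) := fun i h0 hi => by_contra fun hc =>
      fS i h0 hi ⟨fD i hi, hc⟩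
    have hinf : ∀ i ≤ k, IsInner G A B (f i) := fun i hi => (fD i hi).inner hx0
    have hyf : ∀ i ≤ k, ¬ G.Adj y (f i) := fun i hi h' => hnD (fD i hi) hy h'.symm
    have hyfne : ∀ i ≤ k, y ≠ f i := by
      intro i hi e
      exact hxy ((e ▸ fD i hi).trans hy.symm)
    have hk0 : k ≠ 0 := by
      rintro rfl
      exact (hor _ (fD 0 le_rfl)).elim fk.2 f0.2
    by_cases hk1 : k = 1
    · subst hk1
      have h01 : G.Adj (f 0) (f 1) := (hf.adj_iff (by omega) le_rfl).2 (Or.inl rfl)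
      have hX0 := hXf 0 (by omega)
      have hY1 := hYf 1 (by omega) le_rfl
      by_cases hXY : G.Adj X Y
      · exact h.no_four_cycle hX0 h01 hY1.symm hXY.symm (hXn (hinf 1 le_rfl)) fk.2
          (hYn (hinf 0 (by omega))).symm fun h => f0.2 h.symm
      · exact h.free.no_five_wheel hX0 h01 hY1.symm hYy hXy.symm (hXn (hinf 1 le_rfl)) hne
          (hYn (hinf 0 (by omega))).symm (hyfne 0 (by omega)).symm (hyfne 1 le_rfl).symm fk.2 hXY
          (fun h => f0.2 h.symm) (fun h => hyf 0 (by omega) h.symm)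
          (fun h => hyf 1 (by omega) h.symm) (h := A) hXm.1.symm (hinf 0 (by omega)).1.1.symm
          (hinf 1 le_rfl).1.1.symm hYm.2.symm iy.1.1.symm
    · by_cases hXY : G.Adj X Y
      · refine h.free.no_risingSun (hf.shift (k' := k - 2) (c := 1) (by omega)) (S := X) (T := Y)
          (e1 := f 0) (e2 := f k) (e3 := y) hXY ?_ ?_ (hXf 0 (by omega)).symm ?_
          (fun h => f0.2 h.symm) ?_ (hYf k (by omega) le_rfl).symm ?_ (fun h => fk.2 h.symm) ?_
          hXy.symm hYy.symm ?_ ?_ (fun h => hyf 0 (by omega) h.symm)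
          fun h => hyf k le_rfl h.symm
        · exact fun i hi => hXf _ (by omega)
        · exact fun i hi => hYf _ (by omega) (by omega)
        · exact (hf.adj_iff (by omega) (by omega)).2 (Or.inl rfl)
        · intro i h0 hi hc
          have := (hf.adj_iff (by omega) (by omega)).1 hc
          omega
        · exact (hf.adj_iff (by omega) (by omega)).2 (Or.inr (by omega))
        · intro i hi hc
          have := (hf.adj_iff (by omega) (by omega)).1 hc
          omega
        · exact fun i hi => hyf _ (by omega)
        · intro hc
          have := (hf.adj_iff (by omega) (by omega)).1 hc
          omega
      · exact h.no_four_cycle (hXf 1 (by omega)) (hYf 1 (by omega) (by omega)).symm hYy hXy.symm hne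
          hXY (hyfne 1 (by omega)).symm fun h => hyf 1 (by omega) h.symm

end CoverSetting

/-- The component of `x` may be placed before the component of `y`. -/
def MayPrecede (G : SimpleGraph V) (A B x y : V) : Prop :=
  ∀ x' y', InnerConn G A B x x' → InnerConn G A B y y' →
    (∀ X, Reaches G A B X → G.Adj X y' → G.Adj X x') ∧
    (∀ Y, Reaches G B A Y → G.Adj Y x' → G.Adj Y y')

namespace CoverSetting

/-- If both placements fail, each failure has a witness reaching one of the two sides; the four
combinations are excluded by the preceding lemmas. -/
theorem mayPrecede_total [Finite V] (h : CoverSetting G A B) {x y : V} (hx : IsInner G A B x)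
    (hy : IsInner G A B y) (hxy : ¬ InnerConn G A B x y) :
    MayPrecede G A B x y ∨ MayPrecede G A B y x := by
  by_contra hc
  rw [not_or] at hc
  obtain ⟨hc1, hc2⟩ := hc
  simp only [MayPrecede, not_forall, not_and_or] at hc1 hc2
  obtain ⟨x1, y1, hx1, hy1, ⟨X, hX, h1, h2⟩ | ⟨Y, hY, h1, h2⟩⟩ := hc1 <;>
    obtain ⟨y2, x2, hy2, hx2, ⟨X', hX', h3, h4⟩ | ⟨Y', hY', h3, h4⟩⟩ := hc2
  · exact h.not_opposite_same_side hX hX' hx hy hxy hx1 hx2 hy1 hy2 h1 h2 h3 h4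
  · exact h.not_opposite_other_side hX hY' hx hy hxy hx1 hx2 hy1 hy2 h1 h2 h3 h4
  · exact h.not_opposite_other_side hX' hY hy hx (fun h => hxy h.symm) hy2 hy1 hx2 hx1 h3 h4 h1 h2
  · have hxy' : ¬ InnerConn G B A x y := by rwa [innerConn_swap]
    rw [← innerConn_swap] at hx1 hx2 hy1 hy2
    rw [← isInner_swap] at hx hy
    exact h.symm.not_opposite_same_side hY' hY hx hy hxy' hx2 hx1 hy2 hy1 h3 h4 h1 h2

end CoverSetting

end InnerComponents

/-! ### Assembling an interval order from orders on the parts. -/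

section Assembly

variable {V : Type*} {G : SimpleGraph V} {A B : V}

/-- A strict order on the vertices far from `B`, towards the vertices reaching this side. -/
structure SideOrder (G : SimpleGraph V) (A B : V) (lt : V → V → Prop) : Prop where
  dom : ∀ x y, lt x y → (FarFrom G B x ∧ FarFrom G B y) ∧ x ≠ y ∧ ¬ G.Adj x y
  total : ∀ x y, FarFrom G B x → FarFrom G B y → x ≠ y → ¬ G.Adj x y → lt x y ∨ lt y x
  trans : ∀ x y z, lt x y → lt y z → lt x z
  up : ∀ X x y, Reaches G A B X → lt x y → G.Adj X x → G.Adj X y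

/-- A strict order on each set of inner vertices joined by `R`, from the vertices reaching the first
side to those reaching the second one. -/
structure InnerOrder (G : SimpleGraph V) (A B : V) (R : V → V → Prop) (lt : V → V → Prop) :
    Prop where
  dom : ∀ x y, lt x y → (IsInner G A B x ∧ IsInner G A B y) ∧ R x y ∧ x ≠ y ∧ ¬ G.Adj x y
  total : ∀ x y, IsInner G A B x → IsInner G A B y → R x y → x ≠ y → ¬ G.Adj x y →
    lt x y ∨ lt y x
  trans : ∀ x y z, lt x y → lt y z → lt x z
  down : ∀ X x y, Reaches G A B X → lt x y → G.Adj X y → G.Adj X x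
  up : ∀ Y x y, Reaches G B A Y → lt x y → G.Adj Y x → G.Adj Y y

theorem MayPrecede.congr {x y x' y' : V} (h : MayPrecede G A B x y) (hx : InnerConn G A B x x')
    (hy : InnerConn G A B y y') : MayPrecede G A B x' y' := fun u v hu hv =>
  h u v (hx.trans hu) (hy.trans hv)

theorem MayPrecede.trans {x y z : V} (h : MayPrecede G A B x y) (h' : MayPrecede G A B y z) :
    MayPrecede G A B x z := fun u v hu hv =>
  ⟨fun X hX hv' => (h u y hu .refl).1 X hX ((h' y v .refl hv).1 X hX hv'),
    fun Y hY hu' => (h' y v .refl hv).2 Y hY ((h u y hu .refl).2 Y hY hu')⟩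

/-- Vertices have labels that agree exactly on the components of inner vertices. -/
theorem exists_component_label [Finite V] (G : SimpleGraph V) (A B : V) :
    ∃ r : V → ℕ, ∀ x y, r x = r y ↔ InnerConn G A B x y := by
  let e := Finite.equivFin V
  let r : V → ℕ := fun x => sInf {n | ∃ x', InnerConn G A B x x' ∧ (e x').val = n}
  have hr : ∀ x, ∃ x', InnerConn G A B x x' ∧ (e x').val = r x := fun x =>
    Nat.sInf_mem (s := {n | ∃ x', InnerConn G A B x x' ∧ (e x').val = n}) ⟨_, x, .refl, rfl⟩
  refine ⟨r, fun x y => ⟨fun h => ?_, fun h => ?_⟩⟩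
  · obtain ⟨x', hx, hx'⟩ := hr x
    obtain ⟨y', hy, hy'⟩ := hr y
    have : x' = y' := e.injective (Fin.ext (by rw [hx', hy', h]))
    subst this
    exact hx.trans hy.symm
  · have : ∀ u, InnerConn G A B x u ↔ InnerConn G A B y u :=
      fun u => ⟨fun hu => h.symm.trans hu, fun hu => h.trans hu⟩
    simp only [r, this]

theorem CoverSetting.exists_innerOrder [Finite V] (h : CoverSetting G A B) {lc : V → V → Prop}
    (hl : InnerOrder G A B (InnerConn G A B) lc) :
    ∃ lt, InnerOrder G A B (fun _ _ => True) lt := by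
  obtain ⟨r, hr⟩ := exists_component_label G A B
  -- Components that may precede each other in both directions are ordered by their labels; this
  -- makes the relation antisymmetric while keeping it transitive.
  let lo : V → V → Prop := fun x y => IsInner G A B x ∧ IsInner G A B y ∧
    ¬ InnerConn G A B x y ∧ MayPrecede G A B x y ∧ (MayPrecede G A B y x → r x < r y)
  have hcongr : ∀ {x y x' y'}, lo x y → InnerConn G A B x x' → InnerConn G A B y y' →
      lo x' y' := by
    rintro x y x' y' ⟨h1, h2, h3, h4, h5⟩ hx hy
    refine ⟨hx.inner h1, hy.inner h2, fun hc => h3 ((hx.trans hc).trans hy.symm), h4.congr hx hy,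
      fun hp => ?_⟩
    rw [← (hr _ _).2 hx, ← (hr _ _).2 hy]
    exact h5 (hp.congr hy.symm hx.symm)
  refine ⟨fun x y => lc x y ∨ lo x y, ?_, ?_, ?_, ?_, ?_⟩
  · rintro x y (hxy | ⟨h1, h2, h3, -⟩)
    · have := hl.dom x y hxy
      exact ⟨this.1, trivial, this.2.2⟩
    · exact ⟨⟨h1, h2⟩, trivial, fun e => h3 (e ▸ .refl), InnerConn.not_adj h1 h2 h3 .refl .refl⟩
  · intro x y hx hy _ hne hadj
    by_cases hc : InnerConn G A B x y
    · exact (hl.total x y hx hy hc hne hadj).imp Or.inl Or.inl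
    · have hc' : ¬ InnerConn G A B y x := fun h => hc h.symm
      have hrne : r x ≠ r y := fun e => hc ((hr x y).1 e)
      by_cases h1 : MayPrecede G A B x y
      · by_cases h2 : MayPrecede G A B y x
        · rcases lt_or_gt_of_ne hrne with hlt | hlt
          · exact Or.inl (Or.inr ⟨hx, hy, hc, h1, fun _ => hlt⟩)
          · exact Or.inr (Or.inr ⟨hy, hx, hc', h2, fun _ => hlt⟩)
        · exact Or.inl (Or.inr ⟨hx, hy, hc, h1, fun h => absurd h h2⟩)
      · have h2 := (h.mayPrecede_total hx hy hc).resolve_left h1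
        exact Or.inr (Or.inr ⟨hy, hx, hc', h2, fun h => absurd h h1⟩)
  · rintro x y z (hxy | hxy) (hyz | hyz)
    · exact Or.inl (hl.trans x y z hxy hyz)
    · exact Or.inr (hcongr hyz (hl.dom x y hxy).2.1.symm .refl)
    · exact Or.inr (hcongr hxy .refl (hl.dom y z hyz).2.1)
    · right
      obtain ⟨h1, h2, h3, h4, h5⟩ := hxy
      obtain ⟨g1, g2, g3, g4, g5⟩ := hyz
      refine ⟨h1, g2, fun hc => ?_, h4.trans g4, fun hp => ?_⟩
      · have e := (hr x z).2 hc
        have := h5 (g4.congr .refl hc.symm)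
        have := g5 (h4.congr hc .refl)
        omega
      · exact (h5 (g4.trans hp)).trans (g5 (hp.trans h4))
  · rintro X x y hX (hxy | hxy) hadj
    · exact hl.down X x y hX hxy hadj
    · exact (hxy.2.2.2.1 x y .refl .refl).1 X hX hadj
  · rintro Y x y hY (hxy | hxy) hadj
    · exact hl.up Y x y hY hxy hadj
    · exact (hxy.2.2.2.1 x y .refl .refl).2 Y hY hadj

/-- A transitive orientation of the non-adjacent pairs of a graph without induced four-cycles is an
interval order. -/
theorem intervalOrder_of_trans {lt : V → V → Prop} (hirr : ∀ x, ¬ lt x x)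
    (htrans : ∀ x y z, lt x y → lt y z → lt x z)
    (hadj : ∀ v w, v ≠ w → (G.Adj v w ↔ ¬ lt v w ∧ ¬ lt w v))
    (hfour : ∀ w x y z, G.Adj w x → G.Adj x y → G.Adj y z → G.Adj z w → w ≠ y → ¬ G.Adj w y →
      x ≠ z → ¬ G.Adj x z → False) : IntervalOrder G lt where
  irrefl := hirr
  adj_iff := hadj
  two_two x y z w hxy hzw := by
    by_contra hc
    rw [not_or] at hc
    obtain ⟨h1, h2⟩ := hc
    have hne : ∀ {a b}, lt a b → a ≠ b := by rintro a b hab rfl; exact hirr _ hab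
    have hnadj : ∀ {a b}, lt a b → ¬ G.Adj a b := fun hab ha =>
      ((hadj _ _ ha.ne).1 ha).1 hab
    -- Two independent comparisons `x < y`, `z < w` would make `x z y w` an induced four-cycle,
    -- since any comparison between the pairs yields one of the excluded ones by transitivity.
    have key : ∀ {a b c d}, lt a b → lt c d → ¬ lt a d → ¬ lt c b → G.Adj a d ∧ G.Adj a c := by
      intro a b c d hab hcd had hcb
      have n1 : ¬ lt d a := fun h => hcb (htrans _ _ _ (htrans _ _ _ hcd h) hab)
      have n2 : a ≠ d := by rintro rfl; exact hcb (htrans _ _ _ hcd hab)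
      have n3 : ¬ lt a c := fun h => had (htrans _ _ _ h hcd)
      have n4 : ¬ lt c a := fun h => hcb (htrans _ _ _ h hab)
      have n5 : a ≠ c := by rintro rfl; exact had hcd
      exact ⟨(hadj _ _ n2).2 ⟨had, n1⟩, (hadj _ _ n5).2 ⟨n3, n4⟩⟩
    obtain ⟨e1, e2⟩ := key hxy hzw h1 h2
    obtain ⟨e3, -⟩ := key hzw hxy h2 h1
    have e4 : G.Adj y w := by
      have n1 : ¬ lt y w := fun h => h1 (htrans _ _ _ hxy h)
      have n2 : ¬ lt w y := fun h => h2 (htrans _ _ _ hzw h)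
      have n3 : y ≠ w := by rintro rfl; exact h1 hxy
      exact (hadj _ _ n3).2 ⟨n1, n2⟩
    exact hfour x z y w e2 e3 e4 e1.symm (hne hxy) (hnadj hxy) (hne hzw) (hnadj hzw)

/-- Orders on the two sides and on the inner vertices assemble to an interval order. -/
theorem CoverSetting.exists_intervalOrder [Finite V] (h : CoverSetting G A B)
    {la lb li : V → V → Prop} (ha : SideOrder G A B la) (hb : SideOrder G B A lb)
    (hi : InnerOrder G A B (fun _ _ => True) li) : ∃ lt, IntervalOrder G lt := by
  classical
  -- The five groups from left to right. Vertices reaching both sides get rank 1, so those of rank 3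
  -- other than `B` see nothing far from `B`.
  let rk : V → ℕ := fun x => if FarFrom G B x then 0 else if FarFrom G A x then 4 else
    if IsInner G A B x then 2 else if x = A ∨ Reaches G A B x then 1 else 3
  have hrk : ∀ x, (rk x = 0 ∧ FarFrom G B x) ∨ (rk x = 1 ∧ (x = A ∨ Reaches G A B x)) ∨
      (rk x = 2 ∧ IsInner G A B x) ∨
      (rk x = 3 ∧ (x = B ∨ (Reaches G B A x ∧ ¬ Reaches G A B x))) ∨
      (rk x = 4 ∧ FarFrom G A x) := by
    intro x
    by_cases h0 : FarFrom G B x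
    · simp [rk, h0]
    by_cases h4 : FarFrom G A x
    · simp [rk, h0, h4]
    by_cases h2 : IsInner G A B x
    · simp [rk, h0, h4, h2]
    by_cases h1 : x = A ∨ Reaches G A B x
    · simp [rk, h0, h4, h2, h1]
    have h3 : x = B ∨ (Reaches G B A x ∧ ¬ Reaches G A B x) := by
      by_cases hxB : x = B
      · exact Or.inl hxB
      · have hm : IsMid G A B x := by
          refine ⟨by_contra fun hc => h4 ⟨fun e => h1 (Or.inl e), hc⟩,
            by_contra fun hc => h0 ⟨hxB, hc⟩⟩
        refine Or.inr ⟨by_contra fun hc => h2 ⟨hm, fun hr => h1 (Or.inr hr), hc⟩,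
          fun hr => h1 (Or.inr hr)⟩
    simp [rk, h0, h4, h2, h1, h3]
  have n0 : ∀ {x}, rk x = 0 → FarFrom G B x := by intro x hx; have := hrk x; grind
  have n1 : ∀ {x}, rk x = 1 → (x = A ∨ Reaches G A B x) := by
    intro x hx; have := hrk x; grind
  have n2 : ∀ {x}, rk x = 2 → IsInner G A B x := by intro x hx; have := hrk x; grind
  have n3 : ∀ {x}, rk x = 3 → (x = B ∨ (Reaches G B A x ∧ ¬ Reaches G A B x)) := by
    intro x hx; have := hrk x; grind
  have n4 : ∀ {x}, rk x = 4 → FarFrom G A x := by intro x hx; have := hrk x; grind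
  have hle : ∀ x, rk x ≤ 4 := by intro x; have := hrk x; omega
  have c1 : ∀ {x y}, rk x = 1 → rk y = 1 → x ≠ y → G.Adj x y := by
    intro x y hx hy hne
    rcases n1 hx with rfl | hx <;> rcases n1 hy with rfl | hy
    · exact absurd rfl hne
    · exact hy.1.1.symm
    · exact hx.1.1
    · exact h.reaches_clique hx hy hne
  have c3 : ∀ {x y}, rk x = 3 → rk y = 3 → x ≠ y → G.Adj x y := by
    intro x y hx hy hne
    rcases n3 hx with rfl | ⟨hx, -⟩ <;> rcases n3 hy with rfl | ⟨hy, -⟩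
    · exact absurd rfl hne
    · exact hy.1.1.symm
    · exact hx.1.1
    · exact h.symm.reaches_clique hx hy hne
  -- The order `lb` is reversed: a side order points towards the centre, which is to the left for
  -- the vertices far from `A`.
  let lo : V → V → Prop := fun x y => (rk x = 0 ∧ rk y = 0 ∧ la x y) ∨
    (rk x = 2 ∧ rk y = 2 ∧ li x y) ∨ (rk x = 4 ∧ rk y = 4 ∧ lb y x)
  let lt : V → V → Prop := fun x y => x ≠ y ∧ ¬ G.Adj x y ∧ (rk x < rk y ∨ lo x y)
  have lo_eq : ∀ {x y}, lo x y → rk x = rk y := by rintro x y (h | h | h) <;> omega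
  have lt_le : ∀ {x y}, lt x y → rk x ≤ rk y := by
    rintro x y ⟨-, -, h | h⟩
    · exact h.le
    · exact (lo_eq h).le
  have lt0 : ∀ {x y}, lt x y → rk x = 0 → rk y = 0 → la x y := by
    rintro x y ⟨-, -, h | h | h | h⟩ hx hy
    · omega
    · exact h.2.2
    · omega
    · omega
  have lt2 : ∀ {x y}, lt x y → rk x = 2 → rk y = 2 → li x y := by
    rintro x y ⟨-, -, h | h | h | h⟩ hx hy
    · omega
    · omega
    · exact h.2.2
    · omega
  have lt4 : ∀ {x y}, lt x y → rk x = 4 → rk y = 4 → lb y x := by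
    rintro x y ⟨-, -, h | h | h | h⟩ hx hy
    · omega
    · omega
    · omega
    · exact h.2.2
  have l1 : ∀ {x y}, lt x y → rk x = 1 → rk y ≠ 1 := fun hxy hx hy =>
    hxy.2.1 (c1 hx hy hxy.1)
  have l3 : ∀ {x y}, lt x y → rk x = 3 → rk y ≠ 3 := fun hxy hx hy =>
    hxy.2.1 (c3 hx hy hxy.1)
  have midOf : ∀ {x}, IsInner G A B x → IsMid G A B x := fun hx => hx.1
  have htrans : ∀ x y z, lt x y → lt y z → lt x z := by
    intro x y z hxy hyz
    have hxy' := lt_le hxy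
    have hyz' := lt_le hyz
    by_cases heq : rk x = rk z
    · have hcase : rk x = 0 ∨ rk x = 1 ∨ rk x = 2 ∨ rk x = 3 ∨ rk x = 4 := by
        have := hle x; omega
      rcases hcase with hx | hx | hx | hx | hx
      · have := ha.trans x y z (lt0 hxy hx (by omega)) (lt0 hyz (by omega) (by omega))
        exact ⟨(ha.dom x z this).2.1, (ha.dom x z this).2.2,
          Or.inr (Or.inl ⟨hx, by omega, this⟩)⟩
      · exact absurd (by omega) (l1 hxy hx)
      · have := hi.trans x y z (lt2 hxy hx (by omega)) (lt2 hyz (by omega) (by omega))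
        exact ⟨(hi.dom x z this).2.2.1, (hi.dom x z this).2.2.2,
          Or.inr (Or.inr (Or.inl ⟨hx, by omega, this⟩))⟩
      · exact absurd (by omega) (l3 hxy hx)
      · have := hb.trans z y x (lt4 hyz (by omega) (by omega)) (lt4 hxy hx (by omega))
        exact ⟨(hb.dom z x this).2.1.symm, fun h => (hb.dom z x this).2.2 h.symm,
          Or.inr (Or.inr (Or.inr ⟨hx, by omega, this⟩))⟩
    -- With `x` and `z` in different groups only their non-adjacency is needed. If they were
    -- adjacent, monotonicity of the part orders, `adj_mid` or `adj_or_adj_inner` would make `y`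
    -- adjacent to one of them, or the groups themselves forbid the edge.
    · refine ⟨fun e => heq (e ▸ rfl), fun hxz => ?_, Or.inl (by omega)⟩
      have hx4 := hle x
      have hy4 := hle y
      have hz4 := hle z
      rcases (by omega : rk x = 0 ∨ rk x = 1 ∨ rk x = 2 ∨ rk x = 3) with hx | hx | hx | hx
      · have fx := n0 hx
        rcases (by omega : rk z = 1 ∨ rk z = 2 ∨ rk z = 3 ∨ rk z = 4) with hz | hz | hz | hz
        · rcases (by omega : rk y = 0 ∨ rk y = 1) with hy | hy
          · rcases n1 hz with rfl | rz
            · exact hyz.2.1 (h.adj_of_far (n0 hy))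
            · exact hyz.2.1 (ha.up z x y rz (lt0 hxy hx hy) hxz.symm).symm
          · exact l1 hyz hy hz
        · exact inner_not_adj_far (n2 hz) fx hxz.symm
        · rcases n3 hz with rfl | ⟨rz, rz'⟩
          · exact fx.2 hxz
          · exact rz' ⟨rz.1.symm, x, fx, hxz.symm⟩
        · exact h.not_adj_far fx (n4 hz) hxz
      · rcases (by omega : rk z = 2 ∨ rk z = 3 ∨ rk z = 4) with hz | hz | hz
        · have hy : rk y = 2 := by have := l1 hxy hx; omega
          rcases n1 hx with rfl | rx
          · exact hxy.2.1 (n2 hy).1.1.symm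
          · exact hxy.2.1 (hi.down x y z rx (lt2 hyz hy hz) hxz)
        · have hy : rk y = 2 := by
            have := l1 hxy hx
            have : rk y ≠ 3 := fun hy => l3 hyz hy hz
            omega
          rcases n1 hx with rfl | rx
          · exact hxy.2.1 (n2 hy).1.1.symm
          rcases n3 hz with rfl | ⟨rz, -⟩
          · exact hyz.2.1 (n2 hy).1.2
          · exact (h.adj_or_adj_inner rx rz hxz (n2 hy)).elim hxy.2.1 fun h => hyz.2.1 h.symm
        · have fz := n4 hz
          rcases n1 hx with rfl | rx
          · exact fz.2 hxz.symm
          have rx' : Reaches G B A x := ⟨rx.1.symm, z, fz, hxz⟩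
          rcases (by have := l1 hxy hx; omega : rk y = 2 ∨ rk y = 3 ∨ rk y = 4) with hy | hy | hy
          · exact hxy.2.1 (h.adj_mid rx rx' (n2 hy).1 hxy.1)
          · rcases n3 hy with rfl | ⟨ry, -⟩
            · exact hxy.2.1 rx.1.2
            · exact hxy.2.1 (h.adj_mid rx rx' ry.1.symm hxy.1)
          · exact hxy.2.1 (hb.up x z y rx' (lt4 hyz hy hz) hxz)
      · rcases (by omega : rk z = 3 ∨ rk z = 4) with hz | hz
        · have hy : rk y = 2 := by
            have : rk y ≠ 3 := fun hy => l3 hyz hy hz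
            omega
          rcases n3 hz with rfl | ⟨rz, -⟩
          · exact hyz.2.1 (n2 hy).1.2
          · exact hyz.2.1 (hi.up z x y rz (lt2 hxy hx hy) hxz.symm).symm
        · exact inner_not_adj_far' (n2 hx) (n4 hz) hxz
      · have hz : rk z = 4 := by omega
        have hy : rk y = 4 := by have := l3 hxy hx; omega
        rcases n3 hx with rfl | ⟨rx, -⟩
        · exact hxy.2.1 (h.symm.adj_of_far (n4 hy)).symm
        · exact hxy.2.1 (hb.up x z y rx (lt4 hyz hy hz) hxz)
  refine ⟨lt, intervalOrder_of_trans (fun x hx => hx.1 rfl) htrans ?_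
    fun w x y z => h.no_four_cycle⟩
  intro v w hne
  constructor
  · exact fun hvw => ⟨fun hlt => hlt.2.1 hvw, fun hlt => hlt.2.1 hvw.symm⟩
  · rintro ⟨h1, h2⟩
    by_contra hvw
    have hwv : ¬ G.Adj w v := fun h => hvw h.symm
    have hnlt : rk v = rk w := by
      by_contra hc
      rcases lt_or_gt_of_ne hc with hc | hc
      · exact h1 ⟨hne, hvw, Or.inl hc⟩
      · exact h2 ⟨hne.symm, hwv, Or.inl hc⟩
    have hcase : rk v = 0 ∨ rk v = 1 ∨ rk v = 2 ∨ rk v = 3 ∨ rk v = 4 := by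
      have := hle v; omega
    rcases hcase with hv | hv | hv | hv | hv
    · rcases ha.total v w (n0 hv) (n0 (hnlt ▸ hv)) hne hvw with hc | hc
      · exact h1 ⟨hne, hvw, Or.inr (Or.inl ⟨hv, hnlt ▸ hv, hc⟩)⟩
      · exact h2 ⟨hne.symm, hwv, Or.inr (Or.inl ⟨hnlt ▸ hv, hv, hc⟩)⟩
    · exact hvw (c1 hv (hnlt ▸ hv) hne)
    · rcases hi.total v w (n2 hv) (n2 (hnlt ▸ hv)) trivial hne hvw with hc | hc
      · exact h1 ⟨hne, hvw, Or.inr (Or.inr (Or.inl ⟨hv, hnlt ▸ hv, hc⟩))⟩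
      · exact h2 ⟨hne.symm, hwv, Or.inr (Or.inr (Or.inl ⟨hnlt ▸ hv, hv, hc⟩))⟩
    · exact hvw (c3 hv (hnlt ▸ hv) hne)
    · rcases hb.total v w (n4 hv) (n4 (hnlt ▸ hv)) hne hvw with hc | hc
      · exact h2 ⟨hne.symm, hwv, Or.inr (Or.inr (Or.inr ⟨hnlt ▸ hv, hv, hc⟩))⟩
      · exact h1 ⟨hne, hvw, Or.inr (Or.inr (Or.inr ⟨hv, hnlt ▸ hv, hc⟩))⟩

end Assembly

/-! ### Reading the orders off a Helly model. -/

namespace CircularArcModel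

variable {ι : Type*} [Finite ι] {M : CircularArcModel ι}

/-- Of three arcs with a common point, one is contained in the union of the others. -/
theorem not_private_points {i0 i1 i2 : ι} {p w0 w1 w2 : UnitAddCircle} (p0 : p ∈ M.arc i0)
    (p1 : p ∈ M.arc i1) (p2 : p ∈ M.arc i2) (h0 : w0 ∈ M.arc i0 ∧ w0 ∉ M.arc i1 ∧ w0 ∉ M.arc i2)
    (h1 : w1 ∈ M.arc i1 ∧ w1 ∉ M.arc i0 ∧ w1 ∉ M.arc i2)
    (h2 : w2 ∈ M.arc i2 ∧ w2 ∉ M.arc i0 ∧ w2 ∉ M.arc i1) : False := by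
  -- Seen from `p`, the middle one of three private points would lie between two points missed by
  -- its own arc.
  have n01 : circlePos p w0 ≠ circlePos p w1 := fun e => h1.2.1 (circlePos_injective p e ▸ h0.1)
  have n02 : circlePos p w0 ≠ circlePos p w2 := fun e => h2.2.1 (circlePos_injective p e ▸ h0.1)
  have n12 : circlePos p w1 ≠ circlePos p w2 := fun e => h2.2.2 (circlePos_injective p e ▸ h1.1)
  rcases lt_or_gt_of_ne n01 with a | a <;> rcases lt_or_gt_of_ne n02 with b | b <;>
    rcases lt_or_gt_of_ne n12 with c | c
  · exact notMem_arc_of_between p1 h0.2.1 h2.2.2 a c h1.1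
  · exact notMem_arc_of_between p2 h0.2.2 h1.2.2 b c h2.1
  · linarith
  · exact notMem_arc_of_between p0 h2.2.1 h1.2.1 b a h0.1
  · exact notMem_arc_of_between p0 h1.2.1 h2.2.1 a b h0.1
  · linarith
  · exact notMem_arc_of_between p2 h1.2.2 h0.2.2 c b h2.1
  · exact notMem_arc_of_between p1 h2.2.2 h0.2.1 c a h1.1

/-- The intersection graph of a Helly model has no induced net. -/
theorem IsHCA.netFree (hM : M.IsHCA) : NetFree M.intersectionGraph := by
  intro x0 x1 x2 y0 y1 y2 a01 a02 a12 b0 b1 b2 n01 n02 n10 n12 n20 n21 _ _ _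
  obtain ⟨p, p0, p1, p2⟩ := hM.exists_common_three (Or.inr a01) (Or.inr a02) (Or.inr a12)
  have key : ∀ {i k y w}, M.intersectionGraph.Adj i k → ¬ M.intersectionGraph.Adj k y →
      ¬ M.intersectionGraph.Adj i y → w ∈ M.arc y → w ∉ M.arc i := by
    rintro i k y w hik hk hn hy hi
    by_cases e : i = y
    · exact hk (e ▸ hik.symm)
    · exact hn (adj_of_mem e hi hy)
  obtain ⟨-, w0, h0, h0'⟩ := b0
  obtain ⟨-, w1, h1, h1'⟩ := b1
  obtain ⟨-, w2, h2, h2'⟩ := b2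
  exact not_private_points p0 p1 p2 ⟨h0, key a12 n20 n10 h0', key a12.symm n10 n20 h0'⟩
    ⟨h1, key a02 n21 n01 h1', key a02.symm n01 n21 h1'⟩
    ⟨h2, key a01 n12 n02 h2', key a01.symm n02 n12 h2'⟩

/-- Two disjoint arcs missing the base point are ordered pointwise. -/
theorem pos_lt_or_lt {q : UnitAddCircle} {i j : ι} (hne : i ≠ j)
    (hij : ¬ M.intersectionGraph.Adj i j) (hi : q ∉ M.arc i) (hj : q ∉ M.arc j) :
    (∀ u ∈ M.arc i, ∀ v ∈ M.arc j, circlePos q u < circlePos q v) ∨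
      ∀ v ∈ M.arc j, ∀ u ∈ M.arc i, circlePos q v < circlePos q u := by
  have hdis : ∀ u, u ∈ M.arc i → u ∉ M.arc j := fun u hu hu' => hij (adj_of_mem hne hu hu')
  by_contra hc
  push Not at hc
  obtain ⟨⟨u, hu, v, hv, h1⟩, v', hv', u', hu', h2⟩ := hc
  have hn : ∀ u v, u ∈ M.arc i → v ∈ M.arc j → circlePos q u ≠ circlePos q v := fun u v hu hv e =>
    hdis u hu (circlePos_injective q e ▸ hv)
  have h1 := h1.lt_of_ne (hn u v hu hv).symm
  have h2 := h2.lt_of_ne (hn u' v' hu' hv')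
  rcases lt_or_gt_of_ne (hn u v' hu hv') with h3 | h3
  · exact hdis u hu (mem_arc_of_between hj hv hv' h1 h3)
  · exact hdis v' (mem_arc_of_between hi hu' hu h2 h3) hv'

/-- An arc missing the base point and the point `p` lies on one side of `p`. -/
theorem pos_lt_or_gt {q p : UnitAddCircle} {i : ι} (hq : q ∉ M.arc i) (hp : p ∉ M.arc i) :
    (∀ u ∈ M.arc i, circlePos q u < circlePos q p) ∨
      ∀ u ∈ M.arc i, circlePos q p < circlePos q u := by
  by_contra hc
  push Not at hc
  obtain ⟨⟨u, hu, h1⟩, v, hv, h2⟩ := hc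
  have hn : ∀ u, u ∈ M.arc i → circlePos q u ≠ circlePos q p := fun u hu e =>
    hp (circlePos_injective q e ▸ hu)
  exact hp (mem_arc_of_between hq hv hu (h2.lt_of_ne (hn v hv)) (h1.lt_of_ne (hn u hu).symm))

/-- An arc through the base point and another point has its complement on one side. -/
theorem notMem_pos_lt_or_gt {q p : UnitAddCircle} {i : ι} (hq : q ∈ M.arc i) (hp : p ∈ M.arc i) :
    (∀ u, u ∉ M.arc i → circlePos q u < circlePos q p) ∨
      ∀ u, u ∉ M.arc i → circlePos q p < circlePos q u := by
  by_contra hc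
  push Not at hc
  obtain ⟨⟨u, hu, h1⟩, v, hv, h2⟩ := hc
  have hn : ∀ u, u ∉ M.arc i → circlePos q u ≠ circlePos q p := fun u hu e =>
    hu (circlePos_injective q e ▸ hp)
  exact notMem_arc_of_between hq hv hu (h2.lt_of_ne (hn v hv)) (h1.lt_of_ne (hn u hu).symm) hp

/-- If two points of the first arc are missed by the second one, and they separate from the base
point some point missed by the first arc, then the second arc is contained in the first one. -/
theorem arc_subset_of_between {q h r u : UnitAddCircle} {i j : ι} (hqi : q ∈ M.arc i)
    (hqj : q ∈ M.arc j) (hh : h ∈ M.arc i) (hr : r ∈ M.arc i) (hu : u ∉ M.arc i)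
    (hhj : h ∉ M.arc j) (hrj : r ∉ M.arc j) (h1 : circlePos q h < circlePos q u)
    (h2 : circlePos q u < circlePos q r) : M.arc j ⊆ M.arc i := by
  intro z hz
  by_contra hzi
  have c1 := notMem_pos_lt_or_gt hqi hh
  have c2 := notMem_pos_lt_or_gt hqi hr
  -- The complement of `i` lies between `h` and `r`, and all points between these are missed by `j`.
  refine notMem_arc_of_between hqj hhj hrj ?_ ?_ hz
  · rcases c1 with c | c
    · exact absurd (c u hu) h1.asymm
    · exact c z hzi
  · rcases c2 with c | c
    · exact c z hzi
    · exact absurd (c u hu) h2.asymm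

variable {A B : ι}

theorem IsHCA.exists_common_reaches (hM : M.IsHCA)
    (h : CoverSetting M.intersectionGraph A B) {v : ι}
    (hv : ∀ X, Reaches M.intersectionGraph A B X → M.intersectionGraph.Adj X v) :
    ∃ p ∈ M.arc v, ∀ X, Reaches M.intersectionGraph A B X → p ∈ M.arc X := by
  obtain ⟨p, hp⟩ := hM.exists_common ({v} ∪ {X | Reaches M.intersectionGraph A B X}) (by
    rintro i (rfl | hi) j (rfl | hj) hij
    · exact absurd rfl hij
    · exact (hv j hj).symm
    · exact hv i hi
    · exact h.reaches_clique hi hj hij)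
  exact ⟨p, hp v (Or.inl rfl), fun X hX => hp X (Or.inr hX)⟩

/-- Cut at a common point `q` of `B` and the reaching arcs: the far arcs avoid `q` and are ordered
by position. By `hmax` no reaching arc that misses a far vertex contains the arc of `B`. Relative to
a point `p` shared by a far arc and all reaching arcs, this puts the complement of an arc violating
monotonicity upwards to the right of `p`, downwards to the left. Arcs of both kinds would contradict
`far_chain`, so the order or its reverse works. -/
theorem IsHCA.exists_sideOrder (hM : M.IsHCA) (h : CoverSetting M.intersectionGraph A B)
    (hmax : ∀ X, (∃ v, FarFrom M.intersectionGraph X v) →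
      (∀ x, ¬ FarFrom M.intersectionGraph B x → ¬ FarFrom M.intersectionGraph X x) →
      ∀ x, ¬ FarFrom M.intersectionGraph X x → ¬ FarFrom M.intersectionGraph B x) :
    ∃ lt, SideOrder M.intersectionGraph A B lt := by
  obtain ⟨a, ha, hall⟩ := h.exists_far_common
  obtain ⟨q, hqB, hqW⟩ := hM.exists_common_reaches h (v := B) fun X hX => hX.1.2
  obtain ⟨p, hpa, hpW⟩ := hM.exists_common_reaches h hall
  have far_notMem : ∀ {x u}, FarFrom M.intersectionGraph B x → u ∈ M.arc x → u ∉ M.arc B :=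
    fun hx hu hu' => hx.2 (adj_of_mem hx.1 hu hu')
  have hqf : ∀ {x}, FarFrom M.intersectionGraph B x → q ∉ M.arc x := fun hx hq =>
    far_notMem hx hq hqB
  have hsub : ∀ {X y}, Reaches M.intersectionGraph A B X → FarFrom M.intersectionGraph B y →
      ¬ M.intersectionGraph.Adj X y → ¬ M.arc B ⊆ M.arc X := by
    intro X y hX hy hXy hs
    have hyX : y ≠ X := fun e => hy.2 (e ▸ hX.1.2)
    -- Containment would give `X` a closed neighbourhood larger than that of `B`, with `a` as an
    -- additional member.
    refine hmax X ⟨y, hyX, fun h => hXy h.symm⟩ ?_ a (fun h => h.2 (hall X hX).symm) ha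
    intro x hx hxX
    by_cases hxB : x = B
    · exact hxX.2 (hxB ▸ hX.1.2.symm)
    · have : M.intersectionGraph.Adj x B := by_contra fun hc => hx ⟨hxB, hc⟩
      obtain ⟨-, w, hw, hw'⟩ := this
      exact hxX.2 (adj_of_mem hxX.1 hw (hs hw'))
  have hmiss : ∀ {X y u}, Reaches M.intersectionGraph A B X → FarFrom M.intersectionGraph B y →
      ¬ M.intersectionGraph.Adj X y → u ∈ M.arc y → u ∉ M.arc X := by
    intro X y u hX hy hXy hu hu'
    have hyX : y ≠ X := fun e => hy.2 (e ▸ hX.1.2)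
    exact hXy (adj_of_mem hyX.symm hu' hu)
  let lt : ι → ι → Prop := fun x y => (FarFrom M.intersectionGraph B x ∧
    FarFrom M.intersectionGraph B y) ∧ ∀ u ∈ M.arc x, ∀ v ∈ M.arc y, circlePos q u < circlePos q v
  have hdom : ∀ x y, lt x y → (FarFrom M.intersectionGraph B x ∧ FarFrom M.intersectionGraph B y) ∧
      x ≠ y ∧ ¬ M.intersectionGraph.Adj x y := by
    rintro x y ⟨hxy, hlt⟩
    refine ⟨hxy, ?_, ?_⟩
    · rintro rfl
      obtain ⟨u, hu⟩ := M.arc_nonempty x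
      exact lt_irrefl _ (hlt u hu u hu)
    · rintro ⟨-, u, hu, hu'⟩
      exact lt_irrefl _ (hlt u hu u hu')
  have htotal : ∀ x y, FarFrom M.intersectionGraph B x → FarFrom M.intersectionGraph B y →
      x ≠ y → ¬ M.intersectionGraph.Adj x y → lt x y ∨ lt y x := fun x y hx hy hne hxy =>
    (pos_lt_or_lt hne hxy (hqf hx) (hqf hy)).imp (fun h => ⟨⟨hx, hy⟩, h⟩) fun h => ⟨⟨hy, hx⟩, h⟩
  have htrans : ∀ x y z, lt x y → lt y z → lt x z := by
    rintro x y z ⟨hxy, h1⟩ ⟨hyz, h2⟩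
    obtain ⟨v, hv⟩ := M.arc_nonempty y
    exact ⟨⟨hxy.1, hyz.2⟩, fun u hu w hw => (h1 u hu v hv).trans (h2 v hv w hw)⟩
  have hup : ∀ {Y x y}, Reaches M.intersectionGraph A B Y → lt x y → M.intersectionGraph.Adj Y x →
      ¬ M.intersectionGraph.Adj Y y → ∀ u, u ∉ M.arc Y → circlePos q p < circlePos q u := by
    intro Y x y hY hxy hYx hYy
    refine (notMem_pos_lt_or_gt (hqW Y hY) (hpW Y hY)).resolve_left fun hc => ?_
    obtain ⟨-, r, hrY, hrx⟩ := hYx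
    obtain ⟨v, hv⟩ := M.arc_nonempty y
    have hvY := hmiss hY hxy.1.2 hYy hv
    exact hsub hY hxy.1.2 hYy (arc_subset_of_between (hqW Y hY) hqB hrY (hpW Y hY) hvY
      (far_notMem hxy.1.1 hrx) (far_notMem ha hpa) (hxy.2 r hrx v hv) (hc v hvY))
  have hdn : ∀ {X x y}, Reaches M.intersectionGraph A B X → lt x y → M.intersectionGraph.Adj X y →
      ¬ M.intersectionGraph.Adj X x → ∀ u, u ∉ M.arc X → circlePos q u < circlePos q p := by
    intro X x y hX hxy hXy hXx
    refine (notMem_pos_lt_or_gt (hqW X hX) (hpW X hX)).resolve_right fun hc => ?_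
    obtain ⟨-, r, hrX, hry⟩ := hXy
    obtain ⟨v, hv⟩ := M.arc_nonempty x
    have hvX := hmiss hX hxy.1.1 hXx hv
    exact hsub hX hxy.1.1 hXx (arc_subset_of_between (hqW X hX) hqB (hpW X hX) hrX hvX
      (far_notMem ha hpa) (far_notMem hxy.1.2 hry) (hc v hvX) (hxy.2 v hv r hry))
  by_cases hcase : ∀ X x y, Reaches M.intersectionGraph A B X → lt x y →
      M.intersectionGraph.Adj X x → M.intersectionGraph.Adj X y
  · exact ⟨lt, hdom, htotal, htrans, hcase⟩
  push Not at hcase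
  obtain ⟨Y, x', y', hY, hxy', hYx, hYy⟩ := hcase
  refine ⟨fun x y => lt y x, fun x y hxy => ?_,
    fun x y hx hy hne hxy => (htotal x y hx hy hne hxy).symm, fun x y z h1 h2 => htrans _ _ _ h2 h1, ?_⟩
  · obtain ⟨h1, h2, h3⟩ := hdom y x hxy
    exact ⟨h1.symm, h2.symm, fun h => h3 h.symm⟩
  · intro X y x hX hxy hXy
    by_contra hXx
    have hYd := hup hY hxy' hYx hYy
    have hXd := hdn hX hxy hXy hXx
    obtain ⟨v, hv⟩ := M.arc_nonempty x
    obtain ⟨v', hv'⟩ := M.arc_nonempty y'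
    have hvX := hXd v (hmiss hX hxy.1.1 hXx hv)
    have hvY := hYd v' (hmiss hY hxy'.1.2 hYy hv')
    have hYv : v ∈ M.arc Y := by_contra fun hc => absurd (hYd v hc) hvX.asymm
    have hXv : v' ∈ M.arc X := by_contra fun hc => absurd (hXd v' hc) hvY.asymm
    have e1 : Y ≠ x := fun e => hxy.1.1.2 (e ▸ hY.1.2)
    have e2 : X ≠ y' := fun e => hxy'.1.2.2 (e ▸ hX.1.2)
    exact h.far_chain hX hY hxy'.1.2 hxy.1.1 (adj_of_mem e2 hXv hv') hYy
      (adj_of_mem e1 hYv hv) hXx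

/-- Inner arcs avoid both `p` and `q`, so each component lies in one of the two pieces they cut from
the circle; order it by distance from `p`. An arc reaching the first side contains `p`; if it also
contains `q` it reaches both sides and `adj_mid` applies, otherwise it is an interval around `p`.
For the second side, complements are used instead. -/
theorem IsHCA.exists_innerOrder (hM : M.IsHCA) (h : CoverSetting M.intersectionGraph A B) :
    ∃ lt, InnerOrder M.intersectionGraph A B (InnerConn M.intersectionGraph A B) lt := by
  obtain ⟨a, ha, hall⟩ := h.exists_far_common
  obtain ⟨b, hb, hall'⟩ := h.symm.exists_far_common
  obtain ⟨p, hpa, hpW⟩ := hM.exists_common_reaches h hall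
  obtain ⟨q, hqb, hqE⟩ := hM.exists_common_reaches h.symm hall'
  have hp : ∀ {x}, IsInner M.intersectionGraph A B x → p ∉ M.arc x := fun hx hpx =>
    CoverSetting.inner_not_adj_far hx ha (adj_of_mem (fun e => ha.2 (e ▸ hx.1.2)) hpx hpa)
  have hq : ∀ {x}, IsInner M.intersectionGraph A B x → q ∉ M.arc x := fun hx hqx =>
    CoverSetting.inner_not_adj_far' hx hb (adj_of_mem (fun e => hb.2 (e ▸ hx.1.1)) hqx hqb)
  have hside : ∀ {x y}, IsInner M.intersectionGraph A B x → InnerConn M.intersectionGraph A B x y →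
      (∀ u ∈ M.arc x, circlePos q u < circlePos q p) →
      ∀ u ∈ M.arc y, circlePos q u < circlePos q p := by
    intro x y hx hxy hl
    induction hxy with
    | refl => exact hl
    | @tail y z _ hyz ih =>
      obtain ⟨⟨-, v, hv, hv'⟩, hy, hz⟩ := hyz
      refine (pos_lt_or_gt (hq hz) (hp hz)).resolve_right fun hc => ?_
      exact (ih v hv).asymm (hc v hv')
  have hside2 : ∀ {x y}, IsInner M.intersectionGraph A B x → InnerConn M.intersectionGraph A B x y →
      ((∀ u ∈ M.arc x, circlePos q u < circlePos q p) ∧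
        ∀ u ∈ M.arc y, circlePos q u < circlePos q p) ∨
      ((∀ u ∈ M.arc x, circlePos q p < circlePos q u) ∧
        ∀ u ∈ M.arc y, circlePos q p < circlePos q u) := by
    intro x y hx hxy
    have hy := hxy.inner hx
    rcases pos_lt_or_gt (hq hx) (hp hx) with hl | hl
    · exact Or.inl ⟨hl, hside hx hxy hl⟩
    · refine Or.inr ⟨hl, (pos_lt_or_gt (hq hy) (hp hy)).resolve_left fun hc => ?_⟩
      obtain ⟨u, hu⟩ := M.arc_nonempty x
      exact (hl u hu).asymm (hside hy hxy.symm hc u hu)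
  let key : UnitAddCircle → ℝ := fun u => |circlePos q u - circlePos q p|
  have keyl : ∀ {u}, circlePos q u < circlePos q p → key u = circlePos q p - circlePos q u :=
    fun hu => by simp only [key]; rw [abs_of_neg (by linarith)]; ring
  have keyr : ∀ {u}, circlePos q p < circlePos q u → key u = circlePos q u - circlePos q p :=
    fun hu => by simp only [key]; rw [abs_of_pos (by linarith)]
  refine ⟨fun x y => (IsInner M.intersectionGraph A B x ∧ IsInner M.intersectionGraph A B y) ∧
    InnerConn M.intersectionGraph A B x y ∧ ∀ u ∈ M.arc x, ∀ v ∈ M.arc y, key u < key v,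
    ?_, ?_, ?_, ?_, ?_⟩
  · rintro x y ⟨hxy, hc, hlt⟩
    refine ⟨hxy, hc, ?_, ?_⟩
    · rintro rfl
      obtain ⟨u, hu⟩ := M.arc_nonempty x
      exact lt_irrefl _ (hlt u hu u hu)
    · rintro ⟨-, u, hu, hu'⟩
      exact lt_irrefl _ (hlt u hu u hu')
  · intro x y hx hy hc hne hxy
    rcases hside2 hx hc with ⟨s1, s2⟩ | ⟨s1, s2⟩ <;>
      rcases pos_lt_or_lt hne hxy (hq hx) (hq hy) with hl | hl
    · refine Or.inr ⟨⟨hy, hx⟩, hc.symm, fun u hu v hv => ?_⟩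
      rw [keyl (s2 u hu), keyl (s1 v hv)]
      linarith [hl v hv u hu]
    · refine Or.inl ⟨⟨hx, hy⟩, hc, fun u hu v hv => ?_⟩
      rw [keyl (s1 u hu), keyl (s2 v hv)]
      linarith [hl v hv u hu]
    · refine Or.inl ⟨⟨hx, hy⟩, hc, fun u hu v hv => ?_⟩
      rw [keyr (s1 u hu), keyr (s2 v hv)]
      linarith [hl u hu v hv]
    · refine Or.inr ⟨⟨hy, hx⟩, hc.symm, fun u hu v hv => ?_⟩
      rw [keyr (s2 u hu), keyr (s1 v hv)]
      linarith [hl u hu v hv]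
  · rintro x y z ⟨hxy, c1, h1⟩ ⟨hyz, c2, h2⟩
    obtain ⟨v, hv⟩ := M.arc_nonempty y
    exact ⟨⟨hxy.1, hyz.2⟩, c1.trans c2, fun u hu w hw => (h1 u hu v hv).trans (h2 v hv w hw)⟩
  · rintro X x y hX ⟨⟨hx, hy⟩, hc, hlt⟩ hXy
    have hXx : X ≠ x := fun e => hx.2.1 (e ▸ hX)
    by_cases hqX : q ∈ M.arc X
    · exact h.adj_mid hX ⟨hX.1.symm, b, hb,
        adj_of_mem (fun e => hb.2 (e ▸ hX.1.1)) hqX hqb⟩ hx.1 hXx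
    · obtain ⟨-, r, hrX, hry⟩ := hXy
      obtain ⟨u, hu⟩ := M.arc_nonempty x
      refine adj_of_mem hXx ?_ hu
      have hur := hlt u hu r hry
      rcases hside2 hx hc with ⟨s1, s2⟩ | ⟨s1, s2⟩
      · rw [keyl (s1 u hu), keyl (s2 r hry)] at hur
        exact mem_arc_of_between hqX hrX (hpW X hX) (by linarith) (s1 u hu)
      · rw [keyr (s1 u hu), keyr (s2 r hry)] at hur
        exact mem_arc_of_between hqX (hpW X hX) hrX (s1 u hu) (by linarith)
  · rintro Y x y hY ⟨⟨hx, hy⟩, hc, hlt⟩ hYx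
    have hYy : Y ≠ y := fun e => hy.2.2 (e ▸ hY)
    by_cases hpY : p ∈ M.arc Y
    · exact h.adj_mid ⟨hY.1.symm, a, ha,
        adj_of_mem (fun e => ha.2 (e ▸ hY.1.1)) hpY hpa⟩ hY hy.1 hYy
    · obtain ⟨-, r, hrY, hrx⟩ := hYx
      obtain ⟨v, hv⟩ := M.arc_nonempty y
      refine adj_of_mem hYy (by_contra fun hvY => ?_) hv
      have hrv := hlt r hrx v hv
      rcases hside2 hx hc with ⟨s1, s2⟩ | ⟨s1, s2⟩
      · rw [keyl (s1 r hrx), keyl (s2 v hv)] at hrv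
        exact notMem_arc_of_between (hqE Y hY) hvY hpY (by linarith) (s1 r hrx) hrY
      · rw [keyr (s1 r hrx), keyr (s2 v hv)] at hrv
        exact notMem_arc_of_between (hqE Y hY) hpY hvY (s1 r hrx) (by linarith) hrY

/-- A Helly model without forbidden induced submodels and with a cover pair of non-universal vertices
has an interval order. -/
theorem IsHCA.exists_intervalOrder (hM : M.IsHCA) (hG : ForbiddenFree M.intersectionGraph)
    (hp : CoverPair M.intersectionGraph A B) (hA : ∃ v, FarFrom M.intersectionGraph A v)
    (hB : ∃ v, FarFrom M.intersectionGraph B v) :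
    ∃ lt, IntervalOrder M.intersectionGraph lt := by
  -- The given pair only shows that candidates exist; a pair maximal in total neighbourhood size
  -- supplies the maximality required on both sides.
  obtain ⟨⟨A, B⟩, ⟨hp, hA, hB⟩, hmax⟩ := Set.exists_max_image
    {P : ι × ι | CoverPair M.intersectionGraph P.1 P.2 ∧
      (∃ v, FarFrom M.intersectionGraph P.1 v) ∧ ∃ v, FarFrom M.intersectionGraph P.2 v}
    (fun P => {x | ¬ FarFrom M.intersectionGraph P.1 x}.ncard +
      {x | ¬ FarFrom M.intersectionGraph P.2 x}.ncard) (Set.toFinite _) ⟨(A, B), hp, hA, hB⟩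
  have nfar : ∀ {x y}, ¬ FarFrom M.intersectionGraph x y ↔
      y = x ∨ M.intersectionGraph.Adj y x := by
    intro x y; simp only [FarFrom]; tauto
  have key : ∀ {A B}, CoverPair M.intersectionGraph A B →
      (∃ v, FarFrom M.intersectionGraph A v) →
      (∀ X, CoverPair M.intersectionGraph A X → (∃ v, FarFrom M.intersectionGraph X v) →
        {x | ¬ FarFrom M.intersectionGraph X x}.ncard ≤
          {x | ¬ FarFrom M.intersectionGraph B x}.ncard) →
      ∀ X, (∃ v, FarFrom M.intersectionGraph X v) →
      (∀ x, ¬ FarFrom M.intersectionGraph B x → ¬ FarFrom M.intersectionGraph X x) →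
      ∀ x, ¬ FarFrom M.intersectionGraph X x → ¬ FarFrom M.intersectionGraph B x := by
    intro A B hp hA hmax X hX hsub
    -- A non-universal `X` dominating `B` can replace it in the pair. It is not `A`, since the cover
    -- condition would then make `A` universal.
    have hAX : A ≠ X := by
      rintro rfl
      obtain ⟨v, hv⟩ := hA
      exact hv.2 ((hp.cover v v (Or.inl rfl)).elim (fun h => absurd hv (nfar.2 h))
        fun h => absurd hv (hsub v (nfar.2 h)))
    have hpX : CoverPair M.intersectionGraph A X :=
      ⟨(nfar.1 (hsub A (nfar.2 (Or.inr hp.adj)))).resolve_left hAX, fun x y hxy =>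
        (hp.cover x y hxy).imp id fun h => nfar.1 (hsub _ (nfar.2 h))⟩
    have := Set.eq_of_subset_of_ncard_le (s := {x | ¬ FarFrom M.intersectionGraph B x}) hsub
      (hmax X hpX hX) (Set.toFinite _)
    intro x hx
    have h' : x ∈ {x | ¬ FarFrom M.intersectionGraph X x} := hx
    rwa [← this] at h'
  have h : CoverSetting M.intersectionGraph A B := ⟨hG, hM.netFree, hp, hA, hB⟩
  obtain ⟨la, hla⟩ := hM.exists_sideOrder h (key hp hA fun X hX hX' => by
    have := hmax (A, X) ⟨hX, hA, hX'⟩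
    simp only at this
    omega)
  obtain ⟨lb, hlb⟩ := hM.exists_sideOrder h.symm (key hp.symm hB fun X hX hX' => by
    have := hmax (X, B) ⟨hX.symm, hX', hB⟩
    simp only at this
    omega)
  obtain ⟨lc, hlc⟩ := hM.exists_innerOrder h
  obtain ⟨li, hli⟩ := h.exists_innerOrder hlc
  exact h.exists_intervalOrder hla hlb hli

end CircularArcModel

/-! ### Covering the circle when some vertex is universal. -/

namespace CircularArcModel

variable {ι : Type*} [Finite ι] {M : CircularArcModel ι}

theorem isOpen_arc (M : CircularArcModel ι) (i : ι) : IsOpen (M.arc i) := by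
  obtain ⟨a, b, -, -, -, -, h⟩ := exists_cIoo_eq_image (M.s_ne_t i i)
  rw [arc, h]
  exact QuotientAddGroup.isOpenMap_coe _ isOpen_Ioo

/-- An arc meets every arc through one of its extremes. -/
theorem inter_nonempty_of_extreme {i j : ι} (h : M.s i ∈ M.arc j ∨ M.t i ∈ M.arc j) :
    (M.arc i ∩ M.arc j).Nonempty := by
  obtain ⟨a, b, hab, -, ha, hb, he⟩ := exists_cIoo_eq_image (M.s_ne_t i i)
  have hO : IsOpen ((fun x : ℝ => (x : UnitAddCircle)) ⁻¹' M.arc j) :=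
    (M.isOpen_arc j).preimage (AddCircle.continuous_mk' 1)
  have : ∃ c ∈ Set.Icc a b, c ∈ (fun x : ℝ => (x : UnitAddCircle)) ⁻¹' M.arc j := by
    rcases h with h | h
    · exact ⟨a, ⟨le_rfl, hab.le⟩, by rwa [Set.mem_preimage, ha]⟩
    · exact ⟨b, ⟨hab.le, le_rfl⟩, by rwa [Set.mem_preimage, hb]⟩
  obtain ⟨c, hc, hcj⟩ := this
  rw [← closure_Ioo hab.ne, mem_closure_iff] at hc
  obtain ⟨x, hx, hx'⟩ := hc _ hO hcj
  refine ⟨x, ?_, hx⟩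
  rw [arc, he]
  exact ⟨x, hx', rfl⟩

/-- Measuring from the arc's own ending point makes its complement a closed initial segment of
positions, along which walks outside the arc proceed. -/
theorem mem_arc_iff_of_end (M : CircularArcModel ι) (i : ι) (x : UnitAddCircle) :
    x ∈ M.arc i ↔ circlePos (M.t i) (M.s i) < circlePos (M.t i) x := by
  rw [arc, mem_cIoo_iff (M.t i), circlePos_self]
  have := circlePos_nonneg (M.t i) x
  have := circlePos_pos (M.s_ne_t i i)
  grind

theorem s_notMem_arc (M : CircularArcModel ι) (i : ι) : M.s i ∉ M.arc i := fun h =>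
  lt_irrefl _ ((M.mem_arc_iff_of_end i _).1 h)

theorem t_notMem_arc (M : CircularArcModel ι) (i : ι) : M.t i ∉ M.arc i := fun h => by
  have := (M.mem_arc_iff_of_end i _).1 h
  rw [circlePos_self] at this
  exact absurd this (not_lt.2 (circlePos_nonneg _ _))

/-- Two arcs that cover the circle form a cover pair. -/
theorem coverPair_of_union {A B : ι} (hne : A ≠ B) (h : M.arc A ∪ M.arc B = Set.univ) :
    CoverPair M.intersectionGraph A B := by
  have hc : ∀ p, p ∈ M.arc A ∨ p ∈ M.arc B := fun p => (Set.ext_iff.1 h p).2 trivial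
  refine ⟨⟨hne, inter_nonempty_of_extreme
    (Or.inl ((hc _).resolve_left (M.s_notMem_arc A)))⟩, fun x y hxy => ?_⟩
  by_contra hn
  push Not at hn
  obtain ⟨⟨h1, h2⟩, h3, h4⟩ := hn
  have : ∃ p, p ∈ M.arc x ∧ p ∈ M.arc y := by
    rcases hxy with rfl | ⟨-, p, hp⟩
    · exact (M.arc_nonempty x).imp fun p hp => ⟨hp, hp⟩
    · exact ⟨p, hp⟩
  obtain ⟨p, hx, hy⟩ := this
  rcases hc p with hp | hp
  · exact h2 (adj_of_mem h1 hx hp)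
  · exact h4 (adj_of_mem h3 hy hp)

/-- The graph in which two arcs are adjacent if they have a common point outside the arc `A`. -/
def outerGraph (M : CircularArcModel ι) (A : ι) : SimpleGraph ι where
  Adj i j := i ≠ j ∧ ∃ p, p ∈ M.arc i ∧ p ∈ M.arc j ∧ p ∉ M.arc A
  symm := ⟨fun _ _ ⟨h, p, h1, h2, h3⟩ => ⟨h.symm, p, h2, h1, h3⟩⟩
  loopless := ⟨fun _ h => h.1 rfl⟩

/-- If the arcs of a family cover the complement of `A`, then a walk of its members, any two
consecutive ones meeting outside `A`, joins the end of `A` to its beginning. -/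
theorem exists_outer_walk {A : ι} {N : ι → Prop} (hN : ∀ p, p ∉ M.arc A → ∃ i, N i ∧ p ∈ M.arc i)
    {Y : ι} (hY : N Y) (htY : M.t A ∈ M.arc Y) :
    ∃ T, (N T ∧ M.s A ∈ M.arc T) ∧
      Relation.ReflTransGen (fun u v => (M.outerGraph A).Adj u v ∧ N v) Y T := by
  -- The complement of `A` is a connected segment. If no arc through the beginning of `A` were
  -- reachable, reachable and unreachable arcs would cover it by two open sets, which must meet on
  -- it; a common point there makes an unreachable arc reachable.
  let R : ι → Prop := Relation.ReflTransGen (fun u v => (M.outerGraph A).Adj u v ∧ N v) Y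
  let γ : ℝ → UnitAddCircle := fun r => M.t A + (r : UnitAddCircle)
  have hγ : Continuous γ := continuous_const.add (AddCircle.continuous_mk' 1)
  let σ := circlePos (M.t A) (M.s A)
  have hσ : 0 ≤ σ := circlePos_nonneg _ _
  have hout : ∀ r ∈ Set.Icc 0 σ, γ r ∉ M.arc A := by
    rintro r ⟨h0, h1⟩
    rw [mem_arc_iff_of_end, circlePos_add_coe _ h0 (h1.trans_lt (circlePos_lt_one _ _))]
    exact not_lt.2 h1
  have hγσ : γ σ = M.s A := add_coe_circlePos _ _
  have hRN : ∀ i, R i → N i := by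
    intro i hi
    cases hi with
    | refl => exact hY
    | tail _ h => exact h.2
  by_contra hc
  push Not at hc
  obtain ⟨T, hT, hsT⟩ := hN _ (M.s_notMem_arc A)
  have hU : ∀ P : ι → Prop, IsOpen (γ ⁻¹' ⋃ i, ⋃ (_ : P i), M.arc i) := fun P =>
    (isOpen_iUnion fun i => isOpen_iUnion fun _ => M.isOpen_arc i).preimage hγ
  have hsub : Set.Icc 0 σ ⊆ (γ ⁻¹' ⋃ i, ⋃ (_ : R i), M.arc i) ∪
      (γ ⁻¹' ⋃ i, ⋃ (_ : N i ∧ ¬ R i), M.arc i) := by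
    intro r hr
    obtain ⟨i, hi, hi'⟩ := hN _ (hout r hr)
    simp only [Set.mem_union, Set.mem_preimage, Set.mem_iUnion, exists_prop]
    by_cases h : R i
    · exact Or.inl ⟨i, h, hi'⟩
    · exact Or.inr ⟨i, ⟨hi, h⟩, hi'⟩
  have hstart : 0 ∈ γ ⁻¹' ⋃ i, ⋃ (_ : R i), M.arc i := by
    simp only [Set.mem_preimage, Set.mem_iUnion, exists_prop]
    refine ⟨Y, .refl, ?_⟩
    simpa [γ] using htY
  have hend : σ ∈ γ ⁻¹' ⋃ i, ⋃ (_ : N i ∧ ¬ R i), M.arc i := by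
    simp only [Set.mem_preimage, Set.mem_iUnion, exists_prop]
    exact ⟨T, ⟨hT, fun h => hc T ⟨hT, hsT⟩ h⟩, by rwa [hγσ]⟩
  obtain ⟨r, hr, h1, h2⟩ := isPreconnected_Icc _ _ (hU R) (hU fun i => N i ∧ ¬ R i) hsub
    ⟨0, ⟨le_rfl, hσ⟩, hstart⟩ ⟨σ, ⟨hσ, le_rfl⟩, hend⟩
  simp only [Set.mem_preimage, Set.mem_iUnion, exists_prop] at h1 h2
  obtain ⟨i, hi, hi'⟩ := h1
  obtain ⟨j, ⟨hj, hjR⟩, hj'⟩ := h2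
  refine hjR (Relation.ReflTransGen.tail hi ⟨⟨?_, _, hi', hj', hout r hr⟩, hj⟩)
  rintro rfl
  exact hjR hi

/-- If some vertex is universal and no two of the other arcs cover the circle, then some point lies
in universal arcs only. -/
theorem IsHCA.exists_notMem_of_universal (hM : M.IsHCA) (hG : ForbiddenFree M.intersectionGraph)
    (hcov : ∀ i j, i ≠ j → (∃ v, FarFrom M.intersectionGraph i v) →
      (∃ v, FarFrom M.intersectionGraph j v) → ∃ p, p ∉ M.arc i ∧ p ∉ M.arc j)
    {u : ι} (hu : ∀ v, ¬ FarFrom M.intersectionGraph u v) :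
    ∃ p, ∀ i, (∃ v, FarFrom M.intersectionGraph i v) → p ∉ M.arc i := by
  let N : ι → Prop := fun i => ∃ v, FarFrom M.intersectionGraph i v
  by_contra hc
  push Not at hc
  have hN : ∀ p, ∃ i, N i ∧ p ∈ M.arc i := hc
  -- An inclusion-maximal arc closes the chain: a shortest walk outside it from its end to its
  -- beginning will form the rim of a wheel.
  obtain ⟨A, hA, hAmax⟩ := Set.Finite.exists_maximalFor M.arc {i | N i} (Set.toFinite _)
    ((hN (M.s u)).imp fun i hi => hi.1)
  have huN : ∀ i, N i → M.intersectionGraph.Adj u i := by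
    intro i hi
    have hne : i ≠ u := by
      rintro rfl
      obtain ⟨v, hv⟩ := hi
      exact hu v hv
    by_contra h
    exact hu i ⟨hne, fun h' => h h'.symm⟩
  obtain ⟨Y, hY, htY⟩ := hN (M.t A)
  obtain ⟨T, hT, hwalk⟩ := exists_outer_walk (M := M) (A := A) (N := N) (fun p _ => hN p) hY htY
  obtain ⟨k, f, hf, ⟨f0, ht0⟩, ⟨fk, hsk⟩, hfN, hft, hfs⟩ := exists_isInducedPath (M.outerGraph A)
    (S := fun i => N i ∧ M.t A ∈ M.arc i) (T := fun i => N i ∧ M.s A ∈ M.arc i) (D := N)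
    ⟨hY, htY⟩ hT hY hwalk
  have hft : ∀ i, 0 < i → i ≤ k → M.t A ∉ M.arc (f i) := fun i h0 hi h => hft i h0 hi ⟨hfN i hi, h⟩
  have hfs : ∀ i < k, M.s A ∉ M.arc (f i) := fun i hi h => hfs i hi ⟨hfN i hi.le, h⟩
  have hA0 : A ≠ f 0 := by rintro h; exact M.t_notMem_arc A (h ▸ ht0)
  have hAk : A ≠ f k := by rintro h; exact M.s_notMem_arc A (h ▸ hsk)
  have adj0 : M.intersectionGraph.Adj A (f 0) := ⟨hA0, inter_nonempty_of_extreme (Or.inr ht0)⟩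
  have adjk : M.intersectionGraph.Adj A (f k) := ⟨hAk, inter_nonempty_of_extreme (Or.inl hsk)⟩
  have hmemA := M.mem_arc_iff_of_end A
  have houter : ∀ {x}, x ∉ M.arc A → x ≠ M.s A →
      circlePos (M.t A) x < circlePos (M.t A) (M.s A) := by
    intro x hx hne
    rw [hmemA, not_lt] at hx
    exact hx.lt_of_ne fun e => hne (circlePos_injective _ e)
  have hto : ∀ {i j}, (M.outerGraph A).Adj i j → M.intersectionGraph.Adj i j :=
    fun ⟨h, p, h1, h2, _⟩ => ⟨h, p, h1, h2⟩
  have three : ∀ {i j l}, N i → N j → N l → M.intersectionGraph.Adj i j →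
      M.intersectionGraph.Adj i l → M.intersectionGraph.Adj j l →
      ∃ p, p ∉ M.arc i ∧ p ∉ M.arc j ∧ p ∉ M.arc l := by
    intro i j l hi hj hl hij hil hjl
    obtain ⟨m, m1, m2, m3⟩ := hM.exists_common_three (Or.inr hij) (Or.inr hil) (Or.inr hjl)
    obtain ⟨p1, hp1⟩ := hcov i j hij.ne hi hj
    obtain ⟨p2, hp2⟩ := hcov i l hil.ne hi hl
    obtain ⟨p3, hp3⟩ := hcov j l hjl.ne hj hl
    exact exists_notMem_three m1 m2 m3 hp1 hp2 hp3
  rcases (by omega : k = 0 ∨ k = 1 ∨ 2 ≤ k) with rfl | rfl | hk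
  -- A single arc through both extremes of `A` either contains `A` properly or covers the circle
  -- together with it.
  · rcases notMem_pos_lt_or_gt ht0 hsk with h | h
    · refine M.t_notMem_arc A (hAmax (hfN 0 le_rfl) (fun x hx => by_contra fun hc => ?_) ht0)
      exact (h x hc).asymm ((hmemA x).1 hx)
    · obtain ⟨p, hp1, hp2⟩ := hcov A (f 0) hA0 hA (hfN 0 le_rfl)
      exact hp1 ((hmemA p).2 (h p hp2))
  -- The pairwise intersecting `A`, `f 0`, `f 1` miss a common point `p`. Travelling outside `A`
  -- past the meeting point `r` of `f 0` and `f 1`, however, `p` belongs to one of them.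
  · have h01 := ((hf 0 1 one_pos le_rfl).2).2 rfl
    obtain ⟨p, hpA, hp0, hp1⟩ := three hA (hfN 0 zero_le_one) (hfN 1 le_rfl) adj0 adjk (hto h01)
    obtain ⟨-, r, hr0, hr1, hrA⟩ := h01
    have hps := houter hpA fun e => hp1 (e ▸ hsk)
    have hrs := houter hrA fun e => hfs 0 one_pos (e ▸ hr0)
    rcases lt_trichotomy (circlePos (M.t A) p) (circlePos (M.t A) r) with h | h | h
    · exact notMem_arc_of_between ht0 hp0 (hfs 0 one_pos) h hrs hr0
    · exact hp0 (circlePos_injective _ h ▸ hr0)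
    · exact hp1 (mem_arc_of_between (hft 1 one_pos le_rfl) hr1 hsk h hps)
  · have hint : ∀ i, 0 < i → i < k → ∀ x ∈ M.arc (f i), x ∉ M.arc A := by
      intro i h0 hi x hx hxA
      obtain ⟨-, r, hr, -, hrA⟩ := ((hf i (i + 1) (by omega) hi).2).2 rfl
      have hne : r ≠ M.s A := fun e => hfs i hi (e ▸ hr)
      exact hfs i hi (mem_arc_of_between (hft i h0 hi.le) hr hx (houter hrA hne) ((hmemA x).1 hxA))
    have hadj : ∀ i j, i < j → j ≤ k → (i = 0 → j = k → False) →
        (M.intersectionGraph.Adj (f i) (f j) ↔ j = i + 1) := by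
      intro i j hij hj h0
      rw [← (hf i j hij hj).2]
      refine ⟨fun ⟨hne, x, hx, hx'⟩ => ⟨hne, x, hx, hx', ?_⟩, hto⟩
      by_cases hi0 : i = 0
      · exact hint j (by omega) (hj.lt_of_ne (h0 hi0)) x hx'
      · exact hint i (by omega) (by omega) x hx
    -- The interior arcs avoid `A`. If the end arcs meet, necessarily inside `A`, they close the rim
    -- themselves when `k ≥ 3`, while for `k = 2` a Helly point contradicts inducedness outside `A`.
    -- If they do not meet, `A` closes the rim.
    by_cases h0k : M.intersectionGraph.Adj (f 0) (f k)
    · by_cases hk2 : k = 2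
      · subst hk2
        obtain ⟨m, m0, m1, m2⟩ := hM.exists_common_three
          (Or.inr ((hadj 0 1 (by omega) (by omega) (by omega)).2 rfl)) (Or.inr h0k)
          (Or.inr ((hadj 1 2 (by omega) (by omega) (by omega)).2 rfl))
        have := ((hf 0 2 (by omega) le_rfl).2).1
          ⟨h0k.ne, m, m0, m2, hint 1 one_pos (by omega) m m1⟩
        omega
      · refine hG.no_wheel (k := k - 1) (by omega) (f := f) (z := f k) (h := u)
          (fun i j hij hj => ⟨(hf i j hij (by omega)).1, hadj i j hij (by omega) (by omega)⟩)
          h0k.symm ?_ ?_ (huN _ fk) fun i hi => huN _ (hfN i (by omega))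
        · exact ((hadj (k - 1) k (by omega) le_rfl (by omega)).2 (by omega)).symm
        · intro i h0 hi
          refine ⟨(hf i k (by omega) le_rfl).1.symm, fun h => ?_⟩
          have := (hadj i k (by omega) le_rfl (by omega)).1 h.symm
          omega
    · refine hG.no_wheel hk (f := f) (z := A) (h := u) ?_ adj0 adjk ?_ (huN _ hA)
        fun i hi => huN _ (hfN i hi)
      · intro i j hij hj
        refine ⟨(hf i j hij hj).1, ?_⟩
        by_cases h : i = 0 ∧ j = k
        · obtain ⟨rfl, rfl⟩ := h
          exact ⟨fun h => absurd h h0k, fun h => by omega⟩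
        · exact hadj i j hij hj fun h1 h2 => h ⟨h1, h2⟩
      · intro i h0 hi
        refine ⟨?_, ?_⟩
        · rintro rfl
          obtain ⟨x, hx⟩ := M.arc_nonempty (f i)
          exact hint i h0 hi x hx hx
        · rintro ⟨-, x, hx, hx'⟩
          exact hint i h0 hi x hx' hx

/-! ### Sufficiency and the theorem. -/

/-- A Helly model without forbidden induced submodels is equivalent to a normal Helly model. -/
theorem IsHCA.exists_isNHCA (hM : M.IsHCA) (hG : ForbiddenFree M.intersectionGraph) :
    ∃ (κ : Type) (_ : Finite κ) (N : CircularArcModel κ), N.IsNHCA ∧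
      Nonempty (M.intersectionGraph ≃g N.intersectionGraph) := by
  classical
  by_cases hN : M.IsNCA
  · exact IsNHCA.exists_type ⟨hN, hM⟩
  by_cases hpair : ∃ i j, i ≠ j ∧ M.arc i ∪ M.arc j = Set.univ ∧
      (∃ v, FarFrom M.intersectionGraph i v) ∧ ∃ v, FarFrom M.intersectionGraph j v
  · obtain ⟨i, j, hne, hij, hi, hj⟩ := hpair
    obtain ⟨lt, hlt⟩ := hM.exists_intervalOrder hG (coverPair_of_union hne hij) hi hj
    exact hlt.exists_isNHCA
  have hcov : ∀ i j, i ≠ j → (∃ v, FarFrom M.intersectionGraph i v) →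
      (∃ v, FarFrom M.intersectionGraph j v) → ∃ p, p ∉ M.arc i ∧ p ∉ M.arc j := by
    intro i j hne hi hj
    by_contra hc
    push Not at hc
    refine hpair ⟨i, j, hne, Set.eq_univ_of_forall fun p => ?_, hi, hj⟩
    exact or_iff_not_imp_left.2 (hc p)
  -- The model is not normal, so some pair covers the circle, and by the previous case one of its
  -- members must be universal.
  have huniv : ∃ u, ∀ v, ¬ FarFrom M.intersectionGraph u v := by
    by_contra hc
    push Not at hc
    exact hN fun i j hne hij => hpair ⟨i, j, hne, hij, hc i, hc j⟩
  obtain ⟨u, hu⟩ := huniv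
  obtain ⟨p, hp⟩ := hM.exists_notMem_of_universal hG hcov hu
  have hun : ∀ v w, (¬ ∃ x, FarFrom M.intersectionGraph v x) → v ≠ w →
      M.intersectionGraph.Adj w v := fun v w hv hne =>
    by_contra fun h => hv ⟨w, hne.symm, h⟩
  -- Cutting at `p` makes every non-universal arc an interval; a universal arc may pass through `p`
  -- and is replaced by the whole line, which meets every other set as required.
  refine (intervalOrder_of_ordConnected (G := M.intersectionGraph)
    (fun v => if ∃ x, FarFrom M.intersectionGraph v x then circlePos p '' M.arc v else Set.univ)
    (fun v => ?_) (fun v => ?_) fun v w hne => ?_).exists_isNHCA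
  · split_ifs
    · exact (M.arc_nonempty v).image _
    · exact Set.univ_nonempty
  · split_ifs with hv
    · exact ordConnected_circlePos_image fun u hu w hw x => mem_arc_of_between (hp v hv) hu hw
    · exact Set.ordConnected_univ
  · split_ifs with hv hw hw
    · rw [← Set.image_inter (circlePos_injective p), Set.image_nonempty, adj_iff]
      exact ⟨fun h => h.2, fun h => ⟨hne, h⟩⟩
    · simp [hun w v hw hne.symm, M.arc_nonempty v]
    · simp [(hun v w hv hne).symm, M.arc_nonempty w]
    · simp [(hun v w hv hne).symm]

theorem hasInducedSubmodelOf_iff {V : Type*} {H : SimpleGraph V} :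
    M.HasInducedSubmodelOf H ↔ H.IsIndContained M.intersectionGraph := by
  constructor
  · rintro ⟨F, ⟨e⟩⟩
    exact ⟨SimpleGraph.Embedding.comp (⟨Function.Embedding.subtype _, Iff.intro
      (fun h => ⟨fun e => h.1 (congrArg _ e), h.2⟩)
      (fun h => ⟨fun e => h.1 (Subtype.ext e), h.2⟩)⟩ :
        (M.submodel F).intersectionGraph ↪g M.intersectionGraph) e.symm.toEmbedding⟩
  · rintro ⟨φ⟩
    refine ⟨Set.range φ, ⟨(RelIso.symm ⟨Equiv.ofInjective φ φ.injective, ?_⟩)⟩⟩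
    intro v w
    rw [← φ.map_adj_iff]
    exact ⟨fun h => ⟨fun e => h.1 (Subtype.ext e), h.2⟩,
      fun h => ⟨fun e => h.1 (congrArg Subtype.val e), h.2⟩⟩

end CircularArcModel

theorem ForbiddenFree.of_iso {V W : Type*} {G : SimpleGraph V} {H : SimpleGraph W} (e : G ≃g H)
    (h : ForbiddenFree G) : ForbiddenFree H where
  wheel n hn := fun ⟨φ⟩ => h.wheel n hn ⟨e.symm.toEmbedding.comp φ⟩
  sun := fun ⟨φ⟩ => h.sun ⟨e.symm.toEmbedding.comp φ⟩
  risingSun n hn := fun ⟨φ⟩ => h.risingSun n hn ⟨e.symm.toEmbedding.comp φ⟩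
  umbrella := fun ⟨φ⟩ => h.umbrella ⟨e.symm.toEmbedding.comp φ⟩

theorem mainTheorem2 :
    (∀ (ι : Type*) [Finite ι] (M : CircularArcModel ι), M.IsHCA →
      ((∃ (κ : Type) (_ : Finite κ) (N : CircularArcModel κ), N.IsNHCA ∧ M.Equivalent N) ↔
        (∀ n : ℕ, 4 ≤ n → ¬ M.HasInducedSubmodelOf (wheelGraph n)) ∧
        ¬ M.HasInducedSubmodelOf threeSunGraph ∧
        (∀ n : ℕ, 4 ≤ n → ¬ M.HasInducedSubmodelOf (risingSunGraph n)) ∧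
        ¬ M.HasInducedSubmodelOf umbrellaGraph)) ∧
    (∀ (V : Type*) [Finite V] (G : SimpleGraph V), IsHCAGraph G →
      (IsNHCAGraph G ↔
        (∀ n : ℕ, 4 ≤ n → ¬ (wheelGraph n).IsIndContained G) ∧
        ¬ threeSunGraph.IsIndContained G ∧
        (∀ n : ℕ, 4 ≤ n → ¬ (risingSunGraph n).IsIndContained G) ∧
        ¬ umbrellaGraph.IsIndContained G)) := by
  refine ⟨fun ι _ M hM => ?_, fun V _ G => ?_⟩
  · simp only [CircularArcModel.hasInducedSubmodelOf_iff]
    constructor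
    · rintro ⟨κ, _, N, hN, ⟨e⟩⟩
      have h := hN.forbiddenFree.of_iso e.symm
      exact ⟨h.wheel, h.sun, h.risingSun, h.umbrella⟩
    · rintro ⟨h1, h2, h3, h4⟩
      exact hM.exists_isNHCA ⟨h1, h2, h3, h4⟩
  · rintro ⟨ι, _, M, hM, ⟨e⟩⟩
    constructor
    · rintro ⟨κ, _, N, hN, ⟨e'⟩⟩
      have h := hN.forbiddenFree.of_iso e'
      exact ⟨h.wheel, h.sun, h.risingSun, h.umbrella⟩
    · rintro ⟨h1, h2, h3, h4⟩
      obtain ⟨κ, _, N, hN, ⟨e'⟩⟩ := hM.exists_isNHCA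
        (ForbiddenFree.of_iso e.symm ⟨h1, h2, h3, h4⟩)
      exact ⟨κ, inferInstance, N, hN, ⟨e'.symm.trans e⟩⟩
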